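/- Let $n\ge 1$, let $F$ be a field, and let $q,t\in F$ be nonzero with $q^at^b\neq 1$ for all integers $a\ge 1$, $b\ge 0$ (for example, $F=\mathbb Q(q,t)$ with $q,t$ indeterminates, or $0<q,t<1$ real). **Operators.** On $F[x_1,\dots,x_n]$ let $s_i$ interchange $x_i$ and $x_{i+1}$, let $\tau_i$ be the shift $x_i\mapsto qx_i$, and for $1\le i\le n-1$ put $$T_i=t+\frac{tx_i-x_{i+1}}{x_i-x_{i+1}}(s_i-1),\qquad T_i^{-1}=t^{-1}-1+t^{-1}T_i,\qquad \omega=s_{n-1}\cdots s_2s_1\tau_1 .$$ For $1\le i\le n$ and $i<j\le n$ put $$Y_i=t^{-n+i}\,T_i\cdots T_{n-1}\,\omega\,T_1^{-1}\cdots T_{i-1}^{-1},\qquad T_{ij}^{-1}=T_i^{-1}\cdots T_{j-2}^{-1}T_{j-1}^{-1}T_{j-2}^{-1}\cdots T_i^{-1},$$ $$D_i=x_i^{-1}\Bigl(1-t^{n-1}\Bigl[1+(t^{-1}-1)\sum_{j=i+1}^n t^{j-i}T_{ij}^{-1}\Bigr]Y_i\Bigr),$$ $$\Phi_q=x_nT_{n-1}^{-1}\cdots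 T_2^{-1}T_1^{-1},\qquad \widehat\Phi_q=T_1T_2\cdots T_{n-1}D_n .$$ For an operator $L$ built from $q,t$, let $\overline{L}$ be the operator obtained by replacing $q,t$ with $q^{-1},t^{-1}$. **Non-symmetric Macdonald polynomials.** For compositions $\nu,\eta\in\mathbb Z_{\ge0}^n$ write $|\eta|=\sum_i\eta_i$, let $\eta^+$ be the decreasing rearrangement of $\eta$, and let $\nu\le\eta$ denote dominance: $|\nu|=|\eta|$ and $\sum_{i\le p}\nu_i\le\sum_{i\le p}\eta_i$ for all $p$. For $\nu\ne\eta$ let $\nu\prec\eta$ mean that either $\nu^+\neq\eta^+$ and $\nu^+\le\eta^+$, or $\nu^+=\eta^+$ and $\nu\le\eta$. The polynomial $E_\eta(x;q,t)$ is defined by $$E_\eta=x^\eta+\sum_{\nu\prec\eta}b_{\eta\nu}x^\nu,\qquad Y_iE_\eta=q^{\eta_i}\,t^{-\#\{k<i:\,\eta_k\ge\eta_i\}-\#\{k>i:\,\eta_k>\eta_i\}}\,E_\eta\quad(1\le i\le n).$$ **Constants and kernel.** For a node $s=(i,j)$, $1\le j\le\eta_i$, of $\eta$ put $a(s)=\eta_i-j$,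 $a'(s)=j-1$, $$l(s)=\#\{k>i: j\le\eta_k\le\eta_i\}+\#\{k<i: j\le\eta_k+1\le\eta_i\},\qquad l'(s)=\#\{k>i:\eta_k>\eta_i\}+\#\{k<i:\eta_k\ge\eta_i\},$$ and $$d_\eta=\prod_{s\in\eta}(1-q^{a(s)+1}t^{l(s)+1}),\quad d'_\eta=\prod_{s\in\eta}(1-q^{a(s)+1}t^{l(s)}),\quad e_\eta=\prod_{s\in\eta}(1-q^{a'(s)+1}t^{n-l'(s)}).$$ Define the formal power series in $x=(x_1,\dots,x_n)$ and $y=(y_1,\dots,y_n)$ $$\mathcal K_A(x;y;q,t)=\sum_{\eta\in\mathbb Z_{\ge0}^n}\frac{d_\eta}{d'_\eta e_\eta}\,E_\eta(x;q,t)\,E_\eta(y;q^{-1},t^{-1}),$$ and let $L^{(x)}$, $L^{(y)}$ denote the termwise action of an operator $L$ in the $x$-variables, respectively the $y$-variables. **Theorem.** The defining conditions determine a unique polynomial $E_\eta$ for every $\eta$, each $D_i$ maps polynomials to polynomials, and (a) $(T_i^{\pm1})^{(x)}\,\mathcal K_A=\bigl(\overline{T_i^{\mp1}}\bigr)^{(y)}\,\mathcal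 K_A$ for $1\le i\le n-1$ (both choices of sign); (b) $\widehat\Phi_q^{(x)}\,\mathcal K_A=\overline{\Phi_q}^{\,(y)}\,\mathcal K_A$; (c) $D_i^{(x)}\,\mathcal K_A=y_i\,\mathcal K_A$ for $1\le i\le n$. -/

import Mathlib

open MvPolynomial
open scoped Finset

noncomputable section

namespace QDunkl

/-! Throughout, the number of variables is `n = m + 1`, the variables are indexed by
`Fin (m + 1)` (so the variable `x_i`, `1 ≤ i ≤ n`, has index `i - 1`), and the Hecke algebra
generators `T_1, …, T_{n-1}` are indexed by `Fin m`: the generator with index `k : Fin m`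
involves the two neighbouring variables `k.castSucc` and `k.succ`. -/

/-- Polynomials in `n = m + 1` variables. -/
abbrev Poly (m : ℕ) (F : Type*) [CommSemiring F] := MvPolynomial (Fin (m + 1)) F

/-- Linear operators on polynomials; multiplication is composition. -/
abbrev Op (m : ℕ) (F : Type*) [CommSemiring F] := Module.End F (Poly m F)

/-- Compositions `η = (η_1, …, η_n)`, which are also the exponents of monomials. -/
abbrev Comp (m : ℕ) := Fin (m + 1) →₀ ℕ

variable {m : ℕ} {F : Type*} [Field F]

/-! ### Operators -/

/-- `A_{lo} A_{lo+1} ⋯ A_{hi-1}` (indices starting from `0`). -/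
def prodUp (A : Fin m → Op m F) (lo hi : ℕ) : Op m F :=
  (((List.finRange m).filter (fun k => lo ≤ k.val ∧ k.val < hi)).map A).prod

/-- `A_{hi-1} ⋯ A_{lo+1} A_{lo}` (indices starting from `0`). -/
def prodDown (A : Fin m → Op m F) (lo hi : ℕ) : Op m F :=
  (((List.finRange m).filter (fun k => lo ≤ k.val ∧ k.val < hi)).reverse.map A).prod

/-- The operator `s_k` interchanging two neighbouring variables. -/
def s (k : Fin m) : Op m F := (rename (Equiv.swap k.castSucc k.succ)).toLinearMap

/-- The `q`-shift `τ_i : x_i ↦ q x_i`. -/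
def τ (q : F) (i : Fin (m + 1)) : Op m F :=
  (aeval (fun j => if j = i then C q * X j else X j) : Poly m F →ₐ[F] Poly m F).toLinearMap

/-- Multiplication by the variable `x_i`. -/
def mulX (i : Fin (m + 1)) : Op m F := LinearMap.mulLeft F (X i)

theorem dvd_s_sub (k : Fin m) (f : Poly m F) :
    (X k.castSucc - X k.succ : Poly m F) ∣ s k f - f := by
  rw [← Ideal.mem_span_singleton, ← Ideal.Quotient.eq]
  set I : Ideal (Poly m F) := Ideal.span {X k.castSucc - X k.succ}
  have hX : Ideal.Quotient.mk I (X k.castSucc) = Ideal.Quotient.mk I (X k.succ) :=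
    Ideal.Quotient.eq.2 (Ideal.mem_span_singleton_self _)
  have h : (Ideal.Quotient.mkₐ F I).comp (rename (Equiv.swap k.castSucc k.succ)) =
      Ideal.Quotient.mkₐ F I := by
    apply MvPolynomial.algHom_ext
    intro j
    simp only [AlgHom.comp_apply, rename_X, Ideal.Quotient.mkₐ_eq_mk]
    by_cases h1 : j = k.castSucc
    · subst h1; rw [Equiv.swap_apply_left, hX]
    · by_cases h2 : j = k.succ
      · subst h2; rw [Equiv.swap_apply_right, hX]
      · rw [Equiv.swap_apply_of_ne_of_ne h1 h2]
  exact DFunLike.congr_fun h f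

theorem X_sub_X_ne_zero (k : Fin m) : (X k.castSucc - X k.succ : Poly m F) ≠ 0 := by
  rw [sub_ne_zero]
  intro h
  exact (Fin.castSucc_lt_succ (i := k)).ne (X_injective h)

/-- The polynomial `(s_k f - f) / (x_k - x_{k+1})`. -/
def divDiff (k : Fin m) (f : Poly m F) : Poly m F := (dvd_s_sub k f).choose

theorem divDiff_spec (k : Fin m) (f : Poly m F) :
    (X k.castSucc - X k.succ) * divDiff k f = s k f - f :=
  (dvd_s_sub k f).choose_spec.symm

/-- The Demazure–Lusztig operator
`T_k = t + (t x_k - x_{k+1}) / (x_k - x_{k+1}) · (s_k - 1)`. -/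
def T (t : F) (k : Fin m) : Op m F where
  toFun f := t • f + (C t * X k.castSucc - X k.succ) * divDiff k f
  map_add' f g := by
    have h : divDiff k (f + g) = divDiff k f + divDiff k g := by
      apply mul_left_cancel₀ (X_sub_X_ne_zero k)
      rw [mul_add, divDiff_spec, divDiff_spec, divDiff_spec, map_add]
      ring
    rw [h, smul_add]
    ring
  map_smul' c f := by
    have h : divDiff k (c • f) = c • divDiff k f := by
      apply mul_left_cancel₀ (X_sub_X_ne_zero k)
      rw [mul_smul_comm, divDiff_spec, divDiff_spec, map_smul, smul_sub]
    rw [h, RingHom.id_apply, smul_add, mul_smul_comm, smul_comm]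

/-- The inverse `T_k⁻¹ = t⁻¹ - 1 + t⁻¹ T_k` (see `T_mul_Tinv` and `Tinv_mul_T`). -/
def Tinv (t : F) (k : Fin m) : Op m F := (t⁻¹ - 1) • 1 + t⁻¹ • T t k

theorem T_apply (t : F) (k : Fin m) (f : Poly m F) :
    T t k f = t • f + (C t * X k.castSucc - X k.succ) * divDiff k f := rfl

theorem T_sq (t : F) (k : Fin m) (f : Poly m F) :
    T t k (T t k f) = (t - 1) • T t k f + t • f := by
  have hu : s k (X k.castSucc : Poly m F) = X k.succ := by simp [s]
  have hv : s k (X k.succ : Poly m F) = X k.castSucc := by simp [s]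
  have hc : s k (C t : Poly m F) = C t := by simp [s]
  have hm : ∀ a b : Poly m F, s k (a * b) = s k a * s k b := fun a b => by simp [s]
  have hs : s k (s k f) = f := by
    have h : (rename (fun x => x) : Poly m F →ₐ[F] Poly m F) = AlgHom.id F _ := rename_id
    simp [s, rename_rename, Function.comp_def, h]
  have hd : s k (divDiff k f) = divDiff k f := by
    apply mul_left_cancel₀ (X_sub_X_ne_zero k)
    have h := congrArg (s k) (divDiff_spec k f)
    rw [hm, map_sub, map_sub, hu, hv, hs] at h
    linear_combination -h - divDiff_spec k f
  apply mul_left_cancel₀ (X_sub_X_ne_zero k)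
  have h2 := divDiff_spec k (T t k f)
  rw [T_apply t k f, map_add, hm, hd, map_sub, hm, hu, hv, hc, map_smul] at h2
  rw [T_apply t k (T t k f), T_apply t k f]
  simp only [smul_eq_C_mul, map_sub, map_one] at h2 ⊢
  linear_combination (C t * X k.castSucc - X k.succ) * h2 -
    C t * (C t * X k.castSucc - X k.succ) * divDiff_spec k f

theorem T_mul_Tinv {t : F} (ht : t ≠ 0) (k : Fin m) : T t k * Tinv t k = 1 := by
  refine LinearMap.ext fun f => ?_
  simp only [Tinv, Module.End.mul_apply, LinearMap.add_apply, LinearMap.smul_apply, map_add,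
    map_smul, T_sq, Module.End.one_apply, smul_add, smul_smul]
  rw [← add_assoc, ← add_smul, inv_mul_cancel₀ ht, one_smul]
  have : t⁻¹ - 1 + t⁻¹ * (t - 1) = 0 := by field_simp; ring
  rw [this, zero_smul, zero_add]

theorem Tinv_mul_T {t : F} (ht : t ≠ 0) (k : Fin m) : Tinv t k * T t k = 1 := by
  rw [← T_mul_Tinv ht k, Tinv, add_mul, mul_add, smul_mul_assoc, smul_mul_assoc,
    mul_smul_comm, mul_smul_comm, one_mul, mul_one]

/-- `ω = s_{n-1} ⋯ s_2 s_1 τ_1`. -/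
def ω (q : F) : Op m F := prodDown s 0 m * τ q 0

/-- The Cherednik operator `Y_i = t^{-n+i} T_i ⋯ T_{n-1} ω T_1⁻¹ ⋯ T_{i-1}⁻¹`. -/
def Y (q t : F) (i : Fin (m + 1)) : Op m F :=
  t ^ ((i.val : ℤ) - m) • (prodUp (T t) i m * ω q * prodUp (Tinv t) 0 i)

/-- For `i < j`,
`T_{ij}⁻¹ = T_i⁻¹ T_{i+1}⁻¹ ⋯ T_{j-2}⁻¹ T_{j-1}⁻¹ T_{j-2}⁻¹ ⋯ T_i⁻¹`. -/
def Tijinv (t : F) (i j : Fin (m + 1)) : Op m F :=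
  prodUp (Tinv t) i j * prodDown (Tinv t) i (j.val - 1)

/-- `x_i D_i = 1 - t^{n-1} [1 + (t⁻¹ - 1) ∑_{j>i} t^{j-i} T_{ij}⁻¹] Y_i`. -/
def xD (q t : F) (i : Fin (m + 1)) : Op m F :=
  1 - t ^ m • ((1 + (t⁻¹ - 1) • ∑ j ∈ Finset.Ioi i, t ^ (j.val - i.val) • Tijinv t i j) *
    Y q t i)

/-- Division by `x_i`: on multiples of `x_i` this is the exact quotient
(monomials not divisible by `x_i` are dropped). -/
def divX (i : Fin (m + 1)) : Op m F where
  toFun f := f.divMonomial (Finsupp.single i 1)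
  map_add' f g := add_divMonomial f g _
  map_smul' c f := by
    ext ν
    simp [coeff_divMonomial]

/-- The `q`-Dunkl operator
`D_i = x_i⁻¹ (1 - t^{n-1} [1 + (t⁻¹ - 1) ∑_{j>i} t^{j-i} T_{ij}⁻¹] Y_i)`. -/
def D (q t : F) (i : Fin (m + 1)) : Op m F := divX i * xD q t i

/-- The raising operator `Φ_q = x_n T_{n-1}⁻¹ ⋯ T_2⁻¹ T_1⁻¹`; it does not involve `q`. -/
def Φ (t : F) : Op m F := mulX (Fin.last m) * prodDown (Tinv t) 0 m

/-- The lowering operator `Φ̂_q = T_1 T_2 ⋯ T_{n-1} D_n`. -/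
def Φhat (q t : F) : Op m F := prodUp (T t) 0 m * D q t (Fin.last m)

/-! ### Non-symmetric Macdonald polynomials -/

/-- `η⁺`: the decreasing rearrangement of `η`. -/
def plus (η : Comp m) : Fin (m + 1) → ℕ :=
  fun i => η (Tuple.sort (fun k => OrderDual.toDual (η k)) i)

/-- The (weak) dominance order for `n`-tuples. -/
def DomLE (ν η : Fin (m + 1) → ℕ) : Prop :=
  ∑ i, ν i = ∑ i, η i ∧ ∀ p, ∑ i ∈ Finset.Iic p, ν i ≤ ∑ i ∈ Finset.Iic p, η i

/-- The strict partial order `ν ≺ η` on compositions. -/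
def Prec (ν η : Comp m) : Prop :=
  ν ≠ η ∧ ((plus ν ≠ plus η ∧ DomLE (plus ν) (plus η)) ∨ (plus ν = plus η ∧ DomLE ν η))

/-- `#{k < i | η_k ≥ η_i} + #{k > i | η_k > η_i}`. -/
def legCo (η : Comp m) (i : Fin (m + 1)) : ℕ :=
  #{k ∈ Finset.Iio i | η i ≤ η k} + #{k ∈ Finset.Ioi i | η i < η k}

/-- The eigenvalue `t^{η̄_i}`, where
`η̄_i = α η_i - #{k < i | η_k ≥ η_i} - #{k > i | η_k > η_i}` and `t^α = q`. -/
def eigenval (q t : F) (η : Comp m) (i : Fin (m + 1)) : F :=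
  q ^ η i * t⁻¹ ^ legCo η i

/-- The conditions defining the non-symmetric Macdonald polynomial `E_η(x;q,t)`:
`E_η = x^η + ∑_{ν ≺ η} b_{ην} x^ν` and `Y_i E_η = t^{η̄_i} E_η` for all `i`. -/
structure IsMacdonald (q t : F) (η : Comp m) (P : Poly m F) : Prop where
  coeff_self : P.coeff η = 1
  triangular : ∀ ν, P.coeff ν ≠ 0 → ν = η ∨ Prec ν η
  eigen : ∀ i, Y q t i P = eigenval q t η i • P

open Classical in
/-- The non-symmetric Macdonald polynomial `E_η(x;q,t)`. -/
def E (q t : F) (η : Comp m) : Poly m F :=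
  if h : ∃ P, IsMacdonald q t η P then h.choose else 0

/-! ### The constants. Nodes are `s = (i, j)` with `1 ≤ j ≤ η_i`. -/

/-- The leg length `l(i,j) = #{k > i | j ≤ η_k ≤ η_i} + #{k < i | j ≤ η_k + 1 ≤ η_i}`. -/
def leg (η : Comp m) (i : Fin (m + 1)) (j : ℕ) : ℕ :=
  #{k ∈ Finset.Ioi i | j ≤ η k ∧ η k ≤ η i} + #{k ∈ Finset.Iio i | j ≤ η k + 1 ∧ η k + 1 ≤ η i}

/-- `d_η(q,t) = ∏_s (1 - q^{a(s)+1} t^{l(s)+1})`, with `a(i,j) = η_i - j`. -/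
def d (q t : F) (η : Comp m) : F :=
  ∏ i, ∏ j ∈ Finset.Icc 1 (η i), (1 - q ^ ((η i - j) + 1) * t ^ (leg η i j + 1))

/-- `d'_η(q,t) = ∏_s (1 - q^{a(s)+1} t^{l(s)})`. -/
def d' (q t : F) (η : Comp m) : F :=
  ∏ i, ∏ j ∈ Finset.Icc 1 (η i), (1 - q ^ ((η i - j) + 1) * t ^ leg η i j)

/-- `e_η(q,t) = ∏_s (1 - q^{a'(s)+1} t^{n-l'(s)})`, with `a'(i,j) = j - 1` and
`l'(i,j) = #{k > i | η_k > η_i} + #{k < i | η_k ≥ η_i} ≤ n - 1`. -/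
def e (q t : F) (η : Comp m) : F :=
  ∏ i, ∏ j ∈ Finset.Icc 1 (η i), (1 - q ^ ((j - 1) + 1) * t ^ ((m + 1) - legCo η i))

/-! ### Formal series in two sets of variables -/

variable (m F) in
/-- Formal power series in `x_1, …, x_n` (indices `Sum.inl i`) and `y_1, …, y_n`
(indices `Sum.inr i`). -/
abbrev Series := MvPowerSeries (Fin (m + 1) ⊕ Fin (m + 1)) F

/-- The exponent of `x^μ y^ν`. -/
def expo (μ ν : Comp m) : Fin (m + 1) ⊕ Fin (m + 1) →₀ ℕ :=
  Finsupp.sumFinsuppEquivProdFinsupp.symm (μ, ν)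

/-- The series whose coefficient at `x^μ y^ν` is `c μ ν`. -/
def mkSeries (c : Comp m → Comp m → F) : Series m F :=
  fun κ => c (Finsupp.sumFinsuppEquivProdFinsupp κ).1 (Finsupp.sumFinsuppEquivProdFinsupp κ).2

theorem coeff_mkSeries (c : Comp m → Comp m → F) (μ ν : Comp m) :
    MvPowerSeries.coeff (expo μ ν) (mkSeries c) = c μ ν := by
  rw [MvPowerSeries.coeff_apply]
  simp only [mkSeries, expo, Equiv.apply_symm_apply]

/-- The action `L^{(x)}` of an operator on the `x`-variables, termwise:
`∑ K_{λν} x^λ y^ν ↦ ∑ K_{λν} (L x^λ) y^ν`. For the operators used here, which change the degree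
by a constant, only finitely many terms contribute to each coefficient. -/
def actX (L : Op m F) (K : Series m F) : Series m F :=
  mkSeries fun μ ν =>
    ∑ᶠ l : Comp m, (L (monomial l 1)).coeff μ * MvPowerSeries.coeff (expo l ν) K

/-- The action `L^{(y)}` of an operator on the `y`-variables, termwise:
`∑ K_{μλ} x^μ y^λ ↦ ∑ K_{μλ} x^μ (L y^λ)`. -/
def actY (L : Op m F) (K : Series m F) : Series m F :=
  mkSeries fun μ ν =>
    ∑ᶠ l : Comp m, (L (monomial l 1)).coeff ν * MvPowerSeries.coeff (expo μ l) K

/-- The kernel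
`K_A(x;y;q,t) = ∑_η d_η / (d'_η e_η) · E_η(x;q,t) E_η(y;q⁻¹,t⁻¹)`, the sum over all compositions,
as a formal power series: since `E_η` is homogeneous of degree `|η|`, only finitely many `η`
contribute to each coefficient (see `kernel_sum_finite`). -/
def kernel (q t : F) : Series m F :=
  mkSeries fun μ ν =>
    ∑ᶠ η : Comp m, d q t η / (d' q t η * e q t η) *
      ((E q t η).coeff μ * (E q⁻¹ t⁻¹ η).coeff ν)

theorem sum_plus (η : Comp m) : ∑ i, plus η i = ∑ i, η i :=
  Equiv.sum_comp (Tuple.sort (fun k => OrderDual.toDual (η k))) (fun i => η i)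

theorem degree_eq_of_coeff_E_ne_zero {q t : F} {η ν : Comp m} (h : (E q t η).coeff ν ≠ 0) :
    ∑ i, ν i = ∑ i, η i := by
  by_cases hE : ∃ P, IsMacdonald q t η P
  · rw [E, dif_pos hE] at h
    rcases hE.choose_spec.triangular ν h with rfl | ⟨_, ⟨_, h1, _⟩ | ⟨_, h1, _⟩⟩
    · rfl
    · rwa [sum_plus, sum_plus] at h1
    · exact h1
  · rw [E, dif_neg hE] at h
    simp at h

theorem kernel_sum_finite (q t : F) (μ ν : Comp m) :
    (Function.support fun η : Comp m => d q t η / (d' q t η * e q t η) *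
      ((E q t η).coeff μ * (E q⁻¹ t⁻¹ η).coeff ν)).Finite := by
  refine Set.Finite.subset (Finset.finite_toSet
    (Finset.finsuppAntidiag Finset.univ (∑ i, μ i))) fun η hη => ?_
  have h := left_ne_zero_of_mul (right_ne_zero_of_mul hη)
  simp [Finset.mem_finsuppAntidiag, degree_eq_of_coeff_E_ne_zero h]

end QDunkl

end

/-!
The Cherednik operators `Y_i` are triangular with respect to `≺` (`Y_tri`): up to a power of `t`,
`Y_i` is a product of conjugates, under permutations of the variables, of operators `T_k s_k`, of
`τ_1`, and of operators `s_k T_k⁻¹`. The permutations are such that each conjugate of the first or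
third kind sends `x^ν` to a multiple of itself plus monomials obtained by interchanging a larger
part of `ν` with a smaller one to its right, or by moving two parts strictly towards each other. The
diagonal entries are the prescribed eigenvalues. Since `q^a t^b ≠ 1` for `a ≥ 1`, the joint
eigenvalues separate compositions (`eq_of_eigenvalue_eq`). Hence a joint eigenvector with the
eigenvalues of `η` is supported on compositions `ν ⪯ η` and is determined by its coefficient at
`x^η`; this gives uniqueness, and every joint eigenvector that is constructed can be recognized from
its eigenvalues and one coefficient.

Existence and the action of the generators come together. The affine Hecke relations show that
`Ψ = x_n ω` and `T_k - α`, for a suitable scalar `α`, map joint eigenvectors to joint eigenvectors.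
On compositions they induce `η ↦ (η_2, …, η_n, η_1 + 1)` and the interchange of two neighbouring
parts, which generate all compositions from `0` (`comp_induction`). Comparing leading coefficients
one obtains `T_k E_η` as a combination of `E_η` and `E_{s_k η}`. On a joint eigenvector `Φ_q` is a
multiple of `Ψ`, and `Φ̂_q` undoes `Ψ` up to a scalar, so that `Φ_q E_η` and `Φ̂_q E_η` are
multiples of a single Macdonald polynomial (`Φ_E`, `Φhat_E_raise`, `Φhat_E_of_last_eq_zero`).

For the kernel, (a) and (b) then say that the matrix of `T_k`, respectively `Φ̂_q`, in the basis
`E_η(x; q, t)` is the transpose, weighted by the coefficients `d_η / (d'_η e_η)`, of the matrix of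
the corresponding operator in the basis `E_η(y; q⁻¹, t⁻¹)`. This is the content of the recursions
`kerCoeff_sw` and `kerCoeff_raise` for these coefficients under the two moves on compositions. For
(c), the operators `D_i` satisfy `D_i = t⁻¹ T_i D_{i+1} T_i`, which also yields the exactness of the
divisions by downward induction from `i = n`. In the `y`-variables this recursion is mirrored by
`y_i = t⁻¹ (T̄_i)⁻¹ y_{i+1} (T̄_i)⁻¹`, where the bar inverts the parameters, so that (c) follows by
downward induction from the case `i = n`, which is (b) with the factor `T_1 ⋯ T_{n-1}` cancelled.
-/

noncomputable section

namespace QDunkl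

variable {m : ℕ} {F : Type*} [Field F]

/-! ### Ordered products of operators -/

/-- The increasing list of the indices `k` with `lo ≤ k < hi`. -/
def idx (m lo hi : ℕ) : List (Fin m) :=
  (List.finRange m).filter (fun k => lo ≤ k.val ∧ k.val < hi)

theorem mem_idx {lo hi : ℕ} {k : Fin m} : k ∈ idx m lo hi ↔ lo ≤ k.val ∧ k.val < hi := by
  simp [idx]

theorem pairwise_idx (lo hi : ℕ) : (idx m lo hi).Pairwise (· < ·) :=
  (List.pairwise_lt_finRange m).filter _

theorem idx_eq_nil {lo hi : ℕ} (h : hi ≤ lo) : idx m lo hi = [] := by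
  rw [List.eq_nil_iff_forall_not_mem]
  intro k hk
  rw [mem_idx] at hk
  omega

theorem idx_cons (k : Fin m) {hi : ℕ} (h : k.val < hi) :
    idx m k.val hi = k :: idx m (k.val + 1) hi := by
  refine (pairwise_idx _ _).eq_of_mem_iff ?_ fun l => ?_
  · rw [List.pairwise_cons]
    refine ⟨fun l hl => ?_, pairwise_idx _ _⟩
    rw [mem_idx] at hl
    exact Fin.lt_def.2 (by omega)
  · rw [List.mem_cons, mem_idx, mem_idx, Fin.ext_iff]
    omega

theorem idx_concat (k : Fin m) {lo : ℕ} (h : lo ≤ k.val) :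
    idx m lo (k.val + 1) = idx m lo k.val ++ [k] := by
  refine (pairwise_idx _ _).eq_of_mem_iff ?_ fun l => ?_
  · rw [List.pairwise_append]
    refine ⟨pairwise_idx _ _, List.pairwise_singleton _ _, fun l hl r hr => ?_⟩
    rw [mem_idx] at hl
    rw [List.mem_singleton] at hr
    subst hr
    exact Fin.lt_def.2 (by omega)
  · rw [List.mem_append, List.mem_singleton, mem_idx, mem_idx, Fin.ext_iff]
    omega

theorem prodUp_eq (A : Fin m → Op m F) (lo hi : ℕ) :
    prodUp A lo hi = ((idx m lo hi).map A).prod := rfl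

theorem prodDown_eq (A : Fin m → Op m F) (lo hi : ℕ) :
    prodDown A lo hi = ((idx m lo hi).reverse.map A).prod := rfl

theorem prodUp_of_le (A : Fin m → Op m F) {lo hi : ℕ} (h : hi ≤ lo) : prodUp A lo hi = 1 := by
  rw [prodUp_eq, idx_eq_nil h, List.map_nil, List.prod_nil]

theorem prodDown_of_le (A : Fin m → Op m F) {lo hi : ℕ} (h : hi ≤ lo) :
    prodDown A lo hi = 1 := by
  rw [prodDown_eq, idx_eq_nil h, List.reverse_nil, List.map_nil, List.prod_nil]

theorem prodUp_eq_mul (A : Fin m → Op m F) (k : Fin m) {hi : ℕ} (h : k.val < hi) :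
    prodUp A k.val hi = A k * prodUp A (k.val + 1) hi := by
  rw [prodUp_eq, idx_cons k h, List.map_cons, List.prod_cons, prodUp_eq]

theorem prodUp_succ (A : Fin m → Op m F) (k : Fin m) {lo : ℕ} (h : lo ≤ k.val) :
    prodUp A lo (k.val + 1) = prodUp A lo k.val * A k := by
  rw [prodUp_eq, idx_concat k h, List.map_append, List.prod_append, prodUp_eq]
  simp

theorem prodDown_succ (A : Fin m → Op m F) (k : Fin m) {lo : ℕ} (h : lo ≤ k.val) :
    prodDown A lo (k.val + 1) = A k * prodDown A lo k.val := by
  rw [prodDown_eq, idx_concat k h, prodDown_eq]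
  simp

theorem prodDown_eq_mul (A : Fin m → Op m F) (k : Fin m) {hi : ℕ} (h : k.val < hi) :
    prodDown A k.val hi = prodDown A (k.val + 1) hi * A k := by
  rw [prodDown_eq, idx_cons k h, prodDown_eq]
  simp

theorem commute_prodUp {A : Fin m → Op m F} {B : Op m F} {lo hi : ℕ}
    (h : ∀ k : Fin m, lo ≤ k.val → k.val < hi → Commute B (A k)) :
    Commute B (prodUp A lo hi) := by
  rw [prodUp_eq]
  refine Commute.list_prod_right _ _ fun x hx => ?_
  obtain ⟨k, hk, rfl⟩ := List.mem_map.1 hx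
  rw [mem_idx] at hk
  exact h k hk.1 hk.2

theorem prodUp_mul_prodUp (A : Fin m → Op m F) {lo mid hi : ℕ} (h₁ : lo ≤ mid) (h₂ : mid ≤ hi)
    (h₃ : hi ≤ m) : prodUp A lo mid * prodUp A mid hi = prodUp A lo hi := by
  induction hi, h₂ using Nat.le_induction with
  | base => rw [prodUp_of_le A le_rfl, mul_one]
  | succ k hk ih =>
    have e₁ := prodUp_succ A (⟨k, h₃⟩ : Fin m) (lo := mid) hk
    have e₂ := prodUp_succ A (⟨k, h₃⟩ : Fin m) (lo := lo) (h₁.trans hk)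
    simp only at e₁ e₂
    rw [e₁, e₂, ← mul_assoc, ih (by omega)]

theorem prodDown_mul_prodDown (A : Fin m → Op m F) {lo mid hi : ℕ} (h₁ : lo ≤ mid)
    (h₂ : mid ≤ hi) (h₃ : hi ≤ m) :
    prodDown A mid hi * prodDown A lo mid = prodDown A lo hi := by
  induction hi, h₂ using Nat.le_induction with
  | base => rw [prodDown_of_le A le_rfl, one_mul]
  | succ k hk ih =>
    have e₁ := prodDown_succ A (⟨k, h₃⟩ : Fin m) (lo := mid) hk
    have e₂ := prodDown_succ A (⟨k, h₃⟩ : Fin m) (lo := lo) (h₁.trans hk)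
    simp only at e₁ e₂
    rw [e₁, e₂, mul_assoc, ih (by omega)]

theorem prodUp_mul_prodDown {A B : Fin m → Op m F} (h : ∀ k, A k * B k = 1) {lo hi : ℕ}
    (h₁ : lo ≤ hi) (h₃ : hi ≤ m) : prodUp A lo hi * prodDown B lo hi = 1 := by
  induction hi, h₁ using Nat.le_induction with
  | base => rw [prodUp_of_le A le_rfl, prodDown_of_le B le_rfl, mul_one]
  | succ k hk ih =>
    have e₁ := prodUp_succ A (⟨k, h₃⟩ : Fin m) (lo := lo) hk
    have e₂ := prodDown_succ B (⟨k, h₃⟩ : Fin m) (lo := lo) hk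
    simp only at e₁ e₂
    rw [e₁, e₂, mul_assoc, ← mul_assoc (A _), h, one_mul, ih (by omega)]

theorem prodDown_mul_prodUp {A B : Fin m → Op m F} (h : ∀ k, A k * B k = 1) {lo hi : ℕ}
    (h₁ : lo ≤ hi) (h₃ : hi ≤ m) : prodDown A lo hi * prodUp B lo hi = 1 := by
  induction h₁ using Nat.decreasingInduction with
  | self => rw [prodUp_of_le B le_rfl, prodDown_of_le A le_rfl, mul_one]
  | of_succ k hk ih =>
    have e₁ := prodUp_eq_mul B (⟨k, by omega⟩ : Fin m) (hi := hi) hk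
    have e₂ := prodDown_eq_mul A (⟨k, by omega⟩ : Fin m) (hi := hi) hk
    simp only at e₁ e₂
    rw [e₁, e₂, mul_assoc, ← mul_assoc (A _), h, one_mul, ih]

/-! ### The Demazure–Lusztig operators and algebra homomorphisms -/

theorem s_mul_apply (k : Fin m) (f g : Poly m F) : s k (f * g) = s k f * s k g := by
  simp [s]

theorem s_X_castSucc (k : Fin m) : s k (X k.castSucc : Poly m F) = X k.succ := by simp [s]

theorem s_X_succ (k : Fin m) : s k (X k.succ : Poly m F) = X k.castSucc := by simp [s]

theorem s_X_of_ne (k : Fin m) {i : Fin (m + 1)} (h₁ : i ≠ k.castSucc) (h₂ : i ≠ k.succ) :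
    s k (X i : Poly m F) = X i := by
  simp [s, Equiv.swap_apply_of_ne_of_ne h₁ h₂]

theorem s_C (k : Fin m) (a : F) : s k (C a : Poly m F) = C a := by simp [s]

theorem s_one (k : Fin m) : s k (1 : Poly m F) = 1 := by simp [s]

theorem s_mul_s (k : Fin m) : (s k * s k : Op m F) = 1 := by
  refine LinearMap.ext fun f => ?_
  have h : (rename (fun x => x) : Poly m F →ₐ[F] Poly m F) = AlgHom.id F _ := rename_id
  simp [s, rename_rename, Function.comp_def, h]

theorem s_s_apply (k : Fin m) (f : Poly m F) : s k (s k f) = f :=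
  LinearMap.congr_fun (s_mul_s k) f

theorem divDiff_eq {k : Fin m} {f g : Poly m F}
    (h : (X k.castSucc - X k.succ) * g = s k f - f) : divDiff k f = g :=
  mul_left_cancel₀ (X_sub_X_ne_zero k) ((divDiff_spec k f).trans h.symm)

/-- An algebra homomorphism which sends two neighbouring variables to a common scalar multiple of
two neighbouring variables, and intertwines the interchange of the former with that of the latter,
intertwines the Demazure–Lusztig operators. -/
theorem T_algHom {t c : F} (φ : Poly m F →ₐ[F] Poly m F) {k l : Fin m}
    (h₁ : φ (X l.castSucc) = C c * X k.castSucc) (h₂ : φ (X l.succ) = C c * X k.succ)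
    (hs : ∀ f, φ (s l f) = s k (φ f)) (f : Poly m F) : φ (T t l f) = T t k (φ f) := by
  have hC : ∀ a : F, φ (C a) = C a := fun a => φ.commutes a
  have hd : C c * φ (divDiff l f) = divDiff k (φ f) := by
    refine (divDiff_eq ?_).symm
    have h := congrArg φ (divDiff_spec l f)
    rw [map_mul, map_sub, map_sub, h₁, h₂, hs] at h
    linear_combination h
  rw [T_apply, T_apply, map_add, map_smul, map_mul, map_sub, map_mul, h₁, h₂, hC, ← hd]
  ring

/-- `T_k` is linear over the polynomials symmetric in `x_k` and `x_{k+1}`. -/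
theorem T_comm_mul {t : F} {k : Fin m} {g : Poly m F} (hg : s k g = g) (f : Poly m F) :
    T t k (g * f) = g * T t k f := by
  have hd : divDiff k (g * f) = g * divDiff k f := by
    refine divDiff_eq ?_
    rw [s_mul_apply, hg]
    linear_combination g * divDiff_spec k f
  rw [T_apply, T_apply, hd, mul_add, mul_smul_comm]
  ring

theorem commute_T_T {t : F} {k l : Fin m} (h : k.val + 1 < l.val ∨ l.val + 1 < k.val) :
    Commute (T t k : Op m F) (T t l) := by
  have e₁ : l.castSucc ≠ k.castSucc := fun e => by simp [Fin.ext_iff] at e; omega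
  have e₂ : l.castSucc ≠ k.succ := fun e => by simp [Fin.ext_iff] at e; omega
  have e₃ : l.succ ≠ k.castSucc := fun e => by simp [Fin.ext_iff] at e; omega
  have e₄ : l.succ ≠ k.succ := fun e => by simp [Fin.ext_iff] at e; omega
  have hs : ∀ f : Poly m F, T t k (s l f) = s l (T t k f) := fun f => by
    refine (T_algHom (c := 1) (rename (Equiv.swap l.castSucc l.succ)) ?_ ?_ ?_ f).symm
    · rw [C_1, one_mul]
      exact s_X_of_ne l e₁.symm e₃.symm
    · rw [C_1, one_mul]
      exact s_X_of_ne l e₂.symm e₄.symm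
    · intro g
      have hσ : Equiv.swap l.castSucc l.succ * Equiv.swap k.castSucc k.succ =
          Equiv.swap k.castSucc k.succ * Equiv.swap l.castSucc l.succ := by
        rw [Equiv.mul_swap_eq_swap_mul, Equiv.swap_apply_of_ne_of_ne e₁.symm e₃.symm,
          Equiv.swap_apply_of_ne_of_ne e₂.symm e₄.symm]
      simp only [s, AlgHom.toLinearMap_apply, rename_rename]
      rw [← Equiv.Perm.coe_mul, ← Equiv.Perm.coe_mul, hσ]
  refine LinearMap.ext fun f => ?_
  have hX : s k (X l.castSucc - X l.succ : Poly m F) = X l.castSucc - X l.succ := by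
    rw [map_sub, s_X_of_ne k e₁ e₂, s_X_of_ne k e₃ e₄]
  have hY : s k (C t * X l.castSucc - X l.succ : Poly m F) = C t * X l.castSucc - X l.succ := by
    rw [map_sub, s_mul_apply, s_C, s_X_of_ne k e₁ e₂, s_X_of_ne k e₃ e₄]
  have hd : divDiff l (T t k f) = T t k (divDiff l f) := by
    refine divDiff_eq ?_
    rw [← T_comm_mul hX, divDiff_spec, map_sub, hs]
  rw [Module.End.mul_apply, Module.End.mul_apply, T_apply t l, T_apply t l, map_add, map_smul,
    T_comm_mul hY, hd]

theorem T_mul_mulX (t : F) (k : Fin m) (ht : t ≠ 0) :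
    T t k * mulX k.castSucc = t • (mulX k.succ * Tinv t k) := by
  refine LinearMap.ext fun f => ?_
  have hd : divDiff k (X k.castSucc * f) = X k.succ * divDiff k f - f := by
    refine divDiff_eq ?_
    rw [s_mul_apply, s_X_castSucc]
    linear_combination X k.succ * divDiff_spec k f
  have hC : (C t * C t⁻¹ : Poly m F) = 1 := by rw [← C_mul, mul_inv_cancel₀ ht, C_1]
  simp only [Module.End.mul_apply, mulX, LinearMap.mulLeft_apply, LinearMap.smul_apply, Tinv,
    LinearMap.add_apply, Module.End.one_apply, T_apply, hd, smul_eq_C_mul, map_sub, C_1]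
  linear_combination (-X k.succ * f - (C t * X k.castSucc - X k.succ) * X k.succ * divDiff k f
    - C t * X k.succ * f) * hC

theorem T_mul_mulX_of_ne (t : F) (k : Fin m) {i : Fin (m + 1)} (h₁ : i ≠ k.castSucc)
    (h₂ : i ≠ k.succ) : Commute (T t k) (mulX i) := by
  refine LinearMap.ext fun f => ?_
  rw [Module.End.mul_apply, Module.End.mul_apply, mulX, LinearMap.mulLeft_apply,
    LinearMap.mulLeft_apply]
  exact T_comm_mul (s_X_of_ne k h₁ h₂) f

/-- The identity of rational functions behind the braid relation: `L` and `R` are the results of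
applying `T_k T_l T_k` and `T_l T_k T_l` to `f`, and `g, gk, …` are the images under permutations of
the variables of the intermediate results. -/
theorem braid_identity {A : Type*} [CommRing A] [IsDomain A] {x y z t f fk fl fkl flk fw : A}
    {g gk gl gkl h hk hl hlk P Q P' Q' L R : A} (hxy : x - y ≠ 0) (hyz : y - z ≠ 0)
    (hxz : x - z ≠ 0)
    (e₁ : (x - y) * L = (1 - t) * y * P + (t * x - y) * Q)
    (e₂ : (y - z) * P = (1 - t) * z * g + (t * y - z) * gl)
    (e₃ : (x - y) * g = (1 - t) * y * f + (t * x - y) * fk)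
    (e₄ : (x - z) * gl = (1 - t) * z * fl + (t * x - z) * flk)
    (e₅ : (x - z) * Q = (1 - t) * z * gk + (t * x - z) * gkl)
    (e₆ : (y - x) * gk = (1 - t) * x * fk + (t * y - x) * f)
    (e₇ : (y - z) * gkl = (1 - t) * z * fkl + (t * y - z) * fw)
    (e₈ : (y - z) * R = (1 - t) * z * P' + (t * y - z) * Q')
    (e₉ : (x - y) * P' = (1 - t) * y * h + (t * x - y) * hk)
    (e₁₀ : (y - z) * h = (1 - t) * z * f + (t * y - z) * fl)
    (e₁₁ : (x - z) * hk = (1 - t) * z * fk + (t * x - z) * fkl)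
    (e₁₂ : (x - z) * Q' = (1 - t) * z * hl + (t * x - z) * hlk)
    (e₁₃ : (z - y) * hl = (1 - t) * y * fl + (t * z - y) * f)
    (e₁₄ : (x - y) * hlk = (1 - t) * y * flk + (t * x - y) * fw) : L = R := by
  have hL : (x - y) ^ 2 * (y - z) * (x - z) * L =
      (1 - t) * y * ((x - z) * (1 - t) * z * ((1 - t) * y * f + (t * x - y) * fk)
        + (x - y) * (t * y - z) * ((1 - t) * z * fl + (t * x - z) * flk))
      + (t * x - y) * (-(y - z) * (1 - t) * z * ((1 - t) * x * fk + (t * y - x) * f)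
        + (x - y) * (t * x - z) * ((1 - t) * z * fkl + (t * y - z) * fw)) := by
    rw [← e₃, ← e₄, ← e₆, ← e₇]
    linear_combination (x - y) * (y - z) * (x - z) * e₁
      + (x - y) * (x - z) * (1 - t) * y * e₂ + (x - y) * (y - z) * (t * x - y) * e₅
  have hR : (x - y) * (y - z) ^ 2 * (x - z) * R =
      (1 - t) * z * ((x - z) * (1 - t) * y * ((1 - t) * z * f + (t * y - z) * fl)
        + (y - z) * (t * x - y) * ((1 - t) * z * fk + (t * x - z) * fkl))
      + (t * y - z) * (-(x - y) * (1 - t) * z * ((1 - t) * y * fl + (t * z - y) * f)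
        + (y - z) * (t * x - z) * ((1 - t) * y * flk + (t * x - y) * fw)) := by
    rw [← e₁₀, ← e₁₁, ← e₁₃, ← e₁₄]
    linear_combination (x - y) * (y - z) * (x - z) * e₈
      + (y - z) * (x - z) * (1 - t) * z * e₉ + (x - y) * (y - z) * (t * y - z) * e₁₂
  -- Both sides are now explicit in the six images of `f`, and agree after clearing denominators.
  have hN : (x - y) ^ 2 * (y - z) ^ 2 * (x - z) ≠ 0 :=
    mul_ne_zero (mul_ne_zero (pow_ne_zero _ hxy) (pow_ne_zero _ hyz)) hxz
  apply mul_left_cancel₀ hN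
  linear_combination (y - z) * hL - (x - y) * hR

/-- The braid relation. -/
theorem T_braid (t : F) {k l : Fin m} (h : k.val + 1 = l.val) :
    T t k * T t l * T t k = T t l * T t k * T t l := by
  have hkl : k.succ = l.castSucc := Fin.ext (by simpa using h)
  have hkl' : k.castSucc ≠ l.succ := fun e => by simp [Fin.ext_iff] at e; omega
  have hlk : l.castSucc ≠ k.castSucc := fun e => by simp [Fin.ext_iff] at e; omega
  have hll : l.castSucc ≠ l.succ := (Fin.castSucc_lt_succ).ne
  refine LinearMap.ext fun f => ?_
  set x : Poly m F := X k.castSucc with hx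
  set y : Poly m F := X l.castSucc with hy
  set z : Poly m F := X l.succ with hz
  have kx : s k x = y := by rw [hx, hy, s_X_castSucc, hkl]
  have ky : s k y = x := by rw [hx, hy, ← hkl, s_X_succ]
  have kz : s k z = z := s_X_of_ne k hkl'.symm (by rw [hkl]; exact (Fin.castSucc_lt_succ).ne')
  have lx : s l x = x := s_X_of_ne l hlk.symm hkl'
  have ly : s l y = z := s_X_castSucc l
  have lz : s l z = y := s_X_succ l
  have hxy : x - y ≠ 0 := by rw [hx, hy, ← hkl]; exact X_sub_X_ne_zero k
  have hyz : y - z ≠ 0 := X_sub_X_ne_zero l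
  have hxz : x - z ≠ 0 := by
    rw [sub_ne_zero]; exact fun e => hkl' (X_injective e)
  have Tk : ∀ g, (x - y) * T t k g = (1 - C t) * y * g + (C t * x - y) * s k g := fun g => by
    have h := divDiff_spec k g
    rw [hkl] at h
    rw [T_apply, hkl, smul_eq_C_mul]
    linear_combination (C t * x - y) * h
  have Tl : ∀ g, (y - z) * T t l g = (1 - C t) * z * g + (C t * y - z) * s l g := fun g => by
    rw [T_apply, smul_eq_C_mul]
    linear_combination (C t * y - z) * divDiff_spec l g
  have skTk : ∀ g, (y - x) * s k (T t k g) = (1 - C t) * x * s k g + (C t * y - x) * g :=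
    fun g => by
      have h := congrArg (s k) (Tk g)
      simpa only [s_mul_apply, map_add, map_sub, kx, ky, s_C, s_s_apply, s_one] using h
  have slTl : ∀ g, (z - y) * s l (T t l g) = (1 - C t) * y * s l g + (C t * z - y) * g :=
    fun g => by
      have h := congrArg (s l) (Tl g)
      simpa only [s_mul_apply, map_add, map_sub, ly, lz, s_C, s_s_apply, s_one] using h
  have skTl : ∀ g, (x - z) * s k (T t l g) =
      (1 - C t) * z * s k g + (C t * x - z) * s k (s l g) := fun g => by
    have h := congrArg (s k) (Tl g)
    simpa only [s_mul_apply, map_add, map_sub, ky, kz, s_C, s_s_apply, s_one] using h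
  have slTk : ∀ g, (x - z) * s l (T t k g) =
      (1 - C t) * z * s l g + (C t * x - z) * s l (s k g) := fun g => by
    have h := congrArg (s l) (Tk g)
    simpa only [s_mul_apply, map_add, map_sub, lx, ly, s_C, s_s_apply, s_one] using h
  have skslTk : ∀ g, (y - z) * s k (s l (T t k g)) =
      (1 - C t) * z * s k (s l g) + (C t * y - z) * s k (s l (s k g)) := fun g => by
    have h := congrArg (s k) (slTk g)
    simpa only [s_mul_apply, map_add, map_sub, kx, kz, s_C, s_one] using h
  have slskTl : ∀ g, (x - y) * s l (s k (T t l g)) =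
      (1 - C t) * y * s l (s k g) + (C t * x - y) * s l (s k (s l g)) := fun g => by
    have h := congrArg (s l) (skTl g)
    simpa only [s_mul_apply, map_add, map_sub, lx, lz, s_C, s_one] using h
  have hsss : s k (s l (s k f)) = s l (s k (s l f)) := by
    have hσ : Equiv.swap k.castSucc k.succ * Equiv.swap l.castSucc l.succ *
        Equiv.swap k.castSucc k.succ = Equiv.swap l.castSucc l.succ *
        Equiv.swap k.castSucc k.succ * Equiv.swap l.castSucc l.succ := by
      rw [hkl, Equiv.swap_comm k.castSucc, Equiv.swap_comm l.castSucc l.succ,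
        Equiv.swap_mul_swap_mul_swap hll.symm hkl'.symm,
        Equiv.swap_comm l.castSucc k.castSucc, Equiv.swap_comm l.succ l.castSucc,
        Equiv.swap_mul_swap_mul_swap hlk.symm hkl', Equiv.swap_comm]
    simp only [s, AlgHom.toLinearMap_apply, rename_rename]
    rw [← Equiv.Perm.coe_mul, ← Equiv.Perm.coe_mul, ← Equiv.Perm.coe_mul, ← Equiv.Perm.coe_mul,
      ← mul_assoc, ← mul_assoc, hσ]
  have e₇ := skslTk f
  rw [hsss] at e₇
  exact braid_identity hxy hyz hxz (Tk _) (Tl _) (Tk f) (slTk f) (skTl _) (skTk f) e₇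
    (Tl _) (Tk _) (Tl f) (skTl f) (slTk _) (slTl f) (slskTl f)

/-! ### The order on compositions -/

/-- The composition obtained by interchanging two neighbouring parts. -/
def sw (k : Fin m) (ν : Comp m) : Comp m := ν.mapDomain (Equiv.swap k.castSucc k.succ)

theorem sw_apply (k : Fin m) (ν : Comp m) (i : Fin (m + 1)) :
    sw k ν i = ν (Equiv.swap k.castSucc k.succ i) := by
  rw [sw, Finsupp.mapDomain_equiv_apply, Equiv.symm_swap]

theorem sw_castSucc (k : Fin m) (ν : Comp m) : sw k ν k.castSucc = ν k.succ := by
  rw [sw_apply, Equiv.swap_apply_left]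

theorem sw_succ (k : Fin m) (ν : Comp m) : sw k ν k.succ = ν k.castSucc := by
  rw [sw_apply, Equiv.swap_apply_right]

theorem sw_of_ne (k : Fin m) (ν : Comp m) {i : Fin (m + 1)} (h₁ : i ≠ k.castSucc)
    (h₂ : i ≠ k.succ) : sw k ν i = ν i := by
  rw [sw_apply, Equiv.swap_apply_of_ne_of_ne h₁ h₂]

theorem sw_sw (k : Fin m) (ν : Comp m) : sw k (sw k ν) = ν := by
  ext i
  rw [sw_apply, sw_apply, Equiv.swap_apply_self]

theorem sw_eq_self {k : Fin m} {ν : Comp m} (h : ν k.castSucc = ν k.succ) : sw k ν = ν := by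
  ext i
  by_cases h₁ : i = k.castSucc
  · rw [h₁, sw_castSucc, h]
  by_cases h₂ : i = k.succ
  · rw [h₂, sw_succ, h]
  exact sw_of_ne k ν h₁ h₂

theorem s_monomial (k : Fin m) (ν : Comp m) (a : F) :
    s k (monomial ν a) = monomial (sw k ν) a := by
  rw [s, AlgHom.toLinearMap_apply, rename_monomial, sw]

theorem DomLE.trans {μ ν κ : Fin (m + 1) → ℕ} (h₁ : DomLE μ ν) (h₂ : DomLE ν κ) : DomLE μ κ :=
  ⟨h₁.1.trans h₂.1, fun p => (h₁.2 p).trans (h₂.2 p)⟩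

theorem DomLE.antisymm {μ ν : Fin (m + 1) → ℕ} (h₁ : DomLE μ ν) (h₂ : DomLE ν μ) : μ = ν := by
  funext p
  induction p using WellFoundedLT.induction with
  | ind p ih =>
    have h := le_antisymm (h₁.2 p) (h₂.2 p)
    rw [← Finset.Iio_insert, Finset.sum_insert (by simp), Finset.sum_insert (by simp),
      Finset.sum_congr rfl fun l hl => ih l (Finset.mem_Iio.1 hl)] at h
    exact Nat.add_right_cancel h

theorem Prec.sum_eq {μ ν : Comp m} (h : Prec μ ν) : ∑ i, μ i = ∑ i, ν i := by
  rcases h with ⟨_, ⟨_, h, _⟩ | ⟨_, h, _⟩⟩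
  · rwa [sum_plus, sum_plus] at h
  · exact h

theorem Prec.plus_le {μ ν : Comp m} (h : Prec μ ν) : DomLE (plus μ) (plus ν) := by
  rcases h with ⟨_, ⟨_, h⟩ | ⟨h, _⟩⟩
  · exact h
  · rw [h]
    exact ⟨rfl, fun _ => le_rfl⟩

theorem Prec.asymm {μ ν : Comp m} (h₁ : Prec μ ν) (h₂ : Prec ν μ) : False := by
  have h := h₁.plus_le.antisymm h₂.plus_le
  rcases h₁ with ⟨hne, ⟨h₁, _⟩ | ⟨_, h₁⟩⟩
  · exact h₁ h
  rcases h₂ with ⟨_, ⟨h₂, _⟩ | ⟨_, h₂⟩⟩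
  · exact h₂ h.symm
  exact hne (DFunLike.coe_injective (h₁.antisymm h₂))

theorem Prec.trans {μ ν κ : Comp m} (h₁ : Prec μ ν) (h₂ : Prec ν κ) : Prec μ κ := by
  refine ⟨fun h => (h ▸ h₁).asymm h₂, ?_⟩
  by_cases h : plus μ = plus κ
  · right
    have e : plus μ = plus ν := h₁.plus_le.antisymm (h ▸ h₂.plus_le)
    have e' : plus ν = plus κ := e.symm.trans h
    rcases h₁ with ⟨_, ⟨h₁, _⟩ | ⟨_, h₁⟩⟩
    · exact absurd e h₁
    rcases h₂ with ⟨_, ⟨h₂, _⟩ | ⟨_, h₂⟩⟩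
    · exact absurd e' h₂
    exact ⟨h, h₁.trans h₂⟩
  · exact Or.inl ⟨h, h₁.plus_le.trans h₂.plus_le⟩

instance : IsStrictOrder (Comp m) Prec where
  irrefl _ h := h.1 rfl
  trans _ _ _ := Prec.trans

theorem sum_comp_plus (f : ℕ → ℕ) (η : Comp m) : ∑ i, f (plus η i) = ∑ i, f (η i) :=
  Equiv.sum_comp (Tuple.sort (fun k => OrderDual.toDual (η k))) (fun i => f (η i))

theorem plus_antitone (η : Comp m) : Antitone (plus η) :=
  fun _ _ h => Tuple.monotone_sort (fun k => OrderDual.toDual (η k)) h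

theorem plus_mapDomain (σ : Equiv.Perm (Fin (m + 1))) (ν : Comp m) :
    plus (ν.mapDomain σ) = plus ν := by
  funext i
  have h := congrFun (Tuple.comp_perm_comp_sort_eq_comp_sort
    (f := fun k => OrderDual.toDual (ν k)) (σ := σ.symm)) i
  have e : (fun k => OrderDual.toDual (ν.mapDomain σ k)) =
      (fun k => OrderDual.toDual (ν k)) ∘ σ.symm := by
    funext k
    simp [Finsupp.mapDomain_equiv_apply]
  unfold plus
  rw [e, Finsupp.mapDomain_equiv_apply]
  exact congrArg OrderDual.ofDual h

/-- Dominance of the decreasing rearrangements follows from the comparison of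
`∑ max (η_i - c) 0` for all thresholds `c`, which does not mention the rearrangements. -/
theorem domLE_plus_of_threshold {μ ν : Comp m} (h : ∑ i, μ i = ∑ i, ν i)
    (hc : ∀ c, ∑ i, (μ i - c) ≤ ∑ i, (ν i - c)) : DomLE (plus μ) (plus ν) := by
  refine ⟨by rw [sum_plus, sum_plus, h], fun p => ?_⟩
  set c := plus ν p with hcdef
  have h₁ : ∑ i ∈ Finset.Iic p, plus μ i ≤ ∑ i ∈ Finset.Iic p, (c + (plus μ i - c)) :=
    Finset.sum_le_sum fun i _ => by omega
  have h₂ : ∑ i ∈ Finset.Iic p, (plus μ i - c) ≤ ∑ i, (plus μ i - c) :=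
    Finset.sum_le_sum_of_subset (Finset.subset_univ _)
  have h₃ : ∑ i, (plus ν i - c) = ∑ i ∈ Finset.Iic p, (plus ν i - c) := by
    refine (Finset.sum_subset (Finset.subset_univ _) fun i _ hi => ?_).symm
    have := plus_antitone ν (not_le.1 fun h => hi (Finset.mem_Iic.2 h)).le
    omega
  have h₄ : ∑ i ∈ Finset.Iic p, (c + (plus ν i - c)) = ∑ i ∈ Finset.Iic p, plus ν i := by
    refine Finset.sum_congr rfl fun i hi => ?_
    have := plus_antitone ν (Finset.mem_Iic.1 hi)
    omega
  have h₅ := hc c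
  rw [← sum_comp_plus (fun x => x - c) μ, ← sum_comp_plus (fun x => x - c) ν] at h₅
  rw [Finset.sum_add_distrib] at h₁ h₄
  omega

/-- `μ` arises from `ν` by moving the parts `i` and `j` strictly towards each other. -/
def Between (i j : Fin (m + 1)) (ν μ : Comp m) : Prop :=
  (∀ l, l ≠ i → l ≠ j → μ l = ν l) ∧ μ i + μ j = ν i + ν j ∧
    min (ν i) (ν j) < μ i ∧ μ i < max (ν i) (ν j)

theorem sum_eq_pair {i j : Fin (m + 1)} (h : i ≠ j) (f : Fin (m + 1) → ℕ) :
    ∑ l, f l = f i + f j + ∑ l ∈ (Finset.univ.erase i).erase j, f l := by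
  rw [add_assoc, Finset.add_sum_erase _ _ (Finset.mem_erase.2 ⟨h.symm, Finset.mem_univ _⟩),
    Finset.add_sum_erase _ _ (Finset.mem_univ _)]

theorem Between.prec {i j : Fin (m + 1)} (hij : i ≠ j) {ν μ : Comp m} (h : Between i j ν μ) :
    Prec μ ν := by
  obtain ⟨h₁, h₂, h₃, h₄⟩ := h
  have hrest : ∀ f : ℕ → ℕ, ∑ l ∈ (Finset.univ.erase i).erase j, f (μ l) =
      ∑ l ∈ (Finset.univ.erase i).erase j, f (ν l) := fun f =>
    Finset.sum_congr rfl fun l hl => by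
      simp only [Finset.mem_erase] at hl
      rw [h₁ l hl.2.1 hl.1]
  -- The sum of the squares of the parts drops, so the rearrangements differ.
  have hsq : ∑ l, μ l ^ 2 ≠ ∑ l, ν l ^ 2 := by
    rw [sum_eq_pair hij, sum_eq_pair hij (fun l => ν l ^ 2), hrest (fun x => x ^ 2)]
    have : μ i ^ 2 + μ j ^ 2 < ν i ^ 2 + ν j ^ 2 := by
      zify at *
      rcases le_total (ν i) (ν j) with hle | hle
      · rw [min_eq_left (by exact_mod_cast hle)] at h₃
        rw [max_eq_right (by exact_mod_cast hle)] at h₄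
        have e : (μ j : ℤ) = ν i + ν j - μ i := by linarith
        rw [e]
        nlinarith [mul_pos (sub_pos.2 h₃) (sub_pos.2 h₄)]
      · rw [min_eq_right (by exact_mod_cast hle)] at h₃
        rw [max_eq_left (by exact_mod_cast hle)] at h₄
        have e : (μ j : ℤ) = ν i + ν j - μ i := by linarith
        rw [e]
        nlinarith [mul_pos (sub_pos.2 h₃) (sub_pos.2 h₄)]
    omega
  refine ⟨fun h => hsq (by rw [h]), Or.inl ⟨fun h => hsq ?_, domLE_plus_of_threshold ?_ ?_⟩⟩
  · rw [← sum_comp_plus (fun x => x ^ 2) μ, h, sum_comp_plus (fun x => x ^ 2) ν]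
  · rw [sum_eq_pair hij, sum_eq_pair hij (fun l => ν l), hrest (fun x => x), h₂]
  · intro c
    rw [sum_eq_pair hij, sum_eq_pair hij (fun l => ν l - c), hrest (fun x => x - c)]
    omega

/-- Interchanging a larger part with a smaller one to its right leads to a lower composition. -/
theorem prec_swap {i j : Fin (m + 1)} (hij : i < j) {ν : Comp m} (h : ν j < ν i) :
    Prec (ν.mapDomain (Equiv.swap i j)) ν := by
  have hs : ∀ l, ν.mapDomain (Equiv.swap i j) l = ν (Equiv.swap i j l) := fun l => by
    rw [Finsupp.mapDomain_equiv_apply, Equiv.symm_swap]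
  refine ⟨fun e => ?_, Or.inr ⟨plus_mapDomain _ _, ?_, fun p => ?_⟩⟩
  · have := hs i
    rw [e, Equiv.swap_apply_left] at this
    omega
  · simp only [hs]
    exact Equiv.sum_comp (Equiv.swap i j) (fun l => ν l)
  · simp only [hs]
    by_cases hp : j ≤ p
    · refine (Finset.sum_equiv (Equiv.swap i j) (fun l => ?_) fun l _ => rfl).le
      rw [Finset.mem_Iic, Finset.mem_Iic]
      rcases eq_or_ne l i with rfl | h₁
      · rw [Equiv.swap_apply_left]
        exact ⟨fun _ => hp, fun _ => hij.le.trans hp⟩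
      rcases eq_or_ne l j with rfl | h₂
      · rw [Equiv.swap_apply_right]
        exact ⟨fun _ => hij.le.trans hp, fun _ => hp⟩
      rw [Equiv.swap_apply_of_ne_of_ne h₁ h₂]
    · refine Finset.sum_le_sum fun l hl => ?_
      have hl' : l ≠ j := fun e => hp (e ▸ Finset.mem_Iic.1 hl)
      rcases eq_or_ne l i with rfl | h₁
      · rw [Equiv.swap_apply_left]
        exact h.le
      · rw [Equiv.swap_apply_of_ne_of_ne h₁ hl']

/-! ### The action of the generators on monomials -/

theorem T_X_pow (t : F) (k : Fin m) (e : ℕ) :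
    T t k (X k.castSucc ^ (e + 1)) = X k.succ ^ (e + 1) +
      C (1 - t) * ∑ r ∈ Finset.range e, X k.castSucc ^ (r + 1) * X k.succ ^ (e - r) := by
  set x : Poly m F := X k.castSucc with hx
  set y : Poly m F := X k.succ with hy
  have hs : s k (x ^ (e + 1)) = y ^ (e + 1) := by simp [hx, hy, s]
  have hS : ∑ r ∈ Finset.range e, x ^ (r + 1) * y ^ (e - r) =
      x * y * ∑ r ∈ Finset.range e, x ^ r * y ^ (e - 1 - r) := by
    rw [Finset.mul_sum]
    refine Finset.sum_congr rfl fun r hr => ?_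
    have hr := Finset.mem_range.1 hr
    rw [show e - r = (e - 1 - r) + 1 by omega]
    ring
  have hg := (Commute.all x y).geom_sum₂_mul e
  apply mul_left_cancel₀ (X_sub_X_ne_zero k)
  have hd := divDiff_spec k (x ^ (e + 1))
  rw [hs] at hd
  rw [T_apply, hS, smul_eq_C_mul, C_sub, C_1]
  linear_combination (C t * x - y) * hd - (1 - C t) * x * y * hg

/-- The composition `ν` with its parts `k` and `k + 1` replaced by `a` and `b`. -/
def setPair (k : Fin m) (ν : Comp m) (a b : ℕ) : Comp m :=
  Finsupp.equivFunOnFinite.symm fun l => if l = k.castSucc then a else if l = k.succ then b else ν l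

theorem setPair_castSucc (k : Fin m) (ν : Comp m) (a b : ℕ) :
    setPair k ν a b k.castSucc = a := by simp [setPair]

theorem succ_ne_castSucc' (k : Fin m) : k.succ ≠ k.castSucc := (Fin.castSucc_lt_succ).ne'

theorem setPair_succ (k : Fin m) (ν : Comp m) (a b : ℕ) : setPair k ν a b k.succ = b := by
  simp [setPair, succ_ne_castSucc']

theorem setPair_of_ne (k : Fin m) (ν : Comp m) (a b : ℕ) {l : Fin (m + 1)}
    (h₁ : l ≠ k.castSucc) (h₂ : l ≠ k.succ) : setPair k ν a b l = ν l := by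
  simp [setPair, h₁, h₂]

theorem setPair_eq {k : Fin m} {ν μ : Comp m} {a b : ℕ} (h₁ : μ k.castSucc = a)
    (h₂ : μ k.succ = b) (h : ∀ l, l ≠ k.castSucc → l ≠ k.succ → μ l = ν l) :
    setPair k ν a b = μ := by
  ext l
  rcases eq_or_ne l k.castSucc with rfl | h₃
  · rw [setPair_castSucc, h₁]
  rcases eq_or_ne l k.succ with rfl | h₄
  · rw [setPair_succ, h₂]
  rw [setPair_of_ne k ν a b h₃ h₄, h l h₃ h₄]

theorem monomial_setPair (k : Fin m) (ν : Comp m) (a b : ℕ) :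
    (monomial (setPair k ν a b) 1 : Poly m F) =
      monomial (setPair k ν 0 0) 1 * (X k.castSucc ^ a * X k.succ ^ b) := by
  rw [X_pow_eq_monomial, X_pow_eq_monomial, monomial_mul, monomial_mul, one_mul, one_mul]
  refine congrArg (fun κ => monomial κ (1 : F)) (setPair_eq ?_ ?_ fun l h₁ h₂ => ?_)
  · simp [setPair_castSucc, succ_ne_castSucc']
  · simp [setPair_succ, succ_ne_castSucc']
  · simp [setPair_of_ne k ν 0 0 h₁ h₂, h₁.symm, h₂.symm]

/-- When the larger part is on the left, `T_k` interchanges the parts up to monomials with nearer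
parts. The largest factor of `x^ν` symmetric in `x_k` and `x_{k+1}` can be pulled out, which leaves
a power of `x_k`. -/
theorem T_monomial_of_gt (t : F) {k : Fin m} {ν : Comp m} (h : ν k.succ < ν k.castSucc) :
    ∃ g : Poly m F, T t k (monomial ν 1) = monomial (sw k ν) 1 + g ∧
      ∀ μ, g.coeff μ ≠ 0 → Between k.castSucc k.succ ν μ := by
  obtain ⟨e, he⟩ : ∃ e, ν k.castSucc = ν k.succ + (e + 1) :=
    ⟨ν k.castSucc - ν k.succ - 1, by omega⟩
  set b := ν k.succ with hb
  set c : Poly m F := monomial (setPair k ν 0 0) 1 * (X k.castSucc ^ b * X k.succ ^ b) with hc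
  have hcs : s k c = c := by
    rw [hc, s_mul_apply, s_monomial, sw_eq_self]
    · simp only [s, AlgHom.toLinearMap_apply, map_mul, map_pow, rename_X, Equiv.swap_apply_left,
        Equiv.swap_apply_right]
      ring
    · rw [setPair_castSucc, setPair_succ]
  have hmon : ∀ p q, (monomial (setPair k ν (b + p) (b + q)) 1 : Poly m F) =
      c * (X k.castSucc ^ p * X k.succ ^ q) := fun p q => by
    rw [monomial_setPair, hc]
    ring
  have hν : ν = setPair k ν (b + (e + 1)) (b + 0) :=
    (setPair_eq he hb.symm fun _ _ _ => rfl).symm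
  have hsν : sw k ν = setPair k ν (b + 0) (b + (e + 1)) :=
    (setPair_eq (by rw [sw_castSucc, ← hb, add_zero]) (by rw [sw_succ, he])
      fun l h₁ h₂ => sw_of_ne k ν h₁ h₂).symm
  refine ⟨C (1 - t) * ∑ r ∈ Finset.range e,
    monomial (setPair k ν (b + (r + 1)) (b + (e - r))) 1, ?_, fun μ hμ => ?_⟩
  · have h₁ : (monomial ν 1 : Poly m F) = c * X k.castSucc ^ (e + 1) := by
      conv_lhs => rw [hν]
      rw [hmon, pow_zero, mul_one]
    rw [h₁, T_comm_mul hcs, T_X_pow, hsν]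
    simp only [hmon, ← Finset.mul_sum]
    ring
  · rw [coeff_C_mul, coeff_sum] at hμ
    obtain ⟨r, hr, h₁⟩ := Finset.exists_ne_zero_of_sum_ne_zero (right_ne_zero_of_mul hμ)
    rw [coeff_monomial] at h₁
    have h₂ : setPair k ν (b + (r + 1)) (b + (e - r)) = μ := by
      by_contra h₃
      rw [if_neg h₃] at h₁
      exact h₁ rfl
    have hr := Finset.mem_range.1 hr
    refine ⟨fun l hl₁ hl₂ => ?_, ?_, ?_, ?_⟩
    · rw [← h₂, setPair_of_ne k ν _ _ hl₁ hl₂]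
    · rw [← h₂, setPair_castSucc, setPair_succ]
      omega
    · rw [← h₂, setPair_castSucc]
      omega
    · rw [← h₂, setPair_castSucc]
      omega

theorem T_s_apply (t : F) (k : Fin m) (f : Poly m F) :
    T t k (s k f) = t • s k f + t • f - T t k f := by
  have hd : divDiff k (s k f) = -divDiff k f := by
    refine divDiff_eq ?_
    rw [s_s_apply]
    linear_combination -divDiff_spec k f
  rw [T_apply, T_apply, hd]
  ring

theorem T_monomial_of_eq (t : F) {k : Fin m} {ν : Comp m} (h : ν k.castSucc = ν k.succ) :
    T t k (monomial ν 1) = t • (monomial ν 1 : Poly m F) := by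
  rw [T_apply, divDiff_eq (g := 0), mul_zero, add_zero]
  rw [s_monomial, sw_eq_self h, sub_self, mul_zero]

theorem Between.sw {k : Fin m} {ν μ : Comp m} (h : Between k.castSucc k.succ ν μ) :
    Between k.castSucc k.succ (QDunkl.sw k ν) μ := by
  obtain ⟨h₁, h₂, h₃, h₄⟩ := h
  refine ⟨fun l hl₁ hl₂ => ?_, ?_, ?_, ?_⟩
  · rw [h₁ l hl₁ hl₂, sw_of_ne k ν hl₁ hl₂]
  all_goals rw [sw_castSucc, sw_succ]; omega

theorem Between.sw_right {k : Fin m} {ν μ : Comp m} (h : Between k.castSucc k.succ ν μ) :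
    Between k.castSucc k.succ ν (QDunkl.sw k μ) := by
  obtain ⟨h₁, h₂, h₃, h₄⟩ := h
  refine ⟨fun l hl₁ hl₂ => ?_, ?_, ?_, ?_⟩
  · rw [sw_of_ne k μ hl₁ hl₂, h₁ l hl₁ hl₂]
  · rw [sw_castSucc, sw_succ]
    omega
  all_goals rw [sw_castSucc]; omega

/-- `T_k` itself is not triangular, since it interchanges two parts in either order. In `T_k s_k`
the interchanged monomial survives only when it is lower; the remaining monomials have nearer parts.
-/
theorem T_s_monomial (t : F) (k : Fin m) (ν : Comp m) :
    ∃ g : Poly m F, (T t k * s k : Op m F) (monomial ν 1) =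
        (if ν k.succ ≤ ν k.castSucc then t else 1) • monomial ν 1 +
        (if ν k.succ < ν k.castSucc then t - 1 else 0) • monomial (sw k ν) 1 + g ∧
      ∀ μ, g.coeff μ ≠ 0 → Between k.castSucc k.succ ν μ := by
  rw [Module.End.mul_apply]
  rcases lt_trichotomy (ν k.castSucc) (ν k.succ) with h | h | h
  · obtain ⟨g, hg, hg'⟩ := T_monomial_of_gt t (k := k) (ν := sw k ν)
      (by rw [sw_castSucc, sw_succ]; exact h)
    refine ⟨g, ?_, fun μ hμ => sw_sw k ν ▸ (hg' μ hμ).sw⟩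
    rw [if_neg h.not_ge, if_neg h.not_gt, s_monomial, hg, sw_sw, one_smul, zero_smul, add_zero]
  · refine ⟨0, ?_, fun μ hμ => absurd rfl hμ⟩
    rw [if_pos h.ge, if_neg h.not_gt, s_monomial, sw_eq_self h, T_monomial_of_eq t h, zero_smul,
      add_zero, add_zero]
  · obtain ⟨g, hg, hg'⟩ := T_monomial_of_gt t (k := k) (ν := ν) h
    refine ⟨-g, ?_, fun μ hμ => hg' μ fun h0 => hμ (by rw [coeff_neg, h0, neg_zero])⟩
    rw [if_pos h.le, if_pos h, T_s_apply, hg, s_monomial, sub_smul, one_smul]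
    abel

/-- The analogue of `T_s_monomial` for the inverse operator `s_k T_k⁻¹`. -/
theorem s_Tinv_monomial (t : F) (ht : t ≠ 0) (k : Fin m) (ν : Comp m) :
    ∃ g : Poly m F, (s k * Tinv t k : Op m F) (monomial ν 1) =
        (if ν k.succ ≤ ν k.castSucc then t⁻¹ else 1) • monomial ν 1 +
        (if ν k.succ < ν k.castSucc then t⁻¹ - 1 else 0) • monomial (sw k ν) 1 + g ∧
      ∀ μ, g.coeff μ ≠ 0 → Between k.castSucc k.succ ν μ := by
  have hT : (s k * Tinv t k : Op m F) (monomial ν 1) = (t⁻¹ - 1) • monomial (sw k ν) 1 +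
      t⁻¹ • s k (T t k (monomial ν 1)) := by
    simp [Tinv, s_monomial]
  have hsg : ∀ (g : Poly m F) μ, (s k g).coeff μ = g.coeff (sw k μ) := fun g μ => by
    conv_lhs => rw [← sw_sw k μ]
    exact coeff_rename_mapDomain _ (Equiv.injective _) g (sw k μ)
  rw [hT]
  rcases lt_trichotomy (ν k.castSucc) (ν k.succ) with h | h | h
  · obtain ⟨g, hg, hg'⟩ := T_monomial_of_gt t (k := k) (ν := sw k ν)
      (by rw [sw_castSucc, sw_succ]; exact h)
    have hg₂ : T t k (monomial ν 1) =
        t • monomial (sw k ν) 1 + t • monomial ν 1 - (monomial ν 1 + g) := by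
      have := T_s_apply t k (monomial (sw k ν) 1)
      rw [hg, s_monomial, sw_sw] at this
      rw [this]
      abel
    refine ⟨-(t⁻¹ • s k g), ?_, fun μ hμ => ?_⟩
    · rw [if_neg h.not_ge, if_neg h.not_gt, hg₂]
      simp only [map_sub, map_add, map_smul, s_monomial, sw_sw, smul_sub, smul_add, smul_smul,
        inv_mul_cancel₀ ht, one_smul, sub_smul, zero_smul]
      abel
    · rw [coeff_neg, coeff_smul, hsg] at hμ
      have := (hg' _ (right_ne_zero_of_smul (neg_ne_zero.1 hμ))).sw.sw_right
      rwa [sw_sw, sw_sw] at this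
  · refine ⟨0, ?_, fun μ hμ => absurd rfl hμ⟩
    rw [if_pos h.ge, if_neg h.not_gt, T_monomial_of_eq t h, map_smul, s_monomial, sw_eq_self h,
      smul_smul, inv_mul_cancel₀ ht, sub_smul, one_smul, zero_smul]
    abel
  · obtain ⟨g, hg, hg'⟩ := T_monomial_of_gt t (k := k) (ν := ν) h
    refine ⟨t⁻¹ • s k g, ?_, fun μ hμ => ?_⟩
    · rw [if_pos h.le, if_pos h, hg, map_add, s_monomial, sw_sw, smul_add]
      abel
    · rw [coeff_smul, hsg] at hμ
      have := (hg' _ (right_ne_zero_of_smul hμ)).sw_right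
      rwa [sw_sw] at this

/-! ### Triangularity of the Cherednik operators -/

/-- `L` is triangular with respect to `≺` on monomials, with diagonal entries `χ`. -/
structure Tri (L : Op m F) (χ : Comp m → F) : Prop where
  diag : ∀ ν, (L (monomial ν 1)).coeff ν = χ ν
  lower : ∀ ν μ, (L (monomial ν 1)).coeff μ ≠ 0 → μ = ν ∨ Prec μ ν

theorem coeff_op (L : Op m F) (f : Poly m F) (μ : Comp m) :
    (L f).coeff μ = ∑ κ ∈ f.support, f.coeff κ * (L (monomial κ 1)).coeff μ := by
  conv_lhs => rw [f.as_sum, map_sum, coeff_sum]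
  refine Finset.sum_congr rfl fun κ _ => ?_
  rw [← mul_one (f.coeff κ), ← smul_eq_mul, ← smul_monomial, map_smul, coeff_smul, smul_eq_mul,
    smul_eq_mul, mul_one]

theorem Tri.mul {L M : Op m F} {χ ψ : Comp m → F} (hL : Tri L χ) (hM : Tri M ψ) :
    Tri (L * M) (fun ν => χ ν * ψ ν) where
  diag ν := by
    rw [Module.End.mul_apply, coeff_op, Finset.sum_eq_single ν, hL.diag, hM.diag, mul_comm]
    · intro κ hκ hne
      by_contra h
      rcases hM.lower ν κ (mem_support_iff.1 hκ) with h₁ | h₁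
      · exact hne h₁
      rcases hL.lower κ ν (right_ne_zero_of_mul h) with h₂ | h₂
      · exact hne h₂.symm
      exact h₁.asymm h₂
    · intro h
      rw [notMem_support_iff.1 h, zero_mul]
  lower ν μ h := by
    rw [Module.End.mul_apply, coeff_op] at h
    obtain ⟨κ, hκ, h⟩ := Finset.exists_ne_zero_of_sum_ne_zero h
    rcases hM.lower ν κ (mem_support_iff.1 hκ) with rfl | h₁
    · exact hL.lower _ _ (right_ne_zero_of_mul h)
    · rcases hL.lower κ μ (right_ne_zero_of_mul h) with rfl | h₂
      · exact Or.inr h₁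
      · exact Or.inr (h₂.trans h₁)

theorem Tri.smul {L : Op m F} {χ : Comp m → F} (hL : Tri L χ) (c : F) :
    Tri (c • L) (fun ν => c * χ ν) where
  diag ν := by rw [LinearMap.smul_apply, coeff_smul, hL.diag, smul_eq_mul]
  lower ν μ h := hL.lower ν μ (by
    rw [LinearMap.smul_apply, coeff_smul] at h
    exact right_ne_zero_of_smul h)

theorem tri_of_monomial {L : Op m F} {χ : Comp m → F}
    (h : ∀ ν, L (monomial ν 1) = χ ν • monomial ν 1) : Tri L χ where
  diag ν := by rw [h, coeff_smul, coeff_monomial, if_pos rfl, smul_eq_mul, mul_one]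
  lower ν μ hμ := by
    rw [h, coeff_smul, coeff_monomial] at hμ
    exact Or.inl (by_contra fun hne => hμ (by rw [if_neg (Ne.symm hne), smul_zero]))

theorem tri_one : Tri (1 : Op m F) (fun _ => 1) :=
  tri_of_monomial fun ν => by rw [one_smul, Module.End.one_apply]

/-- The permutation `σ` of the variables as an operator. -/
def permOp (σ : Equiv.Perm (Fin (m + 1))) : Op m F := (rename σ).toLinearMap

theorem permOp_mul (σ ρ : Equiv.Perm (Fin (m + 1))) :
    (permOp σ * permOp ρ : Op m F) = permOp (σ * ρ) := by
  refine LinearMap.ext fun f => ?_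
  simp only [permOp, Module.End.mul_apply, AlgHom.toLinearMap_apply, rename_rename,
    Equiv.Perm.coe_mul]

theorem permOp_one : (permOp 1 : Op m F) = 1 := by
  refine LinearMap.ext fun f => ?_
  simp only [permOp, AlgHom.toLinearMap_apply, Module.End.one_apply, Equiv.Perm.coe_one]
  exact rename_id_apply f

theorem permOp_inv_mul (σ : Equiv.Perm (Fin (m + 1))) : (permOp σ⁻¹ * permOp σ : Op m F) = 1 := by
  rw [permOp_mul, inv_mul_cancel, permOp_one]

theorem permOp_mul_inv (σ : Equiv.Perm (Fin (m + 1))) : (permOp σ * permOp σ⁻¹ : Op m F) = 1 := by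
  rw [permOp_mul, mul_inv_cancel, permOp_one]

theorem s_eq_permOp (k : Fin m) : (s k : Op m F) = permOp (Equiv.swap k.castSucc k.succ) := rfl

theorem permOp_monomial (σ : Equiv.Perm (Fin (m + 1))) (ν : Comp m) (a : F) :
    permOp σ (monomial ν a) = monomial (ν.mapDomain σ) a := by
  rw [permOp, AlgHom.toLinearMap_apply, rename_monomial]

theorem coeff_permOp_inv (σ : Equiv.Perm (Fin (m + 1))) (f : Poly m F) (μ : Comp m) :
    (permOp σ⁻¹ f).coeff μ = f.coeff (μ.mapDomain σ) := by
  have h : μ = (μ.mapDomain σ).mapDomain (σ⁻¹ : Equiv.Perm _) := by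
    ext i
    simp [Finsupp.mapDomain_equiv_apply]
  conv_lhs => rw [h]
  exact coeff_rename_mapDomain _ (Equiv.injective _) f _

/-- Let `L` send `x^ν` to a combination of itself, of `x^{s_k ν}` if that is lower, and of monomials
with nearer parts `k` and `k + 1`. If `σ` carries positions `i < j` to `k` and `k + 1`, then the
conjugate `σ⁻¹ L σ` behaves in the same way for the parts `i` and `j`; hence it is triangular. -/
theorem tri_conj {L : Op m F} {k : Fin m} {χ : Comp m → F} {c : F}
    (h : ∀ ν, ∃ g : Poly m F, L (monomial ν 1) = χ ν • monomial ν 1 +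
        (if ν k.succ < ν k.castSucc then c else 0) • monomial (sw k ν) 1 + g ∧
      ∀ μ, g.coeff μ ≠ 0 → Between k.castSucc k.succ ν μ)
    {σ : Equiv.Perm (Fin (m + 1))} {i j : Fin (m + 1)} (hi : σ i = k.castSucc)
    (hj : σ j = k.succ) (hij : i < j) :
    Tri (permOp σ⁻¹ * L * permOp σ) (fun ν => χ (ν.mapDomain σ)) := by
  have hv : ∀ (ν : Comp m) l, ν.mapDomain σ (σ l) = ν l := fun ν l => by
    rw [Finsupp.mapDomain_equiv_apply, Equiv.symm_apply_apply]
  have hinj : ∀ {μ ν : Comp m}, μ.mapDomain σ = ν.mapDomain σ → μ = ν := fun h =>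
    Finsupp.mapDomain_injective σ.injective h
  have hb : ∀ {ν μ : Comp m}, Between k.castSucc k.succ (ν.mapDomain σ) (μ.mapDomain σ) →
      Prec μ ν := fun {ν μ} h => by
    obtain ⟨h₁, h₂, h₃, h₄⟩ := h
    rw [← hi, ← hj] at h₁ h₂
    rw [← hi, ← hj] at h₃ h₄
    simp only [hv] at h₂ h₃ h₄
    refine Between.prec hij.ne ⟨fun l hl₁ hl₂ => ?_, h₂, h₃, h₄⟩
    rw [← hv μ, ← hv ν]
    exact h₁ _ (σ.injective.ne hl₁) (σ.injective.ne hl₂)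
  have hsw : ∀ {ν : Comp m}, sw k (ν.mapDomain σ) =
      (ν.mapDomain (Equiv.swap i j)).mapDomain σ := fun {ν} => by
    rw [sw, ← Finsupp.mapDomain_comp, ← Finsupp.mapDomain_comp, ← hi, ← hj, ← Equiv.Perm.coe_mul,
      ← Equiv.Perm.coe_mul, Equiv.mul_swap_eq_swap_mul]
  have key : ∀ ν μ : Comp m, ∃ a : F, (a ≠ 0 → Prec μ ν) ∧
      ((permOp σ⁻¹ * L * permOp σ : Op m F) (monomial ν 1)).coeff μ =
        (if ν = μ then χ (ν.mapDomain σ) else 0) + a := fun ν μ => by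
    obtain ⟨g, hg, hg'⟩ := h (ν.mapDomain σ)
    rw [Module.End.mul_apply, Module.End.mul_apply, permOp_monomial, coeff_permOp_inv, hg]
    simp only [coeff_add, coeff_smul, coeff_monomial, smul_eq_mul, add_assoc]
    refine ⟨_, fun ha => ?_, congrArg₂ _ ?_ rfl⟩
    · by_cases h₁ : g.coeff (μ.mapDomain σ) = 0
      · rw [h₁, add_zero] at ha
        have h₂ := left_ne_zero_of_mul ha
        have h₃ := right_ne_zero_of_mul ha
        simp only [ne_eq, ite_eq_right_iff, Classical.not_imp] at h₂ h₃
        have h₄ := h₂.1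
        rw [← hi, ← hj, hv, hv] at h₄
        rw [← hinj (hsw.symm.trans h₃.1)]
        exact prec_swap hij h₄
      · exact hb (hg' _ h₁)
    · by_cases h₁ : ν = μ
      · rw [if_pos h₁, if_pos (by rw [h₁]), mul_one]
      · rw [if_neg h₁, if_neg fun h₂ => h₁ (hinj h₂), mul_zero]
  refine ⟨fun ν => ?_, fun ν μ hμ => ?_⟩
  · obtain ⟨a, ha, e⟩ := key ν ν
    rw [e, if_pos rfl, by_contra fun h => (ha h).1 rfl, add_zero]
  · obtain ⟨a, ha, e⟩ := key ν μ
    rw [e] at hμ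
    by_cases h : ν = μ
    · exact Or.inl h.symm
    · rw [if_neg h, zero_add] at hμ
      exact Or.inr (ha hμ)

/-- `T_lo⁻¹ ⋯ T_{i-1}⁻¹` is the permutation `s_lo ⋯ s_{i-1}` times a triangular operator. The latter
is a product of conjugates of `s_k T_k⁻¹`, the one with index `k` comparing the parts `k` and `i`.
-/
theorem prodUp_Tinv_tri {t : F} (ht : t ≠ 0) {lo : ℕ} (i : Fin (m + 1)) (hlo : lo ≤ i.val) :
    ∃ σ : Equiv.Perm (Fin (m + 1)), (prodUp s lo i.val : Op m F) = permOp σ ∧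
      (σ i).val = lo ∧ (∀ l : Fin (m + 1), l.val < lo → σ l = l) ∧
      ∃ L, prodUp (Tinv t) lo i.val = permOp σ * L ∧
        Tri L (fun ν => t⁻¹ ^ #{l : Fin (m + 1) | lo ≤ l.val ∧ l < i ∧ ν i ≤ ν l}) := by
  induction hlo using Nat.decreasingInduction with
  | self =>
    refine ⟨1, ?_, rfl, fun _ _ => rfl, 1, ?_, ?_⟩
    · rw [prodUp_of_le _ le_rfl, permOp_one]
    · rw [prodUp_of_le _ le_rfl, permOp_one, one_mul]
    · convert tri_one (m := m) (F := F) using 2 with ν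
      rw [Finset.card_eq_zero.2, pow_zero]
      rw [Finset.filter_eq_empty_iff]
      intro l _ h
      have := Fin.lt_def.1 h.2.1
      omega
  | of_succ p hp ih =>
    obtain ⟨σ, h₁, h₂, h₃, L, hL, hT⟩ := ih
    obtain ⟨k, rfl⟩ : ∃ k : Fin m, k.val = p := ⟨⟨p, by omega⟩, rfl⟩
    have hi : σ i = k.succ := Fin.ext (by rw [h₂, Fin.val_succ])
    have hk : σ k.castSucc = k.castSucc := h₃ _ (by simp)
    have hs : permOp (Equiv.swap k.castSucc k.succ) * permOp (Equiv.swap k.castSucc k.succ) =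
        (1 : Op m F) := s_mul_s k
    refine ⟨Equiv.swap k.castSucc k.succ * σ, ?_, ?_, fun l hl => ?_,
      (permOp σ⁻¹ * (s k * Tinv t k) * permOp σ) * L, ?_, ?_⟩
    · rw [prodUp_eq_mul _ k hp, h₁, ← permOp_mul, s_eq_permOp]
    · rw [Equiv.Perm.mul_apply, hi, Equiv.swap_apply_right, Fin.val_castSucc]
    · rw [Equiv.Perm.mul_apply, h₃ l (by omega), Equiv.swap_apply_of_ne_of_ne]
      · intro e; rw [e] at hl; simp at hl
      · intro e
        rw [e, Fin.val_succ] at hl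
        omega
    · rw [prodUp_eq_mul _ k hp, hL, ← permOp_mul, s_eq_permOp]
      calc Tinv t k * (permOp σ * L) = (permOp (Equiv.swap k.castSucc k.succ) *
            permOp (Equiv.swap k.castSucc k.succ)) * (Tinv t k * (permOp σ * L)) := by
            rw [hs, one_mul]
        _ = permOp (Equiv.swap k.castSucc k.succ) * (permOp σ * permOp σ⁻¹) *
            (permOp (Equiv.swap k.castSucc k.succ) * (Tinv t k * (permOp σ * L))) := by
            rw [permOp_mul_inv]; simp only [mul_one, mul_assoc]
        _ = _ := by simp only [mul_assoc]
    · convert (tri_conj (s_Tinv_monomial t ht k) hk hi (Fin.lt_def.2 hp)).mul hT using 2 with ν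
      have e₁ : ν.mapDomain σ k.succ = ν i := by
        rw [← hi, Finsupp.mapDomain_equiv_apply, Equiv.symm_apply_apply]
      have e₂ : ν.mapDomain σ k.castSucc = ν k.castSucc := by
        conv_lhs => rw [← hk]
        rw [Finsupp.mapDomain_equiv_apply, Equiv.symm_apply_apply]
      rw [e₁, e₂]
      by_cases hν : ν i ≤ ν k.castSucc
      · rw [if_pos hν, ← pow_succ']
        congr 1
        rw [← Finset.card_insert_of_notMem (a := k.castSucc)]
        · congr 1
          ext l
          simp only [Finset.mem_insert, Finset.mem_filter, Finset.mem_univ, true_and, Fin.lt_def,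
            Fin.ext_iff, Fin.val_castSucc]
          constructor
          · rintro ⟨a, b, c⟩
            by_cases hl : l.val = k.val
            · exact Or.inl hl
            · exact Or.inr ⟨by omega, b, c⟩
          · rintro (a | ⟨a, b, c⟩)
            · refine ⟨a.ge, by omega, ?_⟩
              rwa [show l = k.castSucc from Fin.ext a]
            · exact ⟨by omega, b, c⟩
        · simp
      · rw [if_neg hν, one_mul]
        congr 2
        ext l
        simp only [Finset.mem_filter, Finset.mem_univ, true_and]
        constructor
        · rintro ⟨a, b, c⟩
          refine ⟨?_, b, c⟩
          by_contra hl
          have : l = k.castSucc := Fin.ext (by rw [Fin.val_castSucc]; omega)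
          rw [this] at c
          exact hν c
        · rintro ⟨a, b, c⟩
          exact ⟨by omega, b, c⟩

/-- `T_i ⋯ T_{hi-1} s_{hi-1} ⋯ s_i` is triangular: it is a product of conjugates of `T_k s_k`, the
one with index `k` comparing the parts `i` and `k + 1`. -/
theorem prodUp_T_prodDown_s_tri (t : F) {hi : ℕ} (i : Fin (m + 1)) (h : i.val ≤ hi)
    (hm : hi ≤ m) :
    ∃ σ : Equiv.Perm (Fin (m + 1)), (prodDown s i.val hi : Op m F) = permOp σ ∧
      (σ i).val = hi ∧ (∀ l : Fin (m + 1), hi < l.val → σ l = l) ∧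
      Tri (prodUp (T t) i.val hi * prodDown s i.val hi)
        (fun ν => t ^ #{l : Fin (m + 1) | i < l ∧ l.val ≤ hi ∧ ν l ≤ ν i}) := by
  induction hi, h using Nat.le_induction with
  | base =>
    refine ⟨1, ?_, rfl, fun _ _ => rfl, ?_⟩
    · rw [prodDown_of_le _ le_rfl, permOp_one]
    · rw [prodDown_of_le _ le_rfl, prodUp_of_le _ le_rfl, one_mul]
      convert tri_one (m := m) (F := F) using 2 with ν
      rw [Finset.card_eq_zero.2, pow_zero]
      rw [Finset.filter_eq_empty_iff]
      intro l _ h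
      have := Fin.lt_def.1 h.1
      omega
  | succ p hp ih =>
    obtain ⟨σ, h₁, h₂, h₃, hT⟩ := ih (by omega)
    obtain ⟨k, rfl⟩ : ∃ k : Fin m, k.val = p := ⟨⟨p, by omega⟩, rfl⟩
    have hi : σ i = k.castSucc := Fin.ext (by rw [h₂, Fin.val_castSucc])
    have hk : σ k.succ = k.succ := h₃ _ (by simp)
    refine ⟨Equiv.swap k.castSucc k.succ * σ, ?_, ?_, fun l hl => ?_, ?_⟩
    · rw [prodDown_succ _ k hp, h₁, ← permOp_mul, s_eq_permOp]
    · rw [Equiv.Perm.mul_apply, hi, Equiv.swap_apply_left, Fin.val_succ]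
    · rw [Equiv.Perm.mul_apply, h₃ l (by omega), Equiv.swap_apply_of_ne_of_ne]
      · intro e
        rw [e, Fin.val_castSucc] at hl
        omega
      · intro e; rw [e] at hl; simp at hl
    · have e : prodUp (T t) i.val (k.val + 1) * prodDown s i.val (k.val + 1) =
          (prodUp (T t) i.val k.val * prodDown s i.val k.val) *
            (permOp σ⁻¹ * (T t k * s k) * permOp σ) := by
        rw [prodUp_succ _ k hp, prodDown_succ _ k hp, h₁]
        calc _ = prodUp (T t) i.val k.val * 1 * (T t k * s k * permOp σ) := by
              simp only [mul_assoc, one_mul]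
          _ = _ := by rw [← permOp_mul_inv σ]; simp only [mul_assoc]
      rw [e]
      convert hT.mul (tri_conj (T_s_monomial t k) hi hk (Fin.lt_def.2 (by simp; omega)))
        using 2 with ν
      have e₁ : ν.mapDomain σ k.castSucc = ν i := by
        rw [← hi, Finsupp.mapDomain_equiv_apply, Equiv.symm_apply_apply]
      have e₂ : ν.mapDomain σ k.succ = ν k.succ := by
        conv_lhs => rw [← hk]
        rw [Finsupp.mapDomain_equiv_apply, Equiv.symm_apply_apply]
      rw [e₁, e₂]
      by_cases hν : ν k.succ ≤ ν i
      · rw [if_pos hν, ← pow_succ]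
        congr 1
        rw [← Finset.card_insert_of_notMem (a := k.succ)]
        · congr 1
          ext l
          simp only [Finset.mem_insert, Finset.mem_filter, Finset.mem_univ, true_and, Fin.lt_def,
            Fin.ext_iff, Fin.val_succ]
          constructor
          · rintro ⟨a, b, c⟩
            by_cases hl : l.val = k.val + 1
            · exact Or.inl hl
            · exact Or.inr ⟨a, by omega, c⟩
          · rintro (a | ⟨a, b, c⟩)
            · refine ⟨by omega, a.le, ?_⟩
              rwa [show l = k.succ from Fin.ext a]
            · exact ⟨a, by omega, c⟩
        · simp
      · rw [if_neg hν, mul_one]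
        congr 2
        ext l
        simp only [Finset.mem_filter, Finset.mem_univ, true_and]
        constructor
        · rintro ⟨a, b, c⟩
          refine ⟨a, ?_, c⟩
          by_contra hl
          have : l = k.succ := Fin.ext (by rw [Fin.val_succ]; omega)
          rw [this] at c
          exact hν c
        · rintro ⟨a, b, c⟩
          exact ⟨a, by omega, c⟩

theorem τ_monomial (q : F) (i : Fin (m + 1)) (ν : Comp m) :
    τ q i (monomial ν 1) = q ^ ν i • (monomial ν 1 : Poly m F) := by
  rw [τ, AlgHom.toLinearMap_apply, aeval_monomial, monomial_eq, map_one, C_1, one_mul, one_mul,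
    Finsupp.prod_fintype _ _ (fun _ => pow_zero _), Finsupp.prod_fintype _ _ (fun _ => pow_zero _),
    ← Finset.mul_prod_erase _ _ (Finset.mem_univ i),
    ← Finset.mul_prod_erase Finset.univ (fun j => X j ^ ν j) (Finset.mem_univ i), if_pos rfl,
    smul_eq_C_mul, mul_pow, ← C_pow, mul_assoc]
  congr 2
  exact Finset.prod_congr rfl fun j hj => by rw [if_neg (Finset.ne_of_mem_erase hj)]

/-- The Cherednik operators are triangular: `Y_i` is, up to a power of `t`, the product of
conjugates of `T_k s_k`, of `τ_i`, and of conjugates of `s_k T_k⁻¹`. -/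
theorem Y_tri (q : F) {t : F} (ht : t ≠ 0) (i : Fin (m + 1)) :
    Tri (Y q t i) (fun ν => eigenval q t ν i) := by
  have him : i.val ≤ m := Nat.lt_succ_iff.1 i.isLt
  obtain ⟨σ, h₁, h₂, -, L, hL, hTL⟩ := prodUp_Tinv_tri (m := m) ht i (Nat.zero_le _)
  obtain ⟨-, -, -, -, hU⟩ := prodUp_T_prodDown_s_tri (m := m) t i him le_rfl
  have h₀ : (prodDown s 0 i.val : Op m F) = permOp σ⁻¹ := by
    have := prodDown_mul_prodUp (A := s) (B := s) (s_mul_s (m := m) (F := F))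
      (Nat.zero_le i.val) him
    calc prodDown s 0 i.val = prodDown s 0 i.val * (permOp σ * permOp σ⁻¹) := by
          rw [permOp_mul_inv, mul_one]
      _ = _ := by rw [← h₁, ← mul_assoc, this, one_mul]
  have hτ : Tri (permOp σ⁻¹ * τ q 0 * permOp σ : Op m F) (fun ν => q ^ ν i) := by
    refine tri_of_monomial fun ν => ?_
    have e : ν.mapDomain σ 0 = ν i := by
      rw [← (show σ i = 0 from Fin.ext h₂), Finsupp.mapDomain_equiv_apply, Equiv.symm_apply_apply]
    have e' : (permOp σ⁻¹ (monomial (ν.mapDomain σ) 1) : Poly m F) = monomial ν 1 := by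
      rw [← permOp_monomial, ← Module.End.mul_apply, permOp_inv_mul, Module.End.one_apply]
    rw [Module.End.mul_apply, Module.End.mul_apply, permOp_monomial, τ_monomial, map_smul, e, e']
  have hY : Y q t i = t ^ ((i.val : ℤ) - m) • ((prodUp (T t) i.val m * prodDown s i.val m) *
      ((permOp σ⁻¹ * τ q 0 * permOp σ) * L)) := by
    rw [Y, ω, hL, ← h₀, ← prodDown_mul_prodDown s (Nat.zero_le _) him le_rfl]
    simp only [mul_assoc]
  rw [hY]
  convert (hU.mul (hτ.mul hTL)).smul (t ^ ((i.val : ℤ) - m)) using 2 with ν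
  -- The power `t^{i-n}` turns the parts to the right of `i` which are at most `ν i` into those
  -- which are larger.
  have hcard : #{l : Fin (m + 1) | i < l ∧ l.val ≤ m ∧ ν l ≤ ν i} +
      #{l ∈ Finset.Ioi i | ν i < ν l} = m - i.val := by
    rw [show m - i.val = m + 1 - 1 - i.val by omega, ← Fin.card_Ioi,
      ← Finset.card_filter_add_card_filter_not (s := Finset.Ioi i)
      (p := fun l => ν l ≤ ν i)]
    congr 2
    · ext l
      have := l.isLt
      simp only [Finset.mem_filter, Finset.mem_univ, true_and, Finset.mem_Ioi]
      exact ⟨fun h => ⟨h.1, h.2.2⟩, fun h => ⟨h.1, by omega, h.2⟩⟩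
    · simp only [not_le]
  have hcard' : #{l : Fin (m + 1) | 0 ≤ l.val ∧ l < i ∧ ν i ≤ ν l} =
      #{l ∈ Finset.Iio i | ν i ≤ ν l} := by
    congr 1
    ext l
    simp
  rw [hcard', eigenval, legCo]
  set a := #{l : Fin (m + 1) | i < l ∧ l.val ≤ m ∧ ν l ≤ ν i}
  set b := #{l ∈ Finset.Ioi i | ν i < ν l}
  set c := #{l ∈ Finset.Iio i | ν i ≤ ν l}
  have hz : (i.val : ℤ) - m = -(a : ℤ) - b := by omega
  rw [hz, zpow_sub₀ ht, zpow_neg, zpow_natCast, zpow_natCast, pow_add, inv_pow, inv_pow]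
  have := pow_ne_zero a ht
  have := pow_ne_zero b ht
  have := pow_ne_zero c ht
  field_simp

/-! ### Joint eigenvectors -/

/-- `l` ranks the parts of `η` in decreasing order: it takes the values `0, …, n - 1`, once each,
and larger parts come first. The order among equal parts is arbitrary; `legCo` is the ranking from
left to right. -/
structure Ranks (l : Fin (m + 1) → ℕ) (η : Comp m) : Prop where
  card_lt : ∀ i, #{j | l j < l i} = l i
  lt_of_lt : ∀ i j, η i < η j → l j < l i

theorem legCo_eq (η : Comp m) (i : Fin (m + 1)) :
    legCo η i = #{k : Fin (m + 1) | k < i ∧ η i ≤ η k ∨ i < k ∧ η i < η k} := by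
  rw [legCo, ← Finset.card_union_of_disjoint]
  · congr 1
    ext k
    simp
  · rw [Finset.disjoint_left]
    intro k h₁ h₂
    simp only [Finset.mem_filter, Finset.mem_Iio, Finset.mem_Ioi] at h₁ h₂
    exact h₁.1.asymm h₂.1

theorem legCo_lt_iff (η : Comp m) (i k : Fin (m + 1)) :
    legCo η k < legCo η i ↔ k < i ∧ η i ≤ η k ∨ i < k ∧ η i < η k := by
  have key : ∀ i k : Fin (m + 1), (k < i ∧ η i ≤ η k ∨ i < k ∧ η i < η k) →
      legCo η k < legCo η i := fun i k h => by
    rw [legCo_eq, legCo_eq]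
    refine Finset.card_lt_card ⟨fun j hj => ?_, fun hsub => ?_⟩
    · simp only [Finset.mem_filter, Finset.mem_univ, true_and] at hj ⊢
      simp only [Fin.lt_def] at *
      by_cases h₁ : j.val < i.val
      · left
        omega
      · have h₂ : j.val ≠ i.val := fun e => by
          have : j = i := Fin.ext e
          subst this
          omega
        right
        omega
    · have := hsub (Finset.mem_filter.2 ⟨Finset.mem_univ k, h⟩)
      simp at this
  refine ⟨fun h => ?_, key i k⟩
  by_contra h'
  by_cases e : i = k
  · rw [e] at h
    exact lt_irrefl _ h
  · refine (key k i ?_).asymm h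
    have : i.val ≠ k.val := fun h => e (Fin.ext h)
    simp only [Fin.lt_def] at *
    omega

theorem ranks_legCo (η : Comp m) : Ranks (legCo η) η where
  card_lt i := by
    simp only [legCo_lt_iff]
    exact (legCo_eq η i).symm
  lt_of_lt i j h := by
    rw [legCo_lt_iff]
    rcases lt_trichotomy i j with h' | rfl | h'
    · exact Or.inr ⟨h', h⟩
    · exact absurd h (lt_irrefl _)
    · exact Or.inl ⟨h', h.le⟩

theorem Ranks.comp {l : Fin (m + 1) → ℕ} {η η' : Comp m} (h : Ranks l η)
    (σ : Equiv.Perm (Fin (m + 1))) (hσ : ∀ i, η' i = η (σ i)) : Ranks (l ∘ σ) η' where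
  card_lt i := by
    refine Eq.trans ?_ (h.card_lt (σ i))
    refine Finset.card_bij (fun j _ => σ j) (fun j hj => ?_) (fun _ _ _ _ e => σ.injective e)
      fun j hj => ⟨σ.symm j, ?_, by simp⟩
    · simpa using hj
    · simpa using hj
  lt_of_lt i j hij := by
    rw [hσ, hσ] at hij
    exact h.lt_of_lt _ _ hij

theorem legCo_le (η : Comp m) (i : Fin (m + 1)) : legCo η i ≤ m := by
  rw [← (ranks_legCo η).card_lt i, ← Nat.lt_succ_iff]
  refine (Finset.card_lt_card (t := Finset.univ) ⟨Finset.subset_univ _, fun h => ?_⟩).trans_eq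
    (by simp)
  have := h (Finset.mem_univ i)
  simp at this

/-- The joint eigenvalues separate compositions. At an index of the largest part on which `ν` and
`η` differ, an equality of eigenvalues would be a relation `q ^ a * t ^ b = 1` with `a ≥ 1`. -/
theorem eq_of_eigenvalue_eq {q t : F} (hq : q ≠ 0) (ht : t ≠ 0)
    (hqt : ∀ a b : ℕ, 1 ≤ a → q ^ a * t ^ b ≠ 1) {l l' : Fin (m + 1) → ℕ} {ν η : Comp m}
    (hl : Ranks l ν) (hl' : Ranks l' η)
    (h : ∀ i, q ^ ν i * t⁻¹ ^ l i = q ^ η i * t⁻¹ ^ l' i) : ν = η := by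
  -- The symmetric core: `i` has the largest part on which the compositions differ.
  have key : ∀ {l l' : Fin (m + 1) → ℕ} {ν η : Comp m}, Ranks l ν → Ranks l' η →
      (∀ i, q ^ ν i * t⁻¹ ^ l i = q ^ η i * t⁻¹ ^ l' i) → ∀ i, ν i < η i →
      (∀ j, ν j ≠ η j → max (ν j) (η j) ≤ η i) → False := by
    intro l l' ν η hl hl' h i hi hmax
    -- Among the indices `j` with `η j = η i` and `ν j < η j` choose `p` of least rank in `η`. The
    -- indices ranked before `p` in `η` are then also ranked before `p` in `ν`.
    obtain ⟨p, hp, hpmin⟩ := Finset.exists_min_image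
      (Finset.univ.filter fun j => η j = η i ∧ ν j < η i) l' ⟨i, by simp [hi]⟩
    simp only [Finset.mem_filter, Finset.mem_univ, true_and] at hp hpmin
    have hle : l' p ≤ l p := by
      rw [← hl.card_lt p, ← hl'.card_lt p]
      refine Finset.card_le_card fun j hj => ?_
      simp only [Finset.mem_filter, Finset.mem_univ, true_and] at hj ⊢
      apply hl.lt_of_lt
      have h₁ : η p ≤ η j := by
        by_contra h₁
        exact (hl'.lt_of_lt _ _ (not_le.1 h₁)).asymm hj
      by_cases h₂ : ν j = η j
      · omega
      · have h₃ := hmax j h₂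
        have h₄ : ¬ (η j = η i ∧ ν j < η i) := fun h₄ => (hpmin j h₄).not_gt hj
        omega
    refine hqt (η p - ν p) (l p - l' p) (by omega) ?_
    have h₁ := h p
    have e₁ : η p = ν p + (η p - ν p) := by omega
    have e₂ : l p = l' p + (l p - l' p) := by omega
    rw [e₁, e₂, pow_add, pow_add, inv_pow, inv_pow] at h₁
    have := pow_ne_zero (ν p) hq
    have := pow_ne_zero (l' p) ht
    have := pow_ne_zero (l p - l' p) ht
    field_simp at h₁
    exact (mul_comm _ _).trans h₁.symm
  by_contra hne
  have hS : (Finset.univ.filter fun j => ν j ≠ η j).Nonempty := by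
    by_contra h₀
    rw [Finset.not_nonempty_iff_eq_empty, Finset.filter_eq_empty_iff] at h₀
    exact hne (Finsupp.ext fun j => not_not.1 (h₀ (Finset.mem_univ j)))
  obtain ⟨i, hi, hmax⟩ := Finset.exists_max_image _ (fun j => max (ν j) (η j)) hS
  simp only [Finset.mem_filter, Finset.mem_univ, true_and] at hi hmax
  rcases lt_or_gt_of_ne hi with h₁ | h₁
  · exact key hl hl' h i h₁ fun j hj => (hmax j hj).trans_eq (max_eq_right h₁.le)
  · exact key hl' hl (fun i => (h i).symm) i h₁ fun j hj => by
      rw [max_comm]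
      exact (hmax j hj.symm).trans_eq (max_eq_left h₁.le)

/-- A joint eigenvector of the Cherednik operators with the eigenvalues of `η` is supported on
compositions `ν ⪯ η`: a maximal composition in its support has the eigenvalues of `η`. -/
theorem eigenvector_support {q t : F} (hq : q ≠ 0) (ht : t ≠ 0)
    (hqt : ∀ a b : ℕ, 1 ≤ a → q ^ a * t ^ b ≠ 1) {l : Fin (m + 1) → ℕ} {η : Comp m}
    (hl : Ranks l η) {f : Poly m F} (hf : ∀ i, Y q t i f = (q ^ η i * t⁻¹ ^ l i) • f)
    {ν : Comp m} (hν : f.coeff ν ≠ 0) : (ν = η ∨ Prec ν η) ∧ f.coeff η ≠ 0 := by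
  have hfin : {μ | f.coeff μ ≠ 0 ∧ (ν = μ ∨ Prec ν μ)}.Finite :=
    f.support.finite_toSet.subset fun μ hμ => mem_support_iff.2 hμ.1
  have hwf : {μ | f.coeff μ ≠ 0 ∧ (ν = μ ∨ Prec ν μ)}.WellFoundedOn (fun a b => Prec b a) :=
    hfin.wellFoundedOn
  obtain ⟨⟨μ, hμ, hνμ⟩, -, hmin⟩ := WellFounded.has_min hwf Set.univ
    ⟨⟨ν, hν, Or.inl rfl⟩, Set.mem_univ _⟩
  have hmax : ∀ κ, f.coeff κ ≠ 0 → ¬ Prec μ κ := fun κ hκ h => by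
    refine hmin ⟨κ, hκ, Or.inr ?_⟩ (Set.mem_univ _) h
    rcases hνμ with rfl | h'
    · exact h
    · exact h'.trans h
  have hμη : μ = η := by
    refine eq_of_eigenvalue_eq hq ht hqt (ranks_legCo μ) hl fun i => ?_
    have h₁ := congrArg (coeff μ) (hf i)
    rw [coeff_op, Finset.sum_eq_single μ, (Y_tri q ht i).diag, coeff_smul, smul_eq_mul,
      mul_comm] at h₁
    · exact mul_right_cancel₀ hμ h₁
    · intro κ hκ hne
      by_contra h₂
      rcases (Y_tri q ht i).lower κ μ (right_ne_zero_of_mul h₂) with h₃ | h₃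
      · exact hne h₃.symm
      · exact hmax κ (mem_support_iff.1 hκ) h₃
    · intro h₂
      rw [notMem_support_iff.1 h₂, zero_mul]
  rw [← hμη]
  exact ⟨hνμ, hμ⟩

theorem eq_zero_of_eigenvector {q t : F} (hq : q ≠ 0) (ht : t ≠ 0)
    (hqt : ∀ a b : ℕ, 1 ≤ a → q ^ a * t ^ b ≠ 1) {l : Fin (m + 1) → ℕ} {η : Comp m}
    (hl : Ranks l η) {f : Poly m F} (hf : ∀ i, Y q t i f = (q ^ η i * t⁻¹ ^ l i) • f)
    (h0 : f.coeff η = 0) : f = 0 := by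
  ext ν
  rw [coeff_zero]
  by_contra hν
  exact (eigenvector_support hq ht hqt hl hf hν).2 h0

/-- The joint eigenspaces are one-dimensional. -/
theorem eq_smul_of_eigenvector {q t : F} (hq : q ≠ 0) (ht : t ≠ 0)
    (hqt : ∀ a b : ℕ, 1 ≤ a → q ^ a * t ^ b ≠ 1) {η : Comp m} {P f : Poly m F}
    (hP : IsMacdonald q t η P) (hf : ∀ i, Y q t i f = eigenval q t η i • f) :
    f = f.coeff η • P := by
  rw [← sub_eq_zero]
  refine eq_zero_of_eigenvector hq ht hqt (ranks_legCo η) (fun i => ?_) ?_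
  · rw [map_sub, map_smul, hf, hP.eigen, smul_sub, smul_comm]
    rfl
  · rw [coeff_sub, coeff_smul, hP.coeff_self, smul_eq_mul, mul_one, sub_self]

theorem IsMacdonald.unique {q t : F} (hq : q ≠ 0) (ht : t ≠ 0)
    (hqt : ∀ a b : ℕ, 1 ≤ a → q ^ a * t ^ b ≠ 1) {η : Comp m} {P Q : Poly m F}
    (hP : IsMacdonald q t η P) (hQ : IsMacdonald q t η Q) : P = Q := by
  rw [eq_smul_of_eigenvector hq ht hqt hQ hP.eigen, hP.coeff_self, one_smul]

theorem isMacdonald_of_eigenvector {q t : F} (hq : q ≠ 0) (ht : t ≠ 0)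
    (hqt : ∀ a b : ℕ, 1 ≤ a → q ^ a * t ^ b ≠ 1) {η : Comp m} {f : Poly m F} (h0 : f.coeff η ≠ 0)
    (hf : ∀ i, Y q t i f = eigenval q t η i • f) :
    IsMacdonald q t η ((f.coeff η)⁻¹ • f) where
  coeff_self := by rw [coeff_smul, smul_eq_mul, inv_mul_cancel₀ h0]
  triangular ν hν := by
    rw [coeff_smul] at hν
    exact (eigenvector_support hq ht hqt (ranks_legCo η) hf (right_ne_zero_of_smul hν)).1
  eigen i := by rw [map_smul, hf, smul_comm]

/-! ### Affine Hecke relations -/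

/-- `s_h ⋯ s_1` is the cyclic permutation which sends the first position to the position `h + 1` and
moves the positions `2, …, h + 1` down by one. -/
theorem prodDown_s_eq {h : ℕ} (hm : h ≤ m) :
    ∃ σ : Equiv.Perm (Fin (m + 1)), (prodDown s 0 h : Op m F) = permOp σ ∧ (σ 0).val = h ∧
      (∀ i : Fin m, i.val < h → σ i.succ = i.castSucc) ∧
      ∀ l : Fin (m + 1), h < l.val → σ l = l := by
  induction h with
  | zero =>
    exact ⟨1, by rw [prodDown_of_le _ le_rfl, permOp_one], rfl, fun _ h => absurd h (by omega),
      fun _ _ => rfl⟩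
  | succ p ih =>
    obtain ⟨σ, h₁, h₂, h₃, h₄⟩ := ih (by omega)
    obtain ⟨k, rfl⟩ : ∃ k : Fin m, k.val = p := ⟨⟨p, by omega⟩, rfl⟩
    refine ⟨Equiv.swap k.castSucc k.succ * σ, ?_, ?_, fun i hi => ?_, fun l hl => ?_⟩
    · rw [prodDown_succ _ k (Nat.zero_le _), h₁, ← permOp_mul, s_eq_permOp]
    · rw [Equiv.Perm.mul_apply, show σ 0 = k.castSucc from Fin.ext h₂, Equiv.swap_apply_left,
        Fin.val_succ]
    · rw [Equiv.Perm.mul_apply]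
      rcases (Nat.lt_succ_iff.1 hi).lt_or_eq with h | h
      · rw [h₃ i h, Equiv.swap_apply_of_ne_of_ne]
        · exact fun e => h.ne (by simpa [Fin.ext_iff] using e)
        · intro e
          have : i.val = k.val + 1 := by simpa [Fin.ext_iff] using e
          omega
      · rw [Fin.ext h, h₄ k.succ (by simp), Equiv.swap_apply_right]
    · rw [Equiv.Perm.mul_apply, h₄ l (by omega), Equiv.swap_apply_of_ne_of_ne]
      · intro e
        rw [e, Fin.val_castSucc] at hl
        omega
      · intro e
        rw [e, Fin.val_succ] at hl
        omega

/-- The algebra homomorphism underlying `ω`: `x_1 ↦ q x_n` and `x_{i+1} ↦ x_i`. -/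
def ωHom (q : F) : Poly m F →ₐ[F] Poly m F :=
  aeval (Fin.cons (C q * X (Fin.last m)) fun i => X i.castSucc)

theorem ωHom_X_zero (q : F) : ωHom q (X 0 : Poly m F) = C q * X (Fin.last m) := by
  rw [ωHom, aeval_X, Fin.cons_zero]

theorem ωHom_X_succ (q : F) (i : Fin m) : ωHom q (X i.succ : Poly m F) = X i.castSucc := by
  rw [ωHom, aeval_X, Fin.cons_succ]

theorem ω_apply (q : F) (f : Poly m F) : ω q f = ωHom q f := by
  obtain ⟨σ, h₁, h₂, h₃, -⟩ := prodDown_s_eq (F := F) (le_refl m)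
  have h : (rename σ).comp (aeval fun j : Fin (m + 1) => if j = 0 then C q * X j else X j) =
      (ωHom q : Poly m F →ₐ[F] Poly m F) := by
    refine algHom_ext fun i => ?_
    rw [AlgHom.comp_apply, aeval_X]
    refine Fin.cases ?_ (fun i => ?_) i
    · rw [if_pos rfl, map_mul, rename_X, ωHom_X_zero, rename_C,
        show σ 0 = Fin.last m from Fin.ext h₂]
    · rw [if_neg (Fin.succ_ne_zero i), rename_X, h₃ i i.isLt, ωHom_X_succ]
  rw [ω, h₁, ← h]
  rfl

theorem ω_mul_mulX_zero (q : F) :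
    ω q * mulX 0 = q • (mulX (Fin.last m) * ω q : Op m F) := by
  refine LinearMap.ext fun f => ?_
  simp only [Module.End.mul_apply, mulX, LinearMap.mulLeft_apply, LinearMap.smul_apply, ω_apply,
    map_mul, ωHom_X_zero, smul_eq_C_mul, mul_assoc]

theorem ω_mul_mulX_succ (q : F) (i : Fin m) :
    ω q * mulX i.succ = (mulX i.castSucc * ω q : Op m F) := by
  refine LinearMap.ext fun f => ?_
  simp only [Module.End.mul_apply, mulX, LinearMap.mulLeft_apply, ω_apply, map_mul, ωHom_X_succ]

theorem algHom_s {φ : Poly m F →ₐ[F] Poly m F} {k l : Fin m}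
    (h : ∀ i, φ (s l (X i)) = s k (φ (X i))) (f : Poly m F) : φ (s l f) = s k (φ f) := by
  have : φ.comp (rename (Equiv.swap l.castSucc l.succ)) =
      (rename (Equiv.swap k.castSucc k.succ)).comp φ := algHom_ext h
  exact DFunLike.congr_fun this f

theorem T_mul_ω (q t : F) {k l : Fin m} (h : k.val + 1 = l.val) :
    T t k * ω q = ω q * T t l := by
  have e₁ : l.castSucc = k.succ := Fin.ext (by simp [h])
  have h₁ : ωHom q (X l.castSucc : Poly m F) = C 1 * X k.castSucc := by
    rw [e₁, ωHom_X_succ, C_1, one_mul]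
  have h₂ : ωHom q (X l.succ : Poly m F) = C 1 * X k.succ := by
    rw [ωHom_X_succ, e₁, C_1, one_mul]
  refine LinearMap.ext fun f => ?_
  rw [Module.End.mul_apply, Module.End.mul_apply, ω_apply, ω_apply,
    T_algHom (ωHom q) h₁ h₂ (algHom_s fun i => ?_)]
  rw [C_1, one_mul] at h₁ h₂
  rcases eq_or_ne i l.castSucc with rfl | hi₁
  · rw [s_X_castSucc, h₁, h₂, s_X_castSucc]
  rcases eq_or_ne i l.succ with rfl | hi₂
  · rw [s_X_succ, h₁, h₂, s_X_succ]
  rw [s_X_of_ne l hi₁ hi₂]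
  revert hi₁ hi₂
  refine Fin.cases (fun _ _ => ?_) (fun i hi₁ hi₂ => ?_) i
  · rw [ωHom_X_zero, s_mul_apply, s_C, s_X_of_ne]
    · exact (Fin.castSucc_lt_last k).ne'
    · rw [← e₁]
      exact (Fin.castSucc_lt_last l).ne'
  · rw [ωHom_X_succ, s_X_of_ne]
    · intro e
      rw [Fin.castSucc_inj.1 e, e₁] at hi₁
      exact hi₁ rfl
    · rw [← e₁]
      intro e
      rw [Fin.castSucc_inj.1 e] at hi₂
      exact hi₂ rfl

/-- The relation `T_{n-1} ω² = ω² T_1`. -/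
theorem T_mul_ω_mul_ω (q t : F) {k l : Fin m} (hk : k.val + 1 = m) (hl : l.val = 0) :
    T t k * (ω q * ω q) = ω q * ω q * T t l := by
  have e₁ : l.castSucc = 0 := Fin.ext (by simp [hl])
  have e₂ : Fin.last m = k.succ := Fin.ext (by simp [hk])
  have hC : ∀ a : F, ωHom q (C a : Poly m F) = C a := fun a => (ωHom q).commutes a
  have h₁ : ((ωHom q).comp (ωHom q)) (X l.castSucc : Poly m F) = C q * X k.castSucc := by
    rw [AlgHom.comp_apply, e₁, ωHom_X_zero, map_mul, hC, e₂, ωHom_X_succ]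
  have h₂ : ((ωHom q).comp (ωHom q)) (X l.succ : Poly m F) = C q * X k.succ := by
    rw [AlgHom.comp_apply, ωHom_X_succ, e₁, ωHom_X_zero, e₂]
  refine LinearMap.ext fun f => ?_
  have := T_algHom (t := t) ((ωHom q).comp (ωHom q)) h₁ h₂ (algHom_s fun i => ?_) f
  · simp only [Module.End.mul_apply, ω_apply]
    exact this.symm
  rcases eq_or_ne i l.castSucc with rfl | hi₁
  · rw [s_X_castSucc, h₁, h₂, s_mul_apply, s_C, s_X_castSucc]
  rcases eq_or_ne i l.succ with rfl | hi₂
  · rw [s_X_succ, h₁, h₂, s_mul_apply, s_C, s_X_succ]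
  rw [s_X_of_ne l hi₁ hi₂, AlgHom.comp_apply]
  revert hi₁ hi₂
  refine Fin.cases (fun hi₁ _ => absurd e₁.symm hi₁) (fun i _ hi₂ => ?_) i
  have hi : i.castSucc ≠ 0 := fun e => hi₂ (by
    rw [← e₁] at e
    rw [Fin.castSucc_inj.1 e])
  obtain ⟨j, hj⟩ := Fin.exists_succ_eq.2 hi
  have hj' : j.val + 1 = i.val := by simpa [Fin.ext_iff] using hj
  rw [ωHom_X_succ, ← hj, ωHom_X_succ, s_X_of_ne]
  · intro e
    have : j.val = k.val := by simpa [Fin.ext_iff] using e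
    omega
  · intro e
    have : j.val = k.val + 1 := by simpa [Fin.ext_iff] using e
    omega

theorem commute_T_Tinv {t : F} {k l : Fin m} (h : k.val + 1 < l.val ∨ l.val + 1 < k.val) :
    Commute (T t k : Op m F) (Tinv t l) :=
  ((Commute.one_right _).smul_right _).add_right ((commute_T_T h).smul_right _)

theorem T_mul_Tinv_mul_Tinv {t : F} (ht : t ≠ 0) {k l : Fin m} (h : k.val + 1 = l.val) :
    T t l * (Tinv t k * Tinv t l) = Tinv t k * Tinv t l * T t k := by
  have h₁ : T t l * T t k * (T t l * (Tinv t k * Tinv t l)) = T t l * T t k * (Tinv t k *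
      Tinv t l * T t k) := by
    calc _ = (T t k * T t l * T t k) * (Tinv t k * Tinv t l) := by
          rw [T_braid t h]; simp only [mul_assoc]
      _ = T t k * (T t l * (T t k * Tinv t k) * Tinv t l) := by simp only [mul_assoc]
      _ = T t l * (T t k * Tinv t k) * Tinv t l * T t k := by
          rw [T_mul_Tinv ht, mul_one, T_mul_Tinv ht, mul_one, one_mul]
      _ = _ := by simp only [mul_assoc]
  have h₂ : Tinv t k * (Tinv t l * (T t l * T t k)) = 1 := by
    rw [← mul_assoc (Tinv t l), Tinv_mul_T ht, one_mul, Tinv_mul_T ht]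
  have h₃ := congrArg (fun A => Tinv t k * (Tinv t l * A)) h₁
  calc _ = Tinv t k * (Tinv t l * (T t l * T t k)) * (T t l * (Tinv t k * Tinv t l)) := by
        rw [h₂, one_mul]
    _ = Tinv t k * (Tinv t l * (T t l * T t k)) * (Tinv t k * Tinv t l * T t k) := by
        simpa only [mul_assoc] using h₃
    _ = _ := by rw [h₂, one_mul]

/-- A product `A_lo ⋯ A_{hi-1}` of operators satisfying mixed braid relations with the `T_i` shifts
the index of `T_i` by one. This is used for `A = T` and for `A = T⁻¹`. -/
theorem T_mul_prodUp {t : F} {A : Fin m → Op m F} {k l : Fin m} (h : k.val + 1 = l.val)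
    (hA : ∀ i j : Fin m, i.val + 1 < j.val ∨ j.val + 1 < i.val → Commute (T t i) (A j))
    (hb : T t l * (A k * A l) = A k * A l * T t k) {lo hi : ℕ} (hlo : lo ≤ k.val)
    (hhi : l.val < hi) (hm : hi ≤ m) : T t l * prodUp A lo hi = prodUp A lo hi * T t k := by
  have e : prodUp A lo hi = prodUp A lo k.val * (A k * A l * prodUp A (l.val + 1) hi) := by
    rw [← prodUp_mul_prodUp A hlo (by omega) hm, prodUp_eq_mul A k (by omega), h,
      prodUp_eq_mul A l hhi, mul_assoc (A k)]
  have c₁ : Commute (T t l) (prodUp A lo k.val) :=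
    commute_prodUp fun i _ hi => hA l i (Or.inr (by omega))
  have c₂ : Commute (T t k) (prodUp A (l.val + 1) hi) :=
    commute_prodUp fun i hi _ => hA k i (Or.inl (by omega))
  rw [e, ← mul_assoc, c₁.eq, mul_assoc, ← mul_assoc (T t l), hb, mul_assoc (A k * A l), c₂.eq]
  simp only [mul_assoc]

/-- The recursion `t Y_k = T_k Y_{k+1} T_k`. -/
theorem Y_castSucc {q t : F} (ht : t ≠ 0) (k : Fin m) :
    t • Y q t k.castSucc = T t k * Y q t k.succ * T t k := by
  have h : Tinv t k * T t k = 1 := Tinv_mul_T ht k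
  rw [Y, Y, Fin.val_castSucc, Fin.val_succ, prodUp_eq_mul (T t) k k.isLt,
    prodUp_succ (Tinv t) k (Nat.zero_le _), smul_smul, mul_smul_comm, smul_mul_assoc]
  congr 1
  · rw [← zpow_one_add₀ ht]
    congr 1
    push_cast
    ring
  · simp only [mul_assoc, h, mul_one]

theorem commute_T_Y {q t : F} (ht : t ≠ 0) {k : Fin m} {i : Fin (m + 1)} (h₁ : i ≠ k.castSucc)
    (h₂ : i ≠ k.succ) : Commute (T t k) (Y q t i) := by
  have him : i.val ≤ m := Nat.lt_succ_iff.1 i.isLt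
  have h₁' : i.val ≠ k.val := fun e => h₁ (Fin.ext e)
  have h₂' : i.val ≠ k.val + 1 := fun e => h₂ (Fin.ext e)
  refine Commute.smul_right ?_ _
  rcases lt_or_gt_of_ne h₁' with h | h
  · obtain ⟨l, hl⟩ : ∃ l : Fin m, l.val + 1 = k.val := ⟨⟨k.val - 1, by omega⟩, by simp; omega⟩
    have e₁ : T t k * prodUp (T t) i.val m = prodUp (T t) i.val m * T t l :=
      T_mul_prodUp hl (fun _ _ => commute_T_T) (by rw [← mul_assoc, ← T_braid t hl]) (by omega)
        k.isLt le_rfl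
    have e₂ : Commute (T t k) (prodUp (Tinv t) 0 i.val) :=
      commute_prodUp fun j _ hj => commute_T_Tinv (Or.inr (by omega))
    calc _ = T t k * prodUp (T t) i.val m * ω q * prodUp (Tinv t) 0 i.val := by
          simp only [mul_assoc]
      _ = prodUp (T t) i.val m * (T t l * ω q) * prodUp (Tinv t) 0 i.val := by
          rw [e₁]; simp only [mul_assoc]
      _ = prodUp (T t) i.val m * ω q * (T t k * prodUp (Tinv t) 0 i.val) := by
          rw [T_mul_ω q t hl]; simp only [mul_assoc]
      _ = _ := by rw [e₂.eq]; simp only [mul_assoc]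
  · obtain ⟨l, hl⟩ : ∃ l : Fin m, k.val + 1 = l.val := ⟨⟨k.val + 1, by omega⟩, rfl⟩
    have e₁ : T t l * prodUp (Tinv t) 0 i.val = prodUp (Tinv t) 0 i.val * T t k :=
      T_mul_prodUp hl (fun _ _ => commute_T_Tinv) (T_mul_Tinv_mul_Tinv ht hl) (Nat.zero_le _)
        (by omega) him
    have e₂ : Commute (T t k) (prodUp (T t) i.val m) :=
      commute_prodUp fun j hj _ => commute_T_T (Or.inl (by omega))
    calc _ = T t k * prodUp (T t) i.val m * ω q * prodUp (Tinv t) 0 i.val := by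
          simp only [mul_assoc]
      _ = prodUp (T t) i.val m * (T t k * ω q) * prodUp (Tinv t) 0 i.val := by
          rw [e₂.eq]; simp only [mul_assoc]
      _ = prodUp (T t) i.val m * ω q * (T t l * prodUp (Tinv t) 0 i.val) := by
          rw [T_mul_ω q t hl]; simp only [mul_assoc]
      _ = _ := by rw [e₁]; simp only [mul_assoc]

/-- The raising operator `Ψ = x_n ω`. It sends monomials to multiples of monomials, and it agrees
with `Φ_q` up to a scalar on each joint eigenvector. -/
def Ψ (q : F) : Op m F := mulX (Fin.last m) * ω q

theorem T_mul_Ψ (q t : F) {k l : Fin m} (h : k.val + 1 = l.val) :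
    T t k * Ψ q = Ψ q * T t l := by
  have c : Commute (T t k) (mulX (Fin.last m) : Op m F) := by
    refine T_mul_mulX_of_ne t k (Fin.castSucc_lt_last k).ne' fun e => ?_
    have : m = k.val + 1 := by simpa [Fin.ext_iff] using e
    omega
  rw [Ψ, ← mul_assoc, c.eq, mul_assoc, T_mul_ω q t h, mul_assoc]

theorem Tinv_mul_Ψ (q t : F) {k l : Fin m} (h : k.val + 1 = l.val) :
    Tinv t k * Ψ q = Ψ q * Tinv t l := by
  rw [Tinv, Tinv, add_mul, mul_add, smul_mul_assoc, smul_mul_assoc, mul_smul_comm, mul_smul_comm,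
    T_mul_Ψ q t h, one_mul, mul_one]

theorem prodUp_Tinv_mul_Ψ (q t : F) {h : ℕ} (hm : h < m) :
    (prodUp (Tinv t) 0 h * Ψ q : Op m F) = Ψ q * prodUp (Tinv t) 1 (h + 1) := by
  induction h with
  | zero => rw [prodUp_of_le _ le_rfl, prodUp_of_le _ le_rfl, one_mul, mul_one]
  | succ p ih =>
    have e₁ := prodUp_succ (Tinv t) (⟨p, by omega⟩ : Fin m) (Nat.zero_le _)
    have e₂ := prodUp_succ (Tinv t) (⟨p + 1, hm⟩ : Fin m) (lo := 1) (by simp)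
    simp only at e₁ e₂
    rw [e₁, e₂, mul_assoc, Tinv_mul_Ψ q t (l := ⟨p + 1, hm⟩) rfl, ← mul_assoc, ih (by omega),
      mul_assoc]

theorem Tinv_mul_mulX {t : F} (ht : t ≠ 0) (k : Fin m) :
    Tinv t k * mulX k.succ = t⁻¹ • (mulX k.castSucc * T t k) := by
  have h : t • (mulX k.succ : Op m F) = T t k * mulX k.castSucc * T t k := by
    rw [T_mul_mulX t k ht, smul_mul_assoc, mul_assoc, Tinv_mul_T ht, mul_one]
  have h' := congrArg (fun A => t⁻¹ • (Tinv t k * A)) h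
  simp only [mul_smul_comm, smul_smul, inv_mul_cancel₀ ht, one_smul] at h'
  rw [h', ← mul_assoc, ← mul_assoc, Tinv_mul_T ht, one_mul]

theorem prodUp_Tinv_mul_mulX {t : F} (ht : t ≠ 0) (i : Fin (m + 1)) :
    prodUp (Tinv t) 0 i.val * mulX i = t⁻¹ ^ i.val • (mulX 0 * prodUp (T t) 0 i.val) := by
  induction i using Fin.induction with
  | zero => rw [Fin.val_zero, prodUp_of_le _ le_rfl, prodUp_of_le _ le_rfl, one_mul, mul_one,
      pow_zero, one_smul]
  | succ k ih =>
    rw [Fin.val_castSucc] at ih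
    rw [Fin.val_succ, prodUp_succ _ k (Nat.zero_le _), prodUp_succ _ k (Nat.zero_le _), mul_assoc,
      Tinv_mul_mulX ht, mul_smul_comm, ← mul_assoc, ih, smul_mul_assoc, smul_smul, pow_succ',
      mul_assoc]

theorem Y_last (q t : F) : Y q t (Fin.last m) = ω q * prodUp (Tinv t) 0 m := by
  rw [Y, Fin.val_last, prodUp_of_le _ le_rfl, one_mul, sub_self, zpow_zero, one_smul]

theorem Y_zero (q : F) {t : F} (ht : t ≠ 0) :
    t ^ m • Y q t (0 : Fin (m + 1)) = prodUp (T t) 0 m * ω q := by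
  rw [Y, Fin.val_zero, prodUp_of_le (Tinv t) le_rfl, mul_one, smul_smul, ← zpow_natCast,
    ← zpow_add₀ ht]
  simp

/-- `Ψ` carries eigenvectors of `Y_1` to eigenvectors of `Y_n`, with the eigenvalue multiplied by
`q`. -/
theorem Y_last_mul_Ψ (q : F) {t : F} (ht : t ≠ 0) :
    Y q t (Fin.last m) * Ψ q = q • (Ψ q * Y q t 0) := by
  have h := prodUp_Tinv_mul_mulX (m := m) ht (Fin.last m)
  rw [Fin.val_last] at h
  rw [Y_last, Ψ, mul_assoc, ← mul_assoc (prodUp _ _ _), h, smul_mul_assoc, mul_smul_comm,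
    mul_assoc (mulX 0), ← Y_zero q ht, mul_smul_comm, mul_smul_comm, smul_smul, inv_pow,
    inv_mul_cancel₀ (pow_ne_zero m ht), one_smul, ← mul_assoc, ω_mul_mulX_zero, smul_mul_assoc]

/-- `Ψ` carries eigenvectors of `Y_{k+1}` to eigenvectors of `Y_k`. Downward induction on `k`, by
the recursion `t Y_k = T_k Y_{k+1} T_k`. -/
theorem Y_castSucc_mul_Ψ (q : F) {t : F} (ht : t ≠ 0) (k : Fin m) :
    Y q t k.castSucc * Ψ q = Ψ q * Y q t k.succ := by
  obtain ⟨d, hd⟩ : ∃ d, k.val + 1 + d = m := ⟨m - (k.val + 1), by omega⟩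
  induction d generalizing k with
  | zero =>
    rw [add_zero] at hd
    obtain ⟨l, hl⟩ : ∃ l : Fin m, l.val = 0 := ⟨⟨0, by omega⟩, rfl⟩
    have hlast : Fin.last m = k.succ := Fin.ext (by simp [hd])
    have e₁ : Y q t k.castSucc = t⁻¹ • (T t k * ω q * prodUp (Tinv t) 0 k.val) := by
      rw [Y, Fin.val_castSucc, prodUp_eq_mul _ k k.isLt, prodUp_of_le (T t) hd.ge, mul_one]
      congr 1
      rw [← zpow_neg_one]
      congr 1
      omega
    have e₂ : prodUp (Tinv t) 0 m = Tinv t l * prodUp (Tinv t) 1 m := by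
      rw [← hl, prodUp_eq_mul _ l (by omega), hl]
    -- This case, `k = n - 1`, is the one which needs the relation of `T_{n-1}` with `ω²`.
    have e₃ : Tinv t k * (ω q * ω q) = ω q * ω q * Tinv t l := by
      rw [Tinv, Tinv, add_mul, mul_add, smul_mul_assoc, smul_mul_assoc, mul_smul_comm,
        mul_smul_comm, T_mul_ω_mul_ω q t hd hl, one_mul, mul_one]
    have e₄ : T t k * ω q * Ψ q = t • (mulX (Fin.last m) * (Tinv t k * (ω q * ω q))) := by
      rw [Ψ, hlast, mul_assoc, ← mul_assoc (ω q), ω_mul_mulX_succ, mul_assoc (mulX k.castSucc),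
        ← mul_assoc, T_mul_mulX t k ht, smul_mul_assoc, mul_assoc]
    rw [e₁, smul_mul_assoc, mul_assoc, prodUp_Tinv_mul_Ψ q t k.isLt, ← mul_assoc, e₄, e₃,
      smul_mul_assoc, smul_smul, inv_mul_cancel₀ ht, one_smul, ← hlast, Y_last, e₂, hd, Ψ]
    simp only [mul_assoc]
  | succ d ih =>
    obtain ⟨l, hl⟩ : ∃ l : Fin m, k.val + 1 = l.val := ⟨⟨k.val + 1, by omega⟩, rfl⟩
    have hkl : k.succ = l.castSucc := Fin.ext (by simp [hl])
    have h : t • (Y q t k.castSucc * Ψ q) = t • (Ψ q * Y q t k.succ) := by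
      rw [← smul_mul_assoc, Y_castSucc ht, mul_assoc, T_mul_Ψ q t hl, mul_assoc,
        ← mul_assoc (Y _ _ _), hkl, ih l (by omega), mul_assoc, ← mul_assoc, T_mul_Ψ q t hl,
        ← mul_smul_comm, Y_castSucc ht]
      simp only [mul_assoc]
    exact smul_right_injective _ ht h

/-- The factor `Y_1` acts as a scalar on joint eigenvectors, where `Ψ` is thus a multiple of `Φ_q`.
-/
theorem Ψ_eq (q : F) {t : F} (ht : t ≠ 0) : (Ψ q : Op m F) = t ^ m • (Φ t * Y q t 0) := by
  rw [← mul_smul_comm, Y_zero q ht, Φ, mul_assoc, ← mul_assoc (prodDown _ _ _),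
    prodDown_mul_prodUp (Tinv_mul_T ht) (Nat.zero_le m) le_rfl, one_mul, Ψ]

theorem divX_mul_mulX (i : Fin (m + 1)) : (divX i * mulX i : Op m F) = 1 := by
  refine LinearMap.ext fun f => ?_
  exact X_mul_divMonomial i f

theorem xD_last (q t : F) : xD q t (Fin.last m) = 1 - t ^ m • Y q t (Fin.last m) := by
  have h : Finset.Ioi (Fin.last m) = ∅ := by
    ext i
    simp [Fin.le_last]
  rw [xD, h, Finset.sum_empty, smul_zero, add_zero, one_mul]

/-- `Φ̂_q` undoes `Ψ` up to a polynomial in `Y_1`. -/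
theorem Φhat_mul_Ψ (q : F) {t : F} (ht : t ≠ 0) :
    Φhat q t * Ψ q = t ^ m • (Y q t 0 * (1 - (q * t ^ m) • Y q t (0 : Fin (m + 1)))) := by
  have h : xD q t (Fin.last m) * Ψ q = Ψ q * (1 - (q * t ^ m) • Y q t 0) := by
    rw [xD_last, sub_mul, mul_sub, one_mul, mul_one, smul_mul_assoc, Y_last_mul_Ψ q ht,
      mul_smul_comm, smul_smul, mul_comm q]
  rw [Φhat, D, mul_assoc, mul_assoc, h, Ψ, mul_assoc (mulX _), ← mul_assoc (divX _), divX_mul_mulX,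
    one_mul, ← mul_assoc, ← Y_zero q ht, smul_mul_assoc]

/-! ### Combinatorics of compositions and the constants -/

/-- The composition `Φη = (η_2, …, η_n, η_1 + 1)`. -/
def raise (η : Comp m) : Comp m :=
  Finsupp.equivFunOnFinite.symm (Fin.snoc (α := fun _ => ℕ) (fun i : Fin m => η i.succ) (η 0 + 1))

theorem raise_castSucc (η : Comp m) (i : Fin m) : raise η i.castSucc = η i.succ := by
  simp [raise]

theorem raise_last (η : Comp m) : raise η (Fin.last m) = η 0 + 1 := by
  simp [raise]

theorem raise_injective : Function.Injective (raise : Comp m → Comp m) := fun η ν h => by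
  ext i
  refine Fin.cases ?_ (fun i => ?_) i
  · have := DFunLike.congr_fun h (Fin.last m)
    rw [raise_last, raise_last] at this
    omega
  · have := DFunLike.congr_fun h i.castSucc
    rwa [raise_castSucc, raise_castSucc] at this

theorem exists_raise {η : Comp m} (h : η (Fin.last m) ≠ 0) :
    ∃ ν, raise ν = η ∧ ∑ i, η i = ∑ i, ν i + 1 := by
  refine ⟨Finsupp.equivFunOnFinite.symm
    (Fin.cons (α := fun _ => ℕ) (η (Fin.last m) - 1) fun i : Fin m => η i.castSucc), ?_, ?_⟩
  · ext i
    refine Fin.lastCases ?_ (fun i => ?_) i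
    · rw [raise_last]
      simp only [Finsupp.equivFunOnFinite_symm_apply_apply, Fin.cons_zero]
      omega
    · rw [raise_castSucc]
      simp
  · rw [Fin.sum_univ_castSucc, Fin.sum_univ_succ]
    simp only [Finsupp.equivFunOnFinite_symm_apply_apply, Fin.cons_zero, Fin.cons_succ]
    omega

theorem sum_sw (k : Fin m) (η : Comp m) : ∑ i, sw k η i = ∑ i, η i := by
  simp only [sw_apply]
  exact Equiv.sum_comp (Equiv.swap k.castSucc k.succ) (fun i => η i)

/-- Every composition is reached from `0` by `Φ` and by moving larger parts to the left. -/
theorem comp_induction {p : Comp m → Prop} (zero : p 0) (raise : ∀ η, p η → p (raise η))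
    (swap : ∀ (k : Fin m) η, η k.castSucc < η k.succ → p η → p (sw k η)) (η : Comp m) : p η := by
  obtain ⟨N, hN⟩ : ∃ N, ∑ i, η i = N := ⟨_, rfl⟩
  induction N using Nat.strong_induction_on generalizing η with
  | _ N ih =>
    -- Moving parts to the right decreases `w` at constant degree.
    obtain ⟨w, hw⟩ : ∃ w, ∑ i : Fin (m + 1), (m - i.val) * η i = w := ⟨_, rfl⟩
    induction w using Nat.strong_induction_on generalizing η with
    | _ w ihw =>
      by_cases h0 : η = 0
      · rwa [h0]
      by_cases hl : η (Fin.last m) = 0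
      · have hS : (Finset.univ.filter fun i => η i ≠ 0).Nonempty := by
          by_contra h
          rw [Finset.not_nonempty_iff_eq_empty, Finset.filter_eq_empty_iff] at h
          exact h0 (Finsupp.ext fun i => not_not.1 (h (Finset.mem_univ i)))
        -- `p` is the position of the last nonzero part.
        obtain ⟨p, hp, hmax⟩ := Finset.exists_max_image _ id hS
        simp only [Finset.mem_filter, Finset.mem_univ, true_and, id] at hp hmax
        have hpl : p ≠ Fin.last m := fun e => hp (e ▸ hl)
        obtain ⟨k, rfl⟩ := Fin.exists_castSucc_eq.2 hpl
        have hk : η k.succ = 0 := by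
          by_contra h
          exact (hmax _ h).not_gt Fin.castSucc_lt_succ
        rw [← sw_sw k η]
        refine swap k _ (by rw [sw_castSucc, sw_succ, hk]; omega) (ihw _ ?_ _ ?_ rfl)
        · rw [← hw, sum_eq_pair (Fin.castSucc_lt_succ (i := k)).ne,
            sum_eq_pair (Fin.castSucc_lt_succ (i := k)).ne (fun i => (m - i.val) * η i),
            sw_castSucc,
            sw_succ, hk, mul_zero, mul_zero, zero_add, add_zero]
          refine Nat.add_lt_add_of_lt_of_le ?_ (Finset.sum_le_sum fun i hi => ?_)
          · refine Nat.mul_lt_mul_of_pos_right ?_ (Nat.pos_of_ne_zero hp)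
            rw [Fin.val_succ, Fin.val_castSucc]
            omega
          · rw [Finset.mem_erase, Finset.mem_erase] at hi
            rw [sw_of_ne k η hi.2.1 hi.1]
        · rw [sum_sw, hN]
      · obtain ⟨ν, rfl, hν⟩ := exists_raise hl
        exact raise ν (ih _ (by omega) ν rfl)

theorem swap_lt_swap {k : Fin m} {i j : Fin (m + 1)} (h₁ : ¬ (i = k.castSucc ∧ j = k.succ))
    (h₂ : ¬ (i = k.succ ∧ j = k.castSucc)) :
    Equiv.swap k.castSucc k.succ i < Equiv.swap k.castSucc k.succ j ↔ i < j := by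
  have key : ∀ i : Fin (m + 1), (Equiv.swap k.castSucc k.succ i).val =
      if i.val = k.val then k.val + 1 else if i.val = k.val + 1 then k.val else i.val := fun i => by
    by_cases h : i = k.castSucc
    · rw [h, Equiv.swap_apply_left]; simp
    by_cases h' : i = k.succ
    · rw [h', Equiv.swap_apply_right]; simp
    rw [Equiv.swap_apply_of_ne_of_ne h h',
      if_neg (show ¬ i.val = k.val from fun e => h (Fin.ext e)),
      if_neg (show ¬ i.val = k.val + 1 from fun e => h' (Fin.ext e))]
  simp only [Fin.ext_iff, Fin.val_castSucc, Fin.val_succ] at h₁ h₂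
  rw [Fin.lt_def, Fin.lt_def, key, key]
  split_ifs <;> omega

theorem sum_ite_swap (k : Fin m) (P : Fin (m + 1) → Prop) [DecidablePred P] :
    #{j | P j} = ∑ j, if P (Equiv.swap k.castSucc k.succ j) then 1 else 0 := by
  rw [Finset.card_filter]
  exact (Equiv.sum_comp (Equiv.swap k.castSucc k.succ) (fun j => if P j then 1 else 0)).symm

theorem legCo_sw {k : Fin m} {η : Comp m} (h : η k.castSucc < η k.succ) (i : Fin (m + 1)) :
    legCo (sw k η) i = legCo η (Equiv.swap k.castSucc k.succ i) := by
  rw [legCo_eq, legCo_eq, Finset.card_filter, sum_ite_swap k]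
  refine Finset.sum_congr rfl fun j _ => if_congr ?_ rfl rfl
  simp only [sw_apply]
  by_cases h₁ : i = k.castSucc ∧ j = k.succ
  · rw [h₁.1, h₁.2, Equiv.swap_apply_left, Equiv.swap_apply_right]
    have := Fin.castSucc_lt_succ (i := k)
    simp only [this, this.not_gt, true_and, false_and, or_false, false_or]
    omega
  by_cases h₂ : i = k.succ ∧ j = k.castSucc
  · rw [h₂.1, h₂.2, Equiv.swap_apply_left, Equiv.swap_apply_right]
    have := Fin.castSucc_lt_succ (i := k)
    simp only [this, this.not_gt, true_and, false_and, or_false, false_or]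
    omega
  rw [swap_lt_swap h₁ h₂, swap_lt_swap (fun e => h₂ e.symm) fun e => h₁ e.symm]

theorem eigenval_sw (q t : F) {k : Fin m} {η : Comp m} (h : η k.castSucc < η k.succ)
    (i : Fin (m + 1)) :
    eigenval q t (sw k η) i = eigenval q t η (Equiv.swap k.castSucc k.succ i) := by
  rw [eigenval, eigenval, legCo_sw h, sw_apply]

theorem legCo_raise_castSucc (η : Comp m) (i : Fin m) :
    legCo (raise η) i.castSucc = legCo η i.succ := by
  rw [legCo_eq, legCo_eq, Finset.card_filter, Finset.card_filter, Fin.sum_univ_castSucc,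
    Fin.sum_univ_succ, add_comm]
  simp only [raise_castSucc, raise_last, Fin.castSucc_lt_castSucc_iff, Fin.succ_lt_succ_iff,
    Fin.castSucc_lt_last, Fin.succ_pos, Nat.lt_succ_iff, true_and, Fin.not_lt_zero, false_and,
    or_false, (Fin.castSucc_lt_last i).not_gt, false_or]

theorem legCo_raise_last (η : Comp m) : legCo (raise η) (Fin.last m) = legCo η 0 := by
  rw [legCo_eq, legCo_eq, Finset.card_filter, Finset.card_filter, Fin.sum_univ_castSucc,
    Fin.sum_univ_succ, add_comm]
  simp [raise_castSucc, raise_last, (Fin.castSucc_lt_last _).not_gt]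

theorem eigenval_raise_castSucc (q t : F) (η : Comp m) (i : Fin m) :
    eigenval q t (raise η) i.castSucc = eigenval q t η i.succ := by
  rw [eigenval, eigenval, legCo_raise_castSucc, raise_castSucc]

theorem eigenval_raise_last (q t : F) (η : Comp m) :
    eigenval q t (raise η) (Fin.last m) = q * eigenval q t η 0 := by
  rw [eigenval, eigenval, legCo_raise_last, raise_last, pow_succ', mul_assoc]

theorem leg_eq (η : Comp m) (i : Fin (m + 1)) (j : ℕ) :
    leg η i j = #{k : Fin (m + 1) | i < k ∧ (j ≤ η k ∧ η k ≤ η i) ∨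
      k < i ∧ (j ≤ η k + 1 ∧ η k + 1 ≤ η i)} := by
  rw [leg, ← Finset.card_union_of_disjoint]
  · congr 1
    ext k
    simp
  · rw [Finset.disjoint_left]
    intro k h₁ h₂
    simp only [Finset.mem_filter, Finset.mem_Iio, Finset.mem_Ioi] at h₁ h₂
    exact h₁.1.asymm h₂.1

theorem leg_raise_castSucc (η : Comp m) (i : Fin m) (j : ℕ) :
    leg (raise η) i.castSucc j = leg η i.succ j := by
  rw [leg_eq, leg_eq, Finset.card_filter, Finset.card_filter, Fin.sum_univ_castSucc,
    Fin.sum_univ_succ, add_comm]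
  simp only [raise_castSucc, raise_last, Fin.castSucc_lt_castSucc_iff, Fin.succ_lt_succ_iff,
    Fin.castSucc_lt_last, Fin.succ_pos, true_and, Fin.not_lt_zero, false_and,
    or_false, (Fin.castSucc_lt_last i).not_gt, false_or]

theorem leg_raise_last (η : Comp m) (j : ℕ) :
    leg (raise η) (Fin.last m) (j + 1) = leg η 0 j := by
  rw [leg_eq, leg_eq, Finset.card_filter, Finset.card_filter, Fin.sum_univ_castSucc,
    Fin.sum_univ_succ, add_comm]
  simp [raise_castSucc, raise_last, (Fin.castSucc_lt_last _).not_gt]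

/-- `leg η 0 0` is the leg of the additional node, the first one of the last row, of `raise η`. -/
theorem leg_zero (η : Comp m) : leg η 0 0 = m - legCo η 0 := by
  have : leg η 0 0 + legCo η 0 = m := by
    rw [leg_eq, legCo_eq, Finset.card_filter, Finset.card_filter, Fin.sum_univ_succ,
      Fin.sum_univ_succ]
    simp only [lt_irrefl, false_and, or_self, if_false, zero_add, Fin.not_lt_zero, or_false,
      false_or, Fin.succ_pos, true_and, Nat.zero_le, ← Finset.sum_add_distrib]
    rw [Finset.sum_congr rfl (g := fun _ => 1) fun i _ => ?_]
    · simp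
    · split_ifs <;> omega
  omega

/-- Interchanging the parts `k` and `k + 1`, the smaller one being on the left, moves nodes together
with their legs, except that the node `(k + 1, η_k + 1)` loses one from its leg. -/
theorem leg_sw {k : Fin m} {η : Comp m} (h : η k.castSucc < η k.succ) (i : Fin (m + 1)) (j : ℕ) :
    leg η i j = leg (sw k η) (Equiv.swap k.castSucc k.succ i) j +
      if i = k.succ ∧ j = η k.castSucc + 1 then 1 else 0 := by
  rw [leg_eq, leg_eq, Finset.card_filter, sum_ite_swap k,
    ← Fintype.sum_ite_eq k.castSucc
      (fun _ => if i = k.succ ∧ j = η k.castSucc + 1 then 1 else 0), ← Finset.sum_add_distrib]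
  refine Finset.sum_congr rfl fun l _ => ?_
  simp only [sw_apply, Equiv.swap_apply_self]
  have hlt := Fin.castSucc_lt_succ (i := k)
  by_cases h₁ : i = k.castSucc ∧ l = k.succ
  · rw [h₁.1, h₁.2, Equiv.swap_apply_left, Equiv.swap_apply_right]
    simp only [hlt, hlt.not_gt, hlt.ne, true_and, false_and, or_false, false_or, if_false]
    rw [if_neg (by omega), if_neg (by omega), add_zero]
  by_cases h₂ : i = k.succ ∧ l = k.castSucc
  · rw [h₂.1, h₂.2, Equiv.swap_apply_left, Equiv.swap_apply_right]
    simp only [hlt, hlt.not_gt, true_and, false_and, or_false, false_or, if_true]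
    split_ifs <;> omega
  simp only [swap_lt_swap h₁ h₂, swap_lt_swap (fun e => h₂ e.symm) fun e => h₁ e.symm]
  rw [left_eq_add]
  split_ifs with h₃ h₄
  · exact absurd ⟨h₄.1, h₃.symm⟩ h₂
  · rfl
  · rfl

theorem legCo_add_leg {k : Fin m} {η : Comp m} (h : η k.castSucc < η k.succ) :
    legCo η k.castSucc = legCo η k.succ + leg η k.succ (η k.castSucc + 1) := by
  rw [legCo_eq, legCo_eq, leg_eq, sum_ite_swap k, Finset.card_filter, Finset.card_filter,
    ← Finset.sum_add_distrib]
  refine Finset.sum_congr rfl fun l _ => ?_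
  have hlt := Fin.castSucc_lt_succ (i := k)
  by_cases h₁ : l = k.castSucc
  · rw [h₁, Equiv.swap_apply_left]
    simp only [hlt, hlt.not_gt, true_and, false_and, or_false, false_or]
    split_ifs <;> omega
  by_cases h₂ : l = k.succ
  · rw [h₂, Equiv.swap_apply_right]
    simp
  rw [Equiv.swap_apply_of_ne_of_ne h₁ h₂]
  have e₁ : l.val ≠ k.val := fun e => h₁ (Fin.ext e)
  have e₂ : l.val ≠ k.val + 1 := fun e => h₂ (Fin.ext e)
  simp only [Fin.lt_def, Fin.val_castSucc, Fin.val_succ]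
  split_ifs <;> omega

/-- `∏ (1 - q ^ (a(s) + 1) * t ^ (l(s) + c))` over the nodes `s` of `η`, so that `d` is the case
`c = 1` and `d'` the case `c = 0`. -/
def nodeProd (q t : F) (c : ℕ) (η : Comp m) : F :=
  ∏ i, ∏ j ∈ Finset.Icc 1 (η i), (1 - q ^ ((η i - j) + 1) * t ^ (leg η i j + c))

theorem d_eq_nodeProd (q t : F) (η : Comp m) : d q t η = nodeProd q t 1 η := rfl

theorem d'_eq_nodeProd (q t : F) (η : Comp m) : d' q t η = nodeProd q t 0 η := rfl

theorem nodeProd_raise (q t : F) (c : ℕ) (η : Comp m) :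
    nodeProd q t c (raise η) =
      nodeProd q t c η * (1 - q ^ (η 0 + 1) * t ^ (m - legCo η 0 + c)) := by
  rw [nodeProd, nodeProd, Fin.prod_univ_castSucc, Fin.prod_univ_succ]
  simp only [raise_castSucc, raise_last, leg_raise_castSucc]
  rw [mul_comm, mul_right_comm]
  congr 1
  rw [← Finset.Ico_add_one_right_eq_Icc, ← Finset.Ico_add_one_right_eq_Icc,
    Finset.prod_eq_prod_Ico_succ_bot (by omega), mul_comm, ← Finset.prod_Ico_add']
  congr 1
  · refine Finset.prod_congr rfl fun j _ => ?_
    rw [leg_raise_last, Nat.add_sub_add_right]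
  · rw [leg_raise_last, leg_zero, Nat.add_sub_cancel]

theorem prod_mul_eq_of_eq_off {ι : Type*} [DecidableEq ι] {S : Finset ι} {f g : ι → F} {x : ι}
    (hx : x ∈ S) (h : ∀ y ∈ S, y ≠ x → f y = g y) :
    (∏ y ∈ S, f y) * g x = (∏ y ∈ S, g y) * f x := by
  rw [← Finset.mul_prod_erase S f hx, ← Finset.mul_prod_erase S g hx,
    Finset.prod_congr rfl fun y hy => h y (Finset.mem_of_mem_erase hy) (Finset.ne_of_mem_erase hy)]
  ring

/-- Only the node `(k + 1, η_k + 1)` of `η` changes its factor when the parts are interchanged. -/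
theorem nodeProd_sw (q t : F) (c : ℕ) {k : Fin m} {η : Comp m} (h : η k.castSucc < η k.succ) :
    nodeProd q t c η * (1 - q ^ (η k.succ - η k.castSucc) *
        t ^ (legCo η k.castSucc - legCo η k.succ - 1 + c)) =
      nodeProd q t c (sw k η) * (1 - q ^ (η k.succ - η k.castSucc) *
        t ^ (legCo η k.castSucc - legCo η k.succ + c)) := by
  have h₁ : nodeProd q t c (sw k η) = ∏ i, ∏ j ∈ Finset.Icc 1 (η i),
      (1 - q ^ ((η i - j) + 1) * t ^ (leg (sw k η) (Equiv.swap k.castSucc k.succ i) j + c)) := by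
    rw [nodeProd, ← Equiv.prod_comp (Equiv.swap k.castSucc k.succ)]
    simp only [sw_apply, Equiv.swap_apply_self]
  have h₂ := leg_sw h k.succ (η k.castSucc + 1)
  have h₃ := legCo_add_leg h
  rw [if_pos ⟨rfl, rfl⟩] at h₂
  rw [h₁, nodeProd, Finset.prod_sigma', Finset.prod_sigma']
  have hx : (⟨k.succ, η k.castSucc + 1⟩ : (_ : Fin (m + 1)) × ℕ) ∈
      Finset.univ.sigma fun i => Finset.Icc 1 (η i) := by
    simp only [Finset.mem_sigma, Finset.mem_univ, Finset.mem_Icc, true_and]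
    omega
  convert prod_mul_eq_of_eq_off hx (f := fun x => 1 - q ^ ((η x.1 - x.2) + 1) *
      t ^ (leg η x.1 x.2 + c)) (g := fun x => 1 - q ^ ((η x.1 - x.2) + 1) *
      t ^ (leg (sw k η) (Equiv.swap k.castSucc k.succ x.1) x.2 + c)) ?_ using 2
  · simp only
    rw [show η k.succ - (η k.castSucc + 1) + 1 = η k.succ - η k.castSucc by omega]
    congr 3
    omega
  · simp only
    rw [show η k.succ - (η k.castSucc + 1) + 1 = η k.succ - η k.castSucc by omega]
    congr 3
    omega
  · rintro ⟨i, j⟩ _ hne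
    simp only
    rw [leg_sw h i j, if_neg, add_zero]
    rintro ⟨rfl, rfl⟩
    exact hne rfl

theorem e_raise (q t : F) (η : Comp m) :
    e q t (raise η) = e q t η * (1 - q ^ (η 0 + 1) * t ^ (m - legCo η 0 + 1)) := by
  have hle := legCo_le η 0
  rw [e, e, Fin.prod_univ_castSucc, Fin.prod_univ_succ]
  simp only [raise_castSucc, raise_last, legCo_raise_castSucc, legCo_raise_last]
  rw [Finset.prod_Icc_succ_top (by omega), Nat.add_sub_cancel, Nat.sub_add_comm hle]
  ring

theorem e_sw (q t : F) {k : Fin m} {η : Comp m} (h : η k.castSucc < η k.succ) :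
    e q t (sw k η) = e q t η := by
  rw [e, ← Equiv.prod_comp (Equiv.swap k.castSucc k.succ)]
  simp only [legCo_sw h, sw_apply, Equiv.swap_apply_self]
  rfl

theorem nodeProd_ne_zero {q t : F} (hqt : ∀ a b : ℕ, 1 ≤ a → q ^ a * t ^ b ≠ 1) (c : ℕ)
    (η : Comp m) : nodeProd q t c η ≠ 0 :=
  Finset.prod_ne_zero_iff.2 fun _ _ => Finset.prod_ne_zero_iff.2 fun _ _ =>
    sub_ne_zero.2 (hqt _ _ (by omega)).symm

theorem e_ne_zero {q t : F} (hqt : ∀ a b : ℕ, 1 ≤ a → q ^ a * t ^ b ≠ 1) (η : Comp m) :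
    e q t η ≠ 0 :=
  Finset.prod_ne_zero_iff.2 fun _ _ => Finset.prod_ne_zero_iff.2 fun _ _ =>
    sub_ne_zero.2 (hqt _ _ (by omega)).symm

/-- The coefficient of `E_η(x; q, t) E_η(y; q⁻¹, t⁻¹)` in the kernel. -/
def kerCoeff (q t : F) (η : Comp m) : F := d q t η / (d' q t η * e q t η)

theorem kerCoeff_raise {q t : F} (hqt : ∀ a b : ℕ, 1 ≤ a → q ^ a * t ^ b ≠ 1) (η : Comp m) :
    kerCoeff q t (raise η) * (1 - q ^ (η 0 + 1) * t ^ (m - legCo η 0)) = kerCoeff q t η := by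
  have h₁ : 1 - q ^ (η 0 + 1) * t ^ (m - legCo η 0) ≠ 0 :=
    sub_ne_zero.2 (hqt _ _ (by omega)).symm
  have h₂ : 1 - q ^ (η 0 + 1) * t ^ (m - legCo η 0 + 1) ≠ 0 :=
    sub_ne_zero.2 (hqt _ _ (by omega)).symm
  have h₃ := nodeProd_ne_zero hqt 0 η
  have h₄ := e_ne_zero hqt η
  rw [kerCoeff, kerCoeff, d_eq_nodeProd, d_eq_nodeProd, d'_eq_nodeProd, d'_eq_nodeProd,
    nodeProd_raise, nodeProd_raise, e_raise, add_zero]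
  field_simp

/-- The ratio of the eigenvalues of `Y_{k+1}` and `Y_k` on `E_η` for `η_k < η_{k+1}` (see
`eigenval_succ`); under this condition neither subtraction truncates. -/
def ratio (q t : F) (η : Comp m) (k : Fin m) : F :=
  q ^ (η k.succ - η k.castSucc) * t ^ (legCo η k.castSucc - legCo η k.succ)

theorem legCo_succ_lt {k : Fin m} {η : Comp m} (h : η k.castSucc < η k.succ) :
    legCo η k.succ < legCo η k.castSucc := (ranks_legCo η).lt_of_lt _ _ h

theorem eigenval_succ {q t : F} (ht : t ≠ 0) {k : Fin m} {η : Comp m}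
    (h : η k.castSucc < η k.succ) :
    eigenval q t η k.succ = ratio q t η k * eigenval q t η k.castSucc := by
  obtain ⟨a, ha⟩ := Nat.exists_eq_add_of_lt h
  obtain ⟨b, hb⟩ := Nat.exists_eq_add_of_lt (legCo_succ_lt h)
  have e₁ : η k.succ - η k.castSucc = a + 1 := by omega
  have e₂ : legCo η k.castSucc - legCo η k.succ = b + 1 := by omega
  rw [eigenval, eigenval, ratio, e₁, e₂, ha, hb]
  simp only [pow_add, inv_pow]
  have := pow_ne_zero b ht
  have := pow_ne_zero (legCo η k.succ) ht
  field_simp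

theorem ratio_ne_one {q t : F} (hqt : ∀ a b : ℕ, 1 ≤ a → q ^ a * t ^ b ≠ 1) {k : Fin m}
    {η : Comp m} (h : η k.castSucc < η k.succ) : 1 - ratio q t η k ≠ 0 :=
  sub_ne_zero.2 (hqt _ _ (by omega)).symm

theorem kerCoeff_sw {q t : F} (ht : t ≠ 0) (hqt : ∀ a b : ℕ, 1 ≤ a → q ^ a * t ^ b ≠ 1)
    {k : Fin m} {η : Comp m} (h : η k.castSucc < η k.succ) :
    kerCoeff q t η = (1 - ratio q t η k / t) * (1 - t * ratio q t η k) /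
      (1 - ratio q t η k) ^ 2 * kerCoeff q t (sw k η) := by
  have hlt := legCo_succ_lt h
  have h₁ := nodeProd_sw q t 1 h
  have h₀ := nodeProd_sw q t 0 h
  have e₁ : legCo η k.castSucc - legCo η k.succ - 1 + 1 = legCo η k.castSucc - legCo η k.succ := by
    omega
  have e₂ : q ^ (η k.succ - η k.castSucc) * t ^ (legCo η k.castSucc - legCo η k.succ - 1 + 0) =
      ratio q t η k / t := by
    rw [ratio, eq_div_iff ht, mul_assoc, ← pow_succ, add_zero, e₁]
  have e₃ : q ^ (η k.succ - η k.castSucc) * t ^ (legCo η k.castSucc - legCo η k.succ + 1) =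
      t * ratio q t η k := by
    rw [ratio, pow_succ]
    ring
  rw [e₂, add_zero, ← ratio] at h₀
  rw [e₁, e₃, ← ratio] at h₁
  have hz := ratio_ne_one hqt h
  have n₁ := nodeProd_ne_zero hqt 0 η
  have n₂ := nodeProd_ne_zero hqt 0 (sw k η)
  have n₃ := e_ne_zero hqt η
  rw [kerCoeff, kerCoeff, e_sw q t h, d_eq_nodeProd, d_eq_nodeProd, d'_eq_nodeProd,
    d'_eq_nodeProd, ← mul_div_assoc, div_eq_div_iff (mul_ne_zero n₁ n₃) (mul_ne_zero n₂ n₃),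
    div_mul_eq_mul_div, div_mul_eq_mul_div, eq_div_iff (pow_ne_zero 2 hz)]
  linear_combination (nodeProd q t 0 (sw k η) * e q t η * (1 - ratio q t η k)) * h₁ -
    (nodeProd q t 1 (sw k η) * e q t η * (1 - t * ratio q t η k)) * h₀

/-! ### Existence of the non-symmetric Macdonald polynomials -/

theorem ωHom_monomial (q : F) (ν : Comp m) :
    X (Fin.last m) * ωHom q (monomial ν 1 : Poly m F) = q ^ ν 0 • monomial (raise ν) 1 := by
  rw [ωHom, aeval_monomial, map_one, one_mul, Finsupp.prod_fintype _ _ (fun _ => pow_zero _),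
    Fin.prod_univ_succ, monomial_eq, C_1, one_mul, Finsupp.prod_fintype _ _ (fun _ => pow_zero _),
    Fin.prod_univ_castSucc, raise_last, smul_eq_C_mul, Fin.cons_zero, mul_pow, C_pow]
  simp only [Fin.cons_succ, raise_castSucc]
  ring

theorem Ψ_monomial (q : F) (ν : Comp m) :
    Ψ q (monomial ν 1 : Poly m F) = q ^ ν 0 • monomial (raise ν) 1 := by
  rw [Ψ, Module.End.mul_apply, mulX, LinearMap.mulLeft_apply, ω_apply, ωHom_monomial]

theorem coeff_Ψ (q : F) (f : Poly m F) (η : Comp m) :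
    (Ψ q f).coeff (raise η) = q ^ η 0 * f.coeff η := by
  rw [coeff_op, Finset.sum_eq_single η, Ψ_monomial, coeff_smul, coeff_monomial, if_pos rfl,
    smul_eq_mul, mul_one, mul_comm]
  · intro κ _ hne
    rw [Ψ_monomial, coeff_smul, coeff_monomial, if_neg fun h => hne (raise_injective h), smul_zero,
      mul_zero]
  · intro h
    rw [notMem_support_iff.1 h, zero_mul]

theorem Ψ_eigen {q t : F} (ht : t ≠ 0) {η : Comp m} {f : Poly m F}
    (hf : ∀ i, Y q t i f = eigenval q t η i • f) (i : Fin (m + 1)) :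
    Y q t i (Ψ q f) = eigenval q t (raise η) i • Ψ q f := by
  refine Fin.lastCases ?_ (fun i => ?_) i
  · rw [← Module.End.mul_apply, Y_last_mul_Ψ q ht, LinearMap.smul_apply, Module.End.mul_apply, hf,
      map_smul, smul_smul, eigenval_raise_last]
  · rw [← Module.End.mul_apply, Y_castSucc_mul_Ψ q ht, Module.End.mul_apply, hf, map_smul,
      eigenval_raise_castSucc]

/-- A correction of `T_k f` by a multiple of `f` interchanges two eigenvalues of a joint eigenvector
`f`. The condition on `α` is stated without division, since the two eigenvalues may agree. -/
theorem T_sub_eigen {q t : F} (ht : t ≠ 0) {k : Fin m} {a : Fin (m + 1) → F} {α : F}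
    {f : Poly m F} (hf : ∀ i, Y q t i f = a i • f)
    (hα : α * (a k.castSucc - a k.succ) = (t - 1) * a k.castSucc) (i : Fin (m + 1)) :
    Y q t i (T t k f - α • f) =
      a (Equiv.swap k.castSucc k.succ i) • (T t k f - α • f) := by
  have hY : ∀ g, t • Y q t k.castSucc g = T t k (Y q t k.succ (T t k g)) := fun g =>
    LinearMap.congr_fun (Y_castSucc ht k) g
  by_cases h₁ : i = k.castSucc
  · have h := hY (T t k f)
    rw [T_sq, map_add, map_add, map_smul, map_smul, map_smul, map_smul, ← hY f, hf, hf,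
      map_smul] at h
    have h' : Y q t k.castSucc (T t k f) =
        a k.succ • T t k f + ((t - 1) * a k.castSucc) • f := by
      apply smul_right_injective _ ht
      simp only
      rw [h, smul_add, smul_smul, smul_smul, smul_smul, smul_smul, add_comm]
      congr 2
      ring
    rw [h₁, Equiv.swap_apply_left, map_sub, map_smul, h', hf, ← hα, smul_sub, smul_smul,
      smul_smul, mul_sub, sub_smul, mul_comm (a k.succ)]
    abel
  by_cases h₂ : i = k.succ
  · have h : Y q t k.succ (T t k f) = a k.castSucc • T t k f - ((t - 1) * a k.castSucc) • f := by
      have e := congrArg (Tinv t k) (hY f)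
      rw [← Module.End.mul_apply (Tinv t k), Tinv_mul_T ht, Module.End.one_apply, hf, map_smul,
        map_smul] at e
      rw [← e]
      simp only [Tinv, LinearMap.add_apply, LinearMap.smul_apply, Module.End.one_apply, smul_add,
        smul_smul]
      have c₁ : t * (a k.castSucc * t⁻¹) = a k.castSucc := by field_simp
      have c₂ : t * (a k.castSucc * (t⁻¹ - 1)) = -((t - 1) * a k.castSucc) := by
        field_simp
        ring
      rw [add_comm, c₁, c₂, neg_smul]
      abel
    rw [h₂, Equiv.swap_apply_right, map_sub, map_smul, h, hf, ← hα, smul_sub, smul_smul,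
      smul_smul, mul_sub, sub_smul, mul_comm (a k.castSucc) α]
    abel
  · have h := LinearMap.congr_fun (commute_T_Y (q := q) ht h₁ h₂).eq f
    rw [Module.End.mul_apply, Module.End.mul_apply] at h
    rw [Equiv.swap_apply_of_ne_of_ne h₁ h₂, map_sub, map_smul, ← h, hf, map_smul, smul_sub,
      smul_comm]

/-- Only the leading monomial of `E_η` contributes `x^{s_k η}` to `T_k E_η` when `η_k ≤ η_{k+1}`. -/
theorem coeff_sw_T {q t : F} {η : Comp m} {P : Poly m F} (hP : IsMacdonald q t η P) {k : Fin m}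
    (h : η k.castSucc ≤ η k.succ) : (T t k P).coeff (sw k η) = t := by
  have hT : ∀ κ : Comp m, ∃ g : Poly m F, T t k (monomial κ 1) =
      (if κ k.castSucc ≤ κ k.succ then t else 1) • monomial (sw k κ) 1 +
      (if κ k.castSucc < κ k.succ then t - 1 else 0) • monomial κ 1 + g ∧
      ∀ μ, g.coeff μ ≠ 0 → Between k.castSucc k.succ κ μ := fun κ => by
    obtain ⟨g, hg, hg'⟩ := T_s_monomial t k (sw k κ)
    rw [Module.End.mul_apply, s_monomial, sw_sw, sw_succ, sw_castSucc] at hg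
    exact ⟨g, hg, fun μ hμ => sw_sw k κ ▸ (hg' μ hμ).sw⟩
  have hne : η k.castSucc < η k.succ → η ≠ sw k η := fun hlt e => by
    have := sw_castSucc k η
    rw [← e] at this
    omega
  rw [coeff_op, Finset.sum_eq_single η, hP.coeff_self, one_mul]
  · obtain ⟨g, hg, hg'⟩ := hT η
    have h₁ : g.coeff (sw k η) = 0 := by
      by_contra h₁
      have := (hg' _ h₁).sw_right
      rw [sw_sw] at this
      exact (this.prec (Fin.castSucc_lt_succ).ne).1 rfl
    rw [hg, coeff_add, coeff_add, coeff_smul, coeff_smul, coeff_monomial, coeff_monomial, h₁,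
      if_pos h, if_pos rfl, smul_eq_mul, mul_one, add_zero]
    split_ifs with h₂ h₃
    · exact absurd h₃ (hne h₂)
    · rw [smul_zero, add_zero]
    · rw [zero_smul, add_zero]
    · rw [zero_smul, add_zero]
  · intro κ hκ hκη
    have hprec := (hP.triangular κ (mem_support_iff.1 hκ)).resolve_left hκη
    obtain ⟨g, hg, hg'⟩ := hT κ
    have h₁ : g.coeff (sw k η) = 0 := by
      by_contra h₁
      have := (hg' _ h₁).sw_right
      rw [sw_sw] at this
      exact (this.prec (Fin.castSucc_lt_succ).ne).asymm hprec
    have h₂ : sw k κ ≠ sw k η := fun e => hκη (by rw [← sw_sw k κ, e, sw_sw])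
    rw [hg, coeff_add, coeff_add, coeff_smul, coeff_smul, coeff_monomial, coeff_monomial, h₁,
      if_neg h₂, smul_zero, zero_add, add_zero]
    split_ifs with h₃ h₄
    · rw [h₄, sw_castSucc, sw_succ] at h₃
      omega
    · rw [smul_zero, mul_zero]
    · rw [zero_smul, mul_zero]
    · rw [zero_smul, mul_zero]
  · intro h₁
    rw [notMem_support_iff, hP.coeff_self] at h₁
    exact absurd h₁ one_ne_zero

theorem prec_sw {k : Fin m} {η : Comp m} (h : η k.castSucc < η k.succ) :
    Prec η (sw k η) := by
  have := prec_swap (Fin.castSucc_lt_succ (i := k)) (ν := sw k η)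
    (by rw [sw_castSucc, sw_succ]; exact h)
  rwa [← sw, sw_sw] at this

/-- The diagonal coefficient at `E_η` of `T_k` on the span of `E_η` and `E_{s_k η}`, for
`η_k < η_{k+1}`. -/
def diagCoeff (q t : F) (η : Comp m) (k : Fin m) : F := (t - 1) / (1 - ratio q t η k)

theorem diagCoeff_spec {q t : F} (ht : t ≠ 0)
    (hqt : ∀ a b : ℕ, 1 ≤ a → q ^ a * t ^ b ≠ 1) {k : Fin m} {η : Comp m}
    (h : η k.castSucc < η k.succ) :
    diagCoeff q t η k * (eigenval q t η k.castSucc - eigenval q t η k.succ) =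
      (t - 1) * eigenval q t η k.castSucc := by
  have := ratio_ne_one hqt h
  rw [eigenval_succ ht h, diagCoeff]
  field_simp

theorem exists_isMacdonald {q t : F} (hq : q ≠ 0) (ht : t ≠ 0)
    (hqt : ∀ a b : ℕ, 1 ≤ a → q ^ a * t ^ b ≠ 1) (η : Comp m) :
    ∃ P : Poly m F, IsMacdonald q t η P := by
  induction η using comp_induction with
  | zero =>
    refine ⟨monomial 0 1, ?_⟩
    have h : ∀ i, Y q t i (monomial 0 1) = eigenval q t (0 : Comp m) i • (monomial 0 1) :=
      fun i => by
        ext μ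
        have hY := Y_tri (m := m) q ht i
        by_cases hμ : μ = 0
        · rw [hμ, hY.diag, coeff_smul, coeff_monomial, if_pos rfl, smul_eq_mul, mul_one]
        · rw [coeff_smul, coeff_monomial, if_neg (Ne.symm hμ), smul_zero]
          by_contra hc
          have h₁ := ((hY.lower 0 μ hc).resolve_left hμ).sum_eq
          simp only [Finsupp.coe_zero, Pi.zero_apply, Finset.sum_const_zero,
            Finset.sum_eq_zero_iff, Finset.mem_univ, true_imp_iff] at h₁
          exact hμ (Finsupp.ext h₁)
    refine ⟨by rw [coeff_monomial, if_pos rfl], fun ν hν => Or.inl ?_, h⟩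
    rw [coeff_monomial] at hν
    by_contra hne
    exact hν (if_neg (Ne.symm hne))
  | raise η ih =>
    obtain ⟨P, hP⟩ := ih
    refine ⟨_, isMacdonald_of_eigenvector hq ht hqt ?_ (Ψ_eigen ht hP.eigen)⟩
    rw [coeff_Ψ, hP.coeff_self, mul_one]
    exact pow_ne_zero _ hq
  | swap k η h ih =>
    obtain ⟨P, hP⟩ := ih
    refine ⟨_, isMacdonald_of_eigenvector hq ht hqt (f := T t k P - diagCoeff q t η k • P) ?_
      fun i => ?_⟩
    · have h₁ : P.coeff (sw k η) = 0 := by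
        by_contra h₁
        rcases hP.triangular _ h₁ with h₂ | h₂
        · exact (prec_sw h).1 h₂.symm
        · exact (prec_sw h).asymm h₂
      rw [coeff_sub, coeff_sw_T hP h.le, coeff_smul, h₁, smul_zero, sub_zero]
      exact ht
    · rw [eigenval_sw q t h]
      exact T_sub_eigen ht hP.eigen (diagCoeff_spec ht hqt h) i

theorem isMacdonald_E {q t : F} (hq : q ≠ 0) (ht : t ≠ 0)
    (hqt : ∀ a b : ℕ, 1 ≤ a → q ^ a * t ^ b ≠ 1) (η : Comp m) : IsMacdonald q t η (E q t η) := by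
  have h := exists_isMacdonald hq ht hqt η
  rw [E, dif_pos h]
  exact h.choose_spec

/-! ### The action of the generators on the Macdonald polynomials -/

theorem Ψ_E {q t : F} (hq : q ≠ 0) (ht : t ≠ 0)
    (hqt : ∀ a b : ℕ, 1 ≤ a → q ^ a * t ^ b ≠ 1) (η : Comp m) :
    Ψ q (E q t η) = q ^ η 0 • E q t (raise η) := by
  have hP := isMacdonald_E hq ht hqt η
  rw [eq_smul_of_eigenvector hq ht hqt (isMacdonald_E hq ht hqt (raise η))
    (Ψ_eigen ht hP.eigen), coeff_Ψ, hP.coeff_self, mul_one]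

theorem T_E_of_lt {q t : F} (hq : q ≠ 0) (ht : t ≠ 0)
    (hqt : ∀ a b : ℕ, 1 ≤ a → q ^ a * t ^ b ≠ 1) {k : Fin m} {η : Comp m}
    (h : η k.castSucc < η k.succ) :
    T t k (E q t η) = diagCoeff q t η k • E q t η + t • E q t (sw k η) := by
  have hP := isMacdonald_E hq ht hqt η
  have h₁ : (E q t η).coeff (sw k η) = 0 := by
    by_contra h₁
    rcases hP.triangular _ h₁ with h₂ | h₂
    · exact (prec_sw h).1 h₂.symm
    · exact (prec_sw h).asymm h₂
  have h₂ := eq_smul_of_eigenvector hq ht hqt (isMacdonald_E hq ht hqt (sw k η))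
    (f := T t k (E q t η) - diagCoeff q t η k • E q t η) fun i => by
      rw [eigenval_sw q t h]
      exact T_sub_eigen ht hP.eigen (diagCoeff_spec ht hqt h) i
  rw [coeff_sub, coeff_sw_T hP h.le, coeff_smul, h₁, smul_zero, sub_zero] at h₂
  rw [← h₂]
  abel

/-- The quadratic relation for `T_k` determines its second column on the span of `E_η` and
`E_{s_k η}` from the first one. -/
theorem T_E_sw_of_lt {q t : F} (hq : q ≠ 0) (ht : t ≠ 0)
    (hqt : ∀ a b : ℕ, 1 ≤ a → q ^ a * t ^ b ≠ 1) {k : Fin m} {η : Comp m}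
    (h : η k.castSucc < η k.succ) :
    T t k (E q t (sw k η)) = (t - 1 - diagCoeff q t η k) • E q t (sw k η) +
      ((1 - ratio q t η k / t) * (1 - t * ratio q t η k) / (1 - ratio q t η k) ^ 2) •
        E q t η := by
  have h₁ := T_E_of_lt hq ht hqt h
  have h₂ := congrArg (T t k) h₁
  rw [T_sq, map_add, map_smul, map_smul, h₁] at h₂
  have hz := ratio_ne_one hqt h
  apply smul_right_injective _ ht
  simp only
  have h₃ := eq_sub_of_add_eq' h₂.symm
  rw [h₃]
  simp only [smul_add, smul_smul]
  have e₁ : t * ((1 - ratio q t η k / t) * (1 - t * ratio q t η k) / (1 - ratio q t η k) ^ 2) =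
      (t - 1) * diagCoeff q t η k + t - diagCoeff q t η k * diagCoeff q t η k := by
    rw [diagCoeff]
    field_simp
    ring
  rw [e₁]
  simp only [add_smul, sub_smul, mul_sub, mul_one]
  rw [show (t - 1) * t = t * t - t by ring, mul_comm (diagCoeff q t η k) t, sub_smul]
  abel

/-- When the parts `k` and `k + 1` agree, `T_k E_η - t E_η` is a joint eigenvector without leading
term, hence zero; this covers `t = 1`, where its eigenvalues are those of `E_η`. -/
theorem T_E_of_eq {q t : F} (hq : q ≠ 0) (ht : t ≠ 0)
    (hqt : ∀ a b : ℕ, 1 ≤ a → q ^ a * t ^ b ≠ 1) {k : Fin m} {η : Comp m}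
    (h : η k.castSucc = η k.succ) :
    T t k (E q t η) = t • E q t η := by
  have hP := isMacdonald_E hq ht hqt η
  have hleg : legCo η k.succ = legCo η k.castSucc + 1 := by
    rw [legCo_eq, legCo_eq, ← Finset.card_insert_of_notMem (a := k.castSucc)]
    · congr 1
      ext l
      simp only [Finset.mem_insert, Finset.mem_filter, Finset.mem_univ, true_and, h, Fin.lt_def,
        Fin.ext_iff, Fin.val_succ, Fin.val_castSucc]
      by_cases h₁ : l.val = k.val
      · have : l = k.castSucc := Fin.ext h₁
        subst this
        simp [h]
      · by_cases h₂ : l.val = k.val + 1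
        · have : l = k.succ := Fin.ext h₂
          subst this
          simp
        · omega
    · simp
  have ha : t * (eigenval q t η k.castSucc - eigenval q t η k.succ) =
      (t - 1) * eigenval q t η k.castSucc := by
    rw [eigenval, eigenval, hleg, ← h, pow_succ]
    field_simp
  rw [← sub_eq_zero]
  refine eq_zero_of_eigenvector hq ht hqt
    ((ranks_legCo η).comp (η' := η) (Equiv.swap k.castSucc k.succ) fun i => ?_) (fun i => ?_) ?_
  · rw [← sw_apply, sw_eq_self h]
  · rw [T_sub_eigen ht hP.eigen ha i, eigenval, ← sw_apply, sw_eq_self h, Function.comp_apply]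
  · have := coeff_sw_T hP h.le
    rw [sw_eq_self h] at this
    rw [coeff_sub, this, coeff_smul, hP.coeff_self, smul_eq_mul, mul_one, sub_self]

theorem pow_mul_eigenval_zero {q t : F} (ht : t ≠ 0) (η : Comp m) :
    t ^ m * eigenval q t η 0 = q ^ η 0 * t ^ (m - legCo η 0) := by
  have h := pow_mul_pow_sub t (legCo_le η 0)
  have := pow_ne_zero (legCo η 0) ht
  rw [eigenval, ← h, inv_pow]
  field_simp

theorem Φ_E {q t : F} (hq : q ≠ 0) (ht : t ≠ 0)
    (hqt : ∀ a b : ℕ, 1 ≤ a → q ^ a * t ^ b ≠ 1) (η : Comp m) :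
    Φ t (E q t η) = t⁻¹ ^ (m - legCo η 0) • E q t (raise η) := by
  have h₁ := Ψ_E hq ht hqt η
  rw [Ψ_eq q ht, LinearMap.smul_apply, Module.End.mul_apply,
    (isMacdonald_E hq ht hqt η).eigen 0, map_smul, smul_smul] at h₁
  rw [pow_mul_eigenval_zero ht, mul_smul] at h₁
  have h₂ := smul_right_injective _ (pow_ne_zero _ hq) h₁
  rw [← h₂, smul_smul, inv_pow, inv_mul_cancel₀ (pow_ne_zero _ ht), one_smul]

theorem Φhat_E_raise {q t : F} (hq : q ≠ 0) (ht : t ≠ 0)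
    (hqt : ∀ a b : ℕ, 1 ≤ a → q ^ a * t ^ b ≠ 1) (η : Comp m) :
    Φhat q t (E q t (raise η)) = (t ^ (m - legCo η 0) *
      (1 - q ^ (η 0 + 1) * t ^ (m - legCo η 0))) • E q t η := by
  have h₁ := congrArg (Φhat q t) (Ψ_E hq ht hqt η)
  have hY := (isMacdonald_E hq ht hqt η).eigen 0
  rw [← Module.End.mul_apply, Φhat_mul_Ψ q ht, map_smul] at h₁
  simp only [LinearMap.smul_apply, Module.End.mul_apply, LinearMap.sub_apply,
    Module.End.one_apply, map_sub, map_smul, hY] at h₁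
  have e₁ := pow_mul_eigenval_zero (q := q) ht η
  apply smul_right_injective _ (pow_ne_zero (η 0) hq)
  simp only
  rw [← h₁]
  simp only [smul_smul, ← sub_smul]
  congr 1
  rw [pow_succ]
  linear_combination (1 - q * t ^ m * eigenval q t η 0 - q * q ^ η 0 * t ^ (m - legCo η 0)) * e₁

/-- `x_n D_n = 1 - t^{n-1} Y_n` vanishes on `E_η`, as the eigenvalue of `Y_n` is `t^{1-n}`. -/
theorem Φhat_E_of_last_eq_zero {q t : F} (hq : q ≠ 0) (ht : t ≠ 0)
    (hqt : ∀ a b : ℕ, 1 ≤ a → q ^ a * t ^ b ≠ 1) {η : Comp m} (h : η (Fin.last m) = 0) :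
    Φhat q t (E q t η) = 0 := by
  have hY := (isMacdonald_E hq ht hqt η).eigen (Fin.last m)
  have hleg : legCo η (Fin.last m) = m := by
    have h₁ : Finset.Ioi (Fin.last m) = ∅ := by
      ext i
      simp [Fin.le_last]
    rw [legCo, h₁, h]
    simp
  have h₂ : xD q t (Fin.last m) (E q t η) = 0 := by
    rw [xD_last, LinearMap.sub_apply, LinearMap.smul_apply, hY, eigenval, hleg, h, smul_smul,
      pow_zero, one_mul, ← mul_pow, mul_inv_cancel₀ ht, one_pow, one_smul, Module.End.one_apply,
      sub_self]
  rw [Φhat, D, Module.End.mul_apply, Module.End.mul_apply, h₂, map_zero, map_zero]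

/-! ### The `q`-Dunkl operators -/

theorem Tinv_mul_Tinv {t : F} (ht : t ≠ 0) (k : Fin m) :
    t • (Tinv t k * Tinv t k) = 1 + (t⁻¹ - 1) • (t • Tinv t k) := by
  have h : t • Tinv t k = (1 - t) • (1 : Op m F) + T t k := by
    rw [Tinv, smul_add, smul_smul, smul_smul, mul_sub, mul_inv_cancel₀ ht, mul_one, one_smul]
  have h₂ : (t⁻¹ - 1) • (t • Tinv t k) = (1 - t) • Tinv t k := by
    rw [smul_smul, sub_mul, inv_mul_cancel₀ ht, one_mul]
  rw [← smul_mul_assoc, h₂, h, add_mul, T_mul_Tinv ht, smul_mul_assoc, one_mul, add_comm]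

/-- The factor `1 + (t⁻¹ - 1) ∑_{j>i} t^{j-i} T_{ij}⁻¹` in the definition of `D_i`. -/
def dunklFactor (t : F) (i : Fin (m + 1)) : Op m F :=
  1 + (t⁻¹ - 1) • ∑ j ∈ Finset.Ioi i, t ^ (j.val - i.val) • Tijinv t i j

theorem xD_eq (q t : F) (i : Fin (m + 1)) : xD q t i = 1 - t ^ m • (dunklFactor t i * Y q t i) :=
  rfl

theorem Tijinv_castSucc_succ (t : F) (k : Fin m) : Tijinv t k.castSucc k.succ = Tinv t k := by
  rw [Tijinv, Fin.val_castSucc, Fin.val_succ, prodUp_succ _ k le_rfl, prodUp_of_le _ le_rfl,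
    prodDown_of_le _ (by omega), one_mul, mul_one]

theorem Tijinv_castSucc (t : F) {k : Fin m} {j : Fin (m + 1)} (h : k.succ < j) :
    Tijinv t k.castSucc j = Tinv t k * Tijinv t k.succ j * Tinv t k := by
  have h' : k.val + 1 < j.val := by simpa [Fin.lt_def] using h
  rw [Tijinv, Tijinv, Fin.val_castSucc, Fin.val_succ, prodUp_eq_mul _ k (by omega),
    prodDown_eq_mul _ k (by omega)]
  simp only [mul_assoc]

/-- The quadratic relation accounts for the term `j = i + 1` of the sum. -/
theorem dunklFactor_castSucc {t : F} (ht : t ≠ 0) (k : Fin m) :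
    dunklFactor t k.castSucc = t • (Tinv t k * dunklFactor t k.succ * Tinv t k) := by
  have hI : Finset.Ioi k.castSucc = insert k.succ (Finset.Ioi k.succ) := by
    ext j
    simp only [Finset.mem_Ioi, Finset.mem_insert, Fin.lt_def, Fin.ext_iff, Fin.val_castSucc,
      Fin.val_succ]
    omega
  rw [dunklFactor, dunklFactor, hI, Finset.sum_insert (by simp), Tijinv_castSucc_succ,
    Finset.sum_congr rfl (g := fun j => t • (Tinv t k * (t ^ (j.val - k.succ.val) •
      Tijinv t k.succ j) * Tinv t k)) fun j hj => ?_, ← Finset.smul_sum, ← Finset.sum_mul,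
    ← Finset.mul_sum, mul_add, add_mul, mul_one, smul_add, smul_add t (_ * _), Tinv_mul_Tinv ht,
    mul_smul_comm, smul_mul_assoc, smul_comm t (t⁻¹ - 1) (_ * _ * _), ← add_assoc, Fin.val_castSucc,
    Fin.val_succ, Nat.add_sub_cancel_left, pow_one]
  have hj' : k.val + 1 < j.val := by simpa [Fin.lt_def] using Finset.mem_Ioi.1 hj
  rw [Tijinv_castSucc t (Finset.mem_Ioi.1 hj), mul_smul_comm, smul_mul_assoc, smul_smul,
    ← pow_succ', Fin.val_castSucc, Fin.val_succ, show j.val - (k.val + 1) + 1 = j.val - k.val by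
    omega]

theorem Tinv_mul_xD_mul_T (q : F) {t : F} (ht : t ≠ 0) (k : Fin m) :
    Tinv t k * xD q t k.succ * T t k = xD q t k.castSucc := by
  have h : Y q t k.succ * T t k = t • (Tinv t k * Y q t k.castSucc) := by
    rw [← mul_smul_comm, Y_castSucc ht, mul_assoc, ← mul_assoc, Tinv_mul_T ht, one_mul]
  rw [xD_eq, xD_eq, mul_sub, sub_mul, mul_one, Tinv_mul_T ht, mul_smul_comm, smul_mul_assoc,
    dunklFactor_castSucc ht, mul_assoc, mul_assoc, h, smul_mul_assoc, mul_smul_comm, mul_smul_comm]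
  simp only [mul_assoc]

/-- Multiplication by `x_k` turns `t⁻¹ T_k D_{k+1} T_k` into `x_k D_k`. -/
theorem mulX_mul_T_mul_D {q t : F} (ht : t ≠ 0) {k : Fin m}
    (h : mulX k.succ * D q t k.succ = xD q t k.succ) :
    mulX k.castSucc * (t⁻¹ • (T t k * D q t k.succ * T t k)) = xD q t k.castSucc := by
  rw [← Tinv_mul_xD_mul_T q ht, ← h, ← mul_assoc (Tinv t k), Tinv_mul_mulX ht, mul_smul_comm,
    smul_mul_assoc, smul_mul_assoc]
  simp only [mul_assoc]

/-- Modulo `x_i`, the product `T_i⁻¹ ⋯ T_{n-1}⁻¹` is a power of `t` times a permutation. -/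
theorem X_dvd_prodUp_Tinv {t : F} (ht : t ≠ 0) (f : Poly m F) (i : Fin (m + 1)) :
    (X i : Poly m F) ∣ prodUp (Tinv t) i.val m f - t⁻¹ ^ (m - i.val) • prodUp s i.val m f := by
  induction i using Fin.reverseInduction with
  | last =>
    rw [Fin.val_last, prodUp_of_le _ le_rfl, prodUp_of_le _ le_rfl, Nat.sub_self, pow_zero,
      one_smul, sub_self]
    exact dvd_zero _
  | cast k ih =>
    obtain ⟨g, hg⟩ := ih
    have h₁ : Tinv t k (X k.succ * g) = t⁻¹ • (X k.castSucc * T t k g) :=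
      LinearMap.congr_fun (Tinv_mul_mulX ht k) g
    have h₂ : ∀ p, Tinv t k p - t⁻¹ • s k p =
        X k.castSucc * ((1 - C t⁻¹) * divDiff k p) := fun p => by
      have hC : (C t⁻¹ * C t : Poly m F) = 1 := by rw [← C_mul, inv_mul_cancel₀ ht, C_1]
      have hd := divDiff_spec k p
      rw [Tinv, LinearMap.add_apply, LinearMap.smul_apply, LinearMap.smul_apply,
        Module.End.one_apply, T_apply]
      simp only [smul_eq_C_mul, C_sub, C_1]
      linear_combination (p + X k.castSucc * divDiff k p) * hC + C t⁻¹ * hd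
    rw [Fin.val_succ] at hg
    rw [Fin.val_castSucc, prodUp_eq_mul _ k k.isLt, prodUp_eq_mul _ k k.isLt,
      Module.End.mul_apply, Module.End.mul_apply, eq_add_of_sub_eq hg, map_add, h₁, map_smul,
      show m - k.val = (m - (k.val + 1)) + 1 by omega, pow_succ, mul_smul, add_sub_assoc,
      ← smul_sub, h₂]
    rw [smul_eq_C_mul, smul_eq_C_mul]
    exact dvd_add ((dvd_mul_right _ _).mul_left _) ((dvd_mul_right _ _).mul_left _)

/-- The base case of the exactness: modulo `x_n`, `t^{n-1} Y_n` is `ω s_1 ⋯ s_{n-1}`, which is the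
identity modulo `x_n`. -/
theorem X_last_dvd_xD (q : F) {t : F} (ht : t ≠ 0) (f : Poly m F) :
    (X (Fin.last m) : Poly m F) ∣ xD q t (Fin.last m) f := by
  obtain ⟨σ, h₁, h₂, h₃, -⟩ := prodDown_s_eq (F := F) (le_refl m)
  have hU : (prodUp s 0 m : Op m F) = permOp σ⁻¹ := by
    have := prodUp_mul_prodDown (A := s) (B := s) (s_mul_s (m := m) (F := F)) (Nat.zero_le m) le_rfl
    rw [h₁] at this
    rw [← mul_one (prodUp s 0 m), ← permOp_mul_inv σ, ← mul_assoc, this, one_mul]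
  -- Modulo `x_n`, `ω s_1 ⋯ s_{n-1}` is the identity: it multiplies `x_n` by `q`.
  have hφ : (X (Fin.last m) : Poly m F) ∣ f - ω q (prodUp s 0 m f) := by
    rw [← Ideal.mem_span_singleton, ← Ideal.Quotient.eq]
    set I : Ideal (Poly m F) := Ideal.span {X (Fin.last m)}
    have hX : Ideal.Quotient.mk I (X (Fin.last m)) = 0 :=
      Ideal.Quotient.eq_zero_iff_mem.2 (Ideal.mem_span_singleton_self _)
    have h : Ideal.Quotient.mkₐ F I = (Ideal.Quotient.mkₐ F I).comp
        ((ωHom q).comp (rename (σ⁻¹ : Equiv.Perm _))) := by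
      apply MvPolynomial.algHom_ext
      intro j
      simp only [AlgHom.comp_apply, rename_X, Ideal.Quotient.mkₐ_eq_mk]
      refine Fin.lastCases ?_ (fun j => ?_) j
      · have e : σ⁻¹ (Fin.last m) = 0 := by
          rw [Equiv.Perm.inv_eq_iff_eq]
          exact (Fin.ext h₂).symm
        rw [e, ωHom_X_zero, map_mul, hX, mul_zero]
      · have e : σ⁻¹ j.castSucc = j.succ := by
          rw [Equiv.Perm.inv_eq_iff_eq, h₃ j j.isLt]
        rw [e, ωHom_X_succ]
    rw [hU, ω_apply]
    exact DFunLike.congr_fun h f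
  obtain ⟨g, hg⟩ := X_dvd_prodUp_Tinv ht f 0
  rw [Fin.val_zero, Nat.sub_zero] at hg
  have h : xD q t (Fin.last m) f =
      (f - ω q (prodUp s 0 m f)) - t ^ m • (C q * X (Fin.last m) * ω q g) := by
    rw [xD_last, LinearMap.sub_apply, LinearMap.smul_apply, Y_last, Module.End.mul_apply,
      Module.End.one_apply, eq_add_of_sub_eq hg, map_add, map_smul, ω_apply q (X 0 * g), map_mul,
      ωHom_X_zero, ← ω_apply, smul_add, smul_smul, ← mul_pow, mul_inv_cancel₀ ht, one_pow, one_smul]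
    abel
  rw [h]
  refine dvd_sub hφ ?_
  rw [smul_eq_C_mul]
  exact ((dvd_mul_left _ _).mul_right _).mul_left _

theorem mulX_mul_divX_apply {i : Fin (m + 1)} {f : Poly m F} (h : X i ∣ f) :
    mulX i (divX i f) = f := by
  obtain ⟨g, rfl⟩ := h
  have h₁ : divX i (X i * g) = g := LinearMap.congr_fun (divX_mul_mulX i) g
  rw [h₁]
  rfl

theorem mulX_mul_D_iff {q t : F} {i : Fin (m + 1)} :
    mulX i * D q t i = xD q t i ↔ ∀ f, (X i : Poly m F) ∣ xD q t i f := by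
  refine ⟨fun h f => ?_, fun h => LinearMap.ext fun f => mulX_mul_divX_apply (h f)⟩
  rw [← h]
  exact dvd_mul_right _ _

/-- The divisions in the definition of the `q`-Dunkl operators are exact. Downward induction on `i`:
the operator `t⁻¹ T_i D_{i+1} T_i` exhibits the quotient. -/
theorem mulX_mul_D (q : F) {t : F} (ht : t ≠ 0) (i : Fin (m + 1)) :
    mulX i * D q t i = xD q t i := by
  induction i using Fin.reverseInduction with
  | last => exact mulX_mul_D_iff.2 (X_last_dvd_xD q ht)
  | cast k ih =>
    rw [mulX_mul_D_iff]
    intro f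
    rw [← mulX_mul_T_mul_D ht ih]
    exact dvd_mul_right _ _

theorem D_castSucc (q : F) {t : F} (ht : t ≠ 0) (k : Fin m) :
    D q t k.castSucc = t⁻¹ • (T t k * D q t k.succ * T t k) := by
  rw [D, ← mulX_mul_T_mul_D ht (mulX_mul_D q ht _), ← mul_assoc, divX_mul_mulX, one_mul]

/-! ### Operators acting on series -/

theorem series_ext {K K' : Series m F} (h : ∀ μ ν, MvPowerSeries.coeff (expo μ ν) K =
    MvPowerSeries.coeff (expo μ ν) K') : K = K' := by
  ext κ
  have e : expo (Finsupp.sumFinsuppEquivProdFinsupp κ).1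
      (Finsupp.sumFinsuppEquivProdFinsupp κ).2 = κ := Equiv.symm_apply_apply _ _
  rw [← e]
  exact h _ _

theorem coeff_actX (L : Op m F) (K : Series m F) (μ ν : Comp m) :
    MvPowerSeries.coeff (expo μ ν) (actX L K) =
      ∑ᶠ l : Comp m, (L (monomial l 1)).coeff μ * MvPowerSeries.coeff (expo l ν) K :=
  coeff_mkSeries _ _ _

theorem coeff_actY (L : Op m F) (K : Series m F) (μ ν : Comp m) :
    MvPowerSeries.coeff (expo μ ν) (actY L K) =
      ∑ᶠ l : Comp m, (L (monomial l 1)).coeff ν * MvPowerSeries.coeff (expo μ l) K :=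
  coeff_mkSeries _ _ _

/-- Only finitely many monomials contribute to each coefficient of `L f`; the termwise action of
such an operator is defined on arbitrary series. -/
def RowFinite (L : Op m F) : Prop :=
  ∀ μ, {l | (L (monomial l 1)).coeff μ ≠ 0}.Finite

theorem Tri.rowFinite {L : Op m F} {χ : Comp m → F} (h : Tri L χ) : RowFinite L := fun μ => by
  refine Set.Finite.subset (Finset.finite_toSet
    (Finset.finsuppAntidiag Finset.univ (∑ i, μ i))) fun l hl => ?_
  have : ∑ i, μ i = ∑ i, l i := by
    rcases h.lower l μ hl with rfl | h
    · rfl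
    · exact h.sum_eq
  simp [Finset.mem_finsuppAntidiag, this]

theorem RowFinite.add {L M : Op m F} (hL : RowFinite L) (hM : RowFinite M) :
    RowFinite (L + M) := fun μ =>
  ((hL μ).union (hM μ)).subset fun l hl => by
    by_contra h
    simp only [Set.mem_union, Set.mem_ofPred_eq, not_or, not_not] at h
    exact hl (by rw [LinearMap.add_apply, coeff_add, h.1, h.2, add_zero])

theorem RowFinite.sub {L M : Op m F} (hL : RowFinite L) (hM : RowFinite M) :
    RowFinite (L - M) := fun μ =>
  ((hL μ).union (hM μ)).subset fun l hl => by
    by_contra h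
    simp only [Set.mem_union, Set.mem_ofPred_eq, not_or, not_not] at h
    exact hl (by rw [LinearMap.sub_apply, coeff_sub, h.1, h.2, sub_zero])

theorem RowFinite.smul {L : Op m F} (hL : RowFinite L) (c : F) : RowFinite (c • L) := fun μ =>
  (hL μ).subset fun l hl => by
    rw [Set.mem_ofPred_eq, LinearMap.smul_apply, coeff_smul] at hl
    exact right_ne_zero_of_smul hl

theorem rowFinite_one : RowFinite (1 : Op m F) := tri_one.rowFinite

theorem coeff_op_of_subset (L : Op m F) (f : Poly m F) (μ : Comp m) {S : Finset (Comp m)}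
    (hS : ∀ l, (L (monomial l 1)).coeff μ ≠ 0 → f.coeff l ≠ 0 → l ∈ S) :
    (L f).coeff μ = ∑ l ∈ S, f.coeff l * (L (monomial l 1)).coeff μ := by
  rw [coeff_op, ← finsum_eq_sum_of_support_subset _ (s := f.support),
    finsum_eq_sum_of_support_subset]
  · intro l hl
    exact hS l (right_ne_zero_of_mul hl) (left_ne_zero_of_mul hl)
  · intro l hl
    exact mem_support_iff.2 (left_ne_zero_of_mul hl)

theorem RowFinite.mul {L M : Op m F} (hL : RowFinite L) (hM : RowFinite M) :
    RowFinite (L * M) := fun μ =>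
  ((hL μ).biUnion fun l _ => hM l).subset fun κ hκ => by
    rw [Set.mem_ofPred_eq, Module.End.mul_apply, coeff_op] at hκ
    obtain ⟨l, hl, h⟩ := Finset.exists_ne_zero_of_sum_ne_zero hκ
    simp only [Set.mem_iUnion]
    exact ⟨l, right_ne_zero_of_mul h, left_ne_zero_of_mul h⟩

/-- The termwise action is compatible with composition. The statement concerns one set of variables,
the exponent of the other one being fixed. -/
theorem finsum_coeff_mul {L M : Op m F} (hL : RowFinite L) (hM : RowFinite M) (K : Comp m → F)
    (μ : Comp m) :
    ∑ᶠ l, (L (monomial l 1)).coeff μ * ∑ᶠ κ, (M (monomial κ 1)).coeff l * K κ =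
      ∑ᶠ κ, ((L * M) (monomial κ 1)).coeff μ * K κ := by
  classical
  set A := (hL μ).toFinset
  set B := A.biUnion fun l => (hM l).toFinset
  have hA : ∀ l, (L (monomial l 1)).coeff μ ≠ 0 → l ∈ A := fun l hl =>
    (Set.Finite.mem_toFinset _).2 hl
  have hB : ∀ l ∈ A, ∀ κ, (M (monomial κ 1)).coeff l ≠ 0 → κ ∈ B := fun l hl κ hκ =>
    Finset.mem_biUnion.2 ⟨l, hl, (Set.Finite.mem_toFinset _).2 hκ⟩
  have hLM : ∀ κ, ((L * M) (monomial κ 1)).coeff μ =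
      ∑ l ∈ A, (M (monomial κ 1)).coeff l * (L (monomial l 1)).coeff μ := fun κ =>
    coeff_op_of_subset L _ μ fun l hl _ => hA l hl
  rw [finsum_eq_sum_of_support_subset (s := A) _ fun l hl => hA l (left_ne_zero_of_mul hl),
    finsum_eq_sum_of_support_subset (s := B) _ fun κ hκ => ?_]
  · simp only [hLM, Finset.sum_mul]
    rw [Finset.sum_comm]
    refine Finset.sum_congr rfl fun l hl => ?_
    rw [finsum_eq_sum_of_support_subset (s := B) _ fun κ hκ => hB l hl κ (left_ne_zero_of_mul hκ),
      Finset.mul_sum]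
    exact Finset.sum_congr rfl fun κ _ => by ring
  · have h := left_ne_zero_of_mul hκ
    rw [hLM] at h
    obtain ⟨l, hl, h⟩ := Finset.exists_ne_zero_of_sum_ne_zero h
    exact hB l hl κ (left_ne_zero_of_mul h)

theorem actX_actX {L M : Op m F} (hL : RowFinite L) (hM : RowFinite M) (K : Series m F) :
    actX L (actX M K) = actX (L * M) K := by
  refine series_ext fun μ ν => ?_
  simp only [coeff_actX]
  exact finsum_coeff_mul hL hM (fun κ => MvPowerSeries.coeff (expo κ ν) K) μ

theorem actY_actY {L M : Op m F} (hL : RowFinite L) (hM : RowFinite M) (K : Series m F) :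
    actY L (actY M K) = actY (L * M) K := by
  refine series_ext fun μ ν => ?_
  simp only [coeff_actY]
  exact finsum_coeff_mul hL hM (fun κ => MvPowerSeries.coeff (expo μ κ) K) ν

theorem actX_actY {L M : Op m F} (hL : RowFinite L) (hM : RowFinite M) (K : Series m F) :
    actX L (actY M K) = actY M (actX L K) := by
  refine series_ext fun μ ν => ?_
  simp only [coeff_actX, coeff_actY]
  obtain ⟨A, hA⟩ : ∃ A : Finset (Comp m), ∀ l, (L (monomial l 1)).coeff μ ≠ 0 → l ∈ A :=
    ⟨(hL μ).toFinset, fun l hl => (Set.Finite.mem_toFinset _).2 hl⟩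
  obtain ⟨B, hB⟩ : ∃ B : Finset (Comp m), ∀ l, (M (monomial l 1)).coeff ν ≠ 0 → l ∈ B :=
    ⟨(hM ν).toFinset, fun l hl => (Set.Finite.mem_toFinset _).2 hl⟩
  have eA : ∀ f : Comp m → F, ∑ᶠ l, (L (monomial l 1)).coeff μ * f l =
      ∑ l ∈ A, (L (monomial l 1)).coeff μ * f l := fun f =>
    finsum_eq_sum_of_support_subset _ fun l hl => hA l (left_ne_zero_of_mul hl)
  have eB : ∀ f : Comp m → F, ∑ᶠ l, (M (monomial l 1)).coeff ν * f l =
      ∑ l ∈ B, (M (monomial l 1)).coeff ν * f l := fun f =>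
    finsum_eq_sum_of_support_subset _ fun l hl => hB l (left_ne_zero_of_mul hl)
  rw [eA, eB, Finset.sum_congr rfl fun l _ => congrArg _ (eB _),
    Finset.sum_congr rfl fun l _ => congrArg _ (eA _)]
  simp only [Finset.mul_sum]
  rw [Finset.sum_comm]
  exact Finset.sum_congr rfl fun _ _ => Finset.sum_congr rfl fun _ _ => by ring

theorem actX_one (K : Series m F) : actX 1 K = K := by
  refine series_ext fun μ ν => ?_
  rw [coeff_actX, finsum_eq_single _ μ, Module.End.one_apply, coeff_monomial, if_pos rfl, one_mul]
  intro l hl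
  rw [Module.End.one_apply, coeff_monomial, if_neg hl, zero_mul]

theorem actX_smul (c : F) (L : Op m F) (K : Series m F) : actX (c • L) K = c • actX L K := by
  refine series_ext fun μ ν => ?_
  rw [MvPowerSeries.coeff_smul, coeff_actX, coeff_actX, ← smul_eq_mul, smul_finsum]
  exact finsum_congr fun l => by rw [LinearMap.smul_apply, coeff_smul, smul_eq_mul, smul_eq_mul,
    mul_assoc]

theorem actY_smul (c : F) (L : Op m F) (K : Series m F) : actY (c • L) K = c • actY L K := by
  refine series_ext fun μ ν => ?_
  rw [MvPowerSeries.coeff_smul, coeff_actY, coeff_actY, ← smul_eq_mul, smul_finsum]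
  exact finsum_congr fun l => by rw [LinearMap.smul_apply, coeff_smul, smul_eq_mul, smul_eq_mul,
    mul_assoc]

theorem expo_add_single (μ ν : Comp m) (i : Fin (m + 1)) :
    expo μ (ν + Finsupp.single i 1) = Finsupp.single (Sum.inr i) 1 + expo μ ν := by
  ext j
  rcases j with j | j
  · simp [expo]
  · simp [expo, Finsupp.single_apply, add_comm]

theorem expo_inr (μ ν : Comp m) (i : Fin (m + 1)) : expo μ ν (Sum.inr i) = ν i := by
  simp [expo]

/-- Multiplication by `y_i` is the termwise action of the multiplication operator. -/
theorem actY_mulX (i : Fin (m + 1)) (K : Series m F) :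
    actY (mulX i) K = MvPowerSeries.X (Sum.inr i) * K := by
  classical
  refine series_ext fun μ ν => ?_
  have hmon : ∀ l : Comp m, mulX i (monomial l 1 : Poly m F) =
      monomial (l + Finsupp.single i 1) 1 := fun l => by
    rw [mulX, LinearMap.mulLeft_apply, X, monomial_mul, one_mul, add_comm (Finsupp.single i 1)]
  rw [coeff_actY, MvPowerSeries.X_def]
  simp only [hmon, coeff_monomial]
  by_cases h : ν i = 0
  · rw [MvPowerSeries.coeff_monomial_mul, if_neg]
    · refine finsum_eq_zero_of_forall_eq_zero fun l => ?_
      rw [if_neg, zero_mul]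
      rintro rfl
      simp at h
    · intro hle
      have := hle (Sum.inr i)
      rw [expo_inr, h] at this
      simp at this
  · obtain ⟨κ, rfl⟩ : ∃ κ : Comp m, κ + Finsupp.single i 1 = ν :=
      ⟨ν - Finsupp.single i 1, tsub_add_cancel_of_le
        (Finsupp.single_le_iff.2 (Nat.one_le_iff_ne_zero.2 h))⟩
    rw [expo_add_single, MvPowerSeries.coeff_add_monomial_mul, finsum_eq_single _ κ, if_pos rfl]
    intro l hl
    rw [if_neg fun e => hl (add_right_cancel e), zero_mul]

theorem rowFinite_mulX (i : Fin (m + 1)) : RowFinite (mulX i : Op m F) := fun μ => by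
  refine Set.Finite.subset (Set.finite_singleton (μ - Finsupp.single i 1)) fun l hl => ?_
  have hmon : mulX i (monomial l 1 : Poly m F) = monomial (l + Finsupp.single i 1) 1 := by
    rw [mulX, LinearMap.mulLeft_apply, X, monomial_mul, one_mul, add_comm (Finsupp.single i 1)]
  rw [Set.mem_ofPred_eq, hmon, coeff_monomial] at hl
  have h : l + Finsupp.single i 1 = μ := by_contra fun h => hl (if_neg h)
  rw [Set.mem_singleton_iff, ← h, add_tsub_cancel_right]

theorem rowFinite_divX (i : Fin (m + 1)) : RowFinite (divX i : Op m F) := fun μ => by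
  refine Set.Finite.subset (Set.finite_singleton (Finsupp.single i 1 + μ)) fun l hl => ?_
  have h₁ : (divX i (monomial l 1 : Poly m F)).coeff μ =
      (monomial l (1 : F)).coeff (Finsupp.single i 1 + μ) := coeff_divMonomial _ _ _
  rw [Set.mem_ofPred_eq, h₁, coeff_monomial] at hl
  exact by_contra fun h => hl (if_neg h)

theorem rowFinite_T (t : F) (k : Fin m) : RowFinite (T t k) := fun μ => by
  refine Set.Finite.subset (Finset.finite_toSet
    (Finset.finsuppAntidiag Finset.univ (∑ i, μ i))) fun l hl => ?_
  suffices h : ∑ i, l i = ∑ i, μ i by simp [Finset.mem_finsuppAntidiag, h]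
  obtain ⟨g, hg, hg'⟩ := T_s_monomial t k (sw k l)
  rw [Module.End.mul_apply, s_monomial, sw_sw] at hg
  by_cases h₁ : g.coeff μ = 0
  · rw [Set.mem_ofPred_eq, hg, coeff_add, coeff_add, h₁, coeff_smul, coeff_smul, coeff_monomial,
      coeff_monomial] at hl
    by_cases h₂ : sw k l = μ
    · rw [← h₂, sum_sw]
    by_cases h₃ : l = μ
    · rw [h₃]
    rw [if_neg h₂, if_neg h₃, smul_zero, smul_zero, add_zero, add_zero] at hl
    exact absurd rfl hl
  · rw [((hg' μ h₁).prec (Fin.castSucc_lt_succ).ne).sum_eq, sum_sw]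

theorem rowFinite_Tinv (t : F) (k : Fin m) : RowFinite (Tinv t k) :=
  (rowFinite_one.smul _).add ((rowFinite_T t k).smul _)

theorem rowFinite_prodUp {A : Fin m → Op m F} (hA : ∀ k, RowFinite (A k)) {hi : ℕ} (h : hi ≤ m) :
    RowFinite (prodUp A 0 hi) := by
  induction hi with
  | zero => rw [prodUp_of_le _ le_rfl]; exact rowFinite_one
  | succ p ih =>
    have e := prodUp_succ A (⟨p, h⟩ : Fin m) (Nat.zero_le _)
    simp only at e
    rw [e]
    exact (ih (by omega)).mul (hA _)

theorem rowFinite_prodDown {A : Fin m → Op m F} (hA : ∀ k, RowFinite (A k)) {hi : ℕ}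
    (h : hi ≤ m) : RowFinite (prodDown A 0 hi) := by
  induction hi with
  | zero => rw [prodDown_of_le _ le_rfl]; exact rowFinite_one
  | succ p ih =>
    have e := prodDown_succ A (⟨p, h⟩ : Fin m) (Nat.zero_le _)
    simp only at e
    rw [e]
    exact (hA _).mul (ih (by omega))

theorem rowFinite_D (q : F) {t : F} (ht : t ≠ 0) (i : Fin (m + 1)) : RowFinite (D q t i) := by
  induction i using Fin.reverseInduction with
  | last =>
    rw [D, xD_last]
    exact (rowFinite_divX _).mul (rowFinite_one.sub ((Y_tri q ht _).rowFinite.smul _))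
  | cast k ih =>
    rw [D_castSucc q ht]
    exact (((rowFinite_T t k).mul ih).mul (rowFinite_T t k)).smul _

/-! ### The kernel -/

theorem finite_support_E (q t : F) (μ : Comp m) :
    {η : Comp m | (E q t η).coeff μ ≠ 0}.Finite := by
  refine Set.Finite.subset (Finset.finite_toSet
    (Finset.finsuppAntidiag Finset.univ (∑ i, μ i))) fun η hη => ?_
  simp [Finset.mem_finsuppAntidiag, degree_eq_of_coeff_E_ne_zero hη]

theorem coeff_kernel (q t : F) (μ ν : Comp m) :
    MvPowerSeries.coeff (expo μ ν) (kernel q t) = ∑ᶠ η : Comp m, kerCoeff q t η *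
      ((E q t η).coeff μ * (E q⁻¹ t⁻¹ η).coeff ν) := coeff_mkSeries _ _ _

/-- In one set of variables an operator acts on `∑ a_η P_η`, a finite sum in each coefficient, term
by term. -/
theorem finsum_coeff_finsum (L : Op m F) {a : Comp m → F} (P : Comp m → Poly m F)
    (ha : (Function.support a).Finite) (μ : Comp m) :
    ∑ᶠ l, (L (monomial l 1)).coeff μ * ∑ᶠ η, a η * (P η).coeff l =
      ∑ᶠ η, a η * (L (P η)).coeff μ := by
  have hs : ∀ f : Comp m → F, ∑ᶠ η, a η * f η = ∑ η ∈ ha.toFinset, a η * f η := fun f =>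
    finsum_eq_sum_of_support_subset _ fun η hη =>
      (Set.Finite.mem_toFinset _).2 (left_ne_zero_of_mul hη)
  have hp : ∀ l, ∑ᶠ η, a η * (P η).coeff l = (∑ η ∈ ha.toFinset, a η • P η).coeff l := fun l => by
    rw [hs, coeff_sum]
    exact Finset.sum_congr rfl fun η _ => by rw [coeff_smul, smul_eq_mul]
  simp only [hp]
  rw [hs, finsum_eq_sum_of_support_subset (s := (∑ η ∈ ha.toFinset, a η • P η).support) _
    fun l hl => mem_support_iff.2 (right_ne_zero_of_mul hl)]
  rw [Finset.sum_congr rfl fun l _ => mul_comm _ _, ← coeff_op, map_sum, coeff_sum]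
  exact Finset.sum_congr rfl fun η _ => by rw [map_smul, coeff_smul, smul_eq_mul]

theorem coeff_actX_kernel (q t : F) (L : Op m F) (μ ν : Comp m) :
    MvPowerSeries.coeff (expo μ ν) (actX L (kernel q t)) = ∑ᶠ η : Comp m, kerCoeff q t η *
      ((L (E q t η)).coeff μ * (E q⁻¹ t⁻¹ η).coeff ν) := by
  have h := finsum_coeff_finsum L (a := fun η => kerCoeff q t η * (E q⁻¹ t⁻¹ η).coeff ν) (E q t)
    ((finite_support_E q⁻¹ t⁻¹ ν).subset fun η hη => right_ne_zero_of_mul hη) μ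
  rw [coeff_actX]
  simp only [coeff_kernel]
  calc _ = _ := finsum_congr fun l => congrArg _ (finsum_congr fun η => by ring)
    _ = _ := h
    _ = _ := finsum_congr fun η => by ring

theorem coeff_actY_kernel (q t : F) (L : Op m F) (μ ν : Comp m) :
    MvPowerSeries.coeff (expo μ ν) (actY L (kernel q t)) = ∑ᶠ η : Comp m, kerCoeff q t η *
      ((E q t η).coeff μ * (L (E q⁻¹ t⁻¹ η)).coeff ν) := by
  have h := finsum_coeff_finsum L (a := fun η => kerCoeff q t η * (E q t η).coeff μ) (E q⁻¹ t⁻¹)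
    ((finite_support_E q t μ).subset fun η hη => right_ne_zero_of_mul hη) ν
  rw [coeff_actY]
  simp only [coeff_kernel]
  calc _ = _ := finsum_congr fun l => congrArg _ (finsum_congr fun η => by ring)
    _ = _ := h
    _ = _ := finsum_congr fun η => by ring

theorem inv_generic {q t : F} (hqt : ∀ a b : ℕ, 1 ≤ a → q ^ a * t ^ b ≠ 1) (a b : ℕ)
    (ha : 1 ≤ a) : q⁻¹ ^ a * t⁻¹ ^ b ≠ 1 := by
  rw [inv_pow, inv_pow, ← mul_inv, Ne, inv_eq_one]
  exact hqt a b ha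

theorem ratio_inv (q t : F) (η : Comp m) (k : Fin m) :
    ratio q⁻¹ t⁻¹ η k = (ratio q t η k)⁻¹ := by
  rw [ratio, ratio, mul_inv, inv_pow, inv_pow]

/-- The matrix of `T_k` in the `x`-variables is, up to the coefficients of the kernel, the transpose
of the matrix of `T_k⁻¹` with inverted parameters in the `y`-variables. -/
theorem exists_T_E_coeffs {q t : F} (hq : q ≠ 0) (ht : t ≠ 0)
    (hqt : ∀ a b : ℕ, 1 ≤ a → q ^ a * t ^ b ≠ 1) (k : Fin m) :
    ∃ α β γ : Comp m → F, ∀ η,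
      T t k (E q t η) = α η • E q t η + β η • E q t (sw k η) ∧
      Tinv t⁻¹ k (E q⁻¹ t⁻¹ η) = α η • E q⁻¹ t⁻¹ η + γ η • E q⁻¹ t⁻¹ (sw k η) ∧
      kerCoeff q t η * β η = kerCoeff q t (sw k η) * γ (sw k η) := by
  have hq' := inv_ne_zero hq
  have ht' := inv_ne_zero ht
  have hqt' := inv_generic hqt
  -- `ρ` is the off-diagonal entry of `T_E_sw_of_lt`; it is invariant under inverting `q` and `t`.
  set ρ : Comp m → F := fun η => (1 - ratio q t η k / t) * (1 - t * ratio q t η k) /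
    (1 - ratio q t η k) ^ 2
  have hdiag : ∀ η : Comp m, η k.castSucc < η k.succ →
      t * diagCoeff q⁻¹ t⁻¹ η k = diagCoeff q t η k - t + 1 := fun η h => by
    have h₁ := ratio_ne_one hqt h
    have h₂ := ratio_ne_one hqt' h
    have h₃ : ratio q t η k ≠ 0 := mul_ne_zero (pow_ne_zero _ hq) (pow_ne_zero _ ht)
    have h₄ : ratio q t η k - 1 ≠ 0 := by rw [← neg_sub]; exact neg_ne_zero.2 h₁
    rw [diagCoeff, diagCoeff, ratio_inv]
    rw [ratio_inv] at h₂
    have e : 1 - (ratio q t η k)⁻¹ = -(1 - ratio q t η k) / ratio q t η k := by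
      field_simp
      ring
    rw [e]
    field_simp
    ring
  have hρ : ∀ η : Comp m, η k.castSucc < η k.succ →
      (1 - ratio q⁻¹ t⁻¹ η k / t⁻¹) * (1 - t⁻¹ * ratio q⁻¹ t⁻¹ η k) /
        (1 - ratio q⁻¹ t⁻¹ η k) ^ 2 = ρ η := fun η h => by
    have h₁ := ratio_ne_one hqt h
    have h₃ : ratio q t η k ≠ 0 := mul_ne_zero (pow_ne_zero _ hq) (pow_ne_zero _ ht)
    simp only [ρ, ratio_inv]
    have e : 1 - (ratio q t η k)⁻¹ = -(1 - ratio q t η k) / ratio q t η k := by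
      field_simp
      ring
    rw [e]
    field_simp
    ring
  have hTinv : ∀ f : Poly m F, Tinv t⁻¹ k f = (t - 1) • f + t • T t⁻¹ k f := fun f => by
    rw [Tinv, inv_inv]
    rfl
  refine ⟨fun η => if η k.castSucc < η k.succ then diagCoeff q t η k else
      if η k.succ < η k.castSucc then t - 1 - diagCoeff q t (sw k η) k else t,
    fun η => if η k.castSucc < η k.succ then t else
      if η k.succ < η k.castSucc then ρ (sw k η) else 0,
    fun η => if η k.castSucc < η k.succ then 1 else
      if η k.succ < η k.castSucc then t * ρ (sw k η) else 0, fun η => ?_⟩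
  rcases lt_trichotomy (η k.castSucc) (η k.succ) with h | h | h
  · simp only [sw_castSucc, sw_succ, sw_sw, if_pos h, if_neg h.not_gt]
    refine ⟨T_E_of_lt hq ht hqt h, ?_, ?_⟩
    · rw [hTinv, T_E_of_lt hq' ht' hqt' h, smul_add, smul_smul, smul_smul, hdiag η h,
        mul_inv_cancel₀ ht, ← add_assoc, ← add_smul]
      congr 2
      ring
    · rw [kerCoeff_sw ht hqt h]
      ring
  · simp only [sw_castSucc, sw_succ, h, lt_irrefl, if_false, zero_smul, add_zero, mul_zero,
      and_true]
    refine ⟨T_E_of_eq hq ht hqt h, ?_⟩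
    rw [hTinv, T_E_of_eq hq' ht' hqt' h, smul_smul, mul_inv_cancel₀ ht, ← add_smul]
    congr 1
    ring
  · simp only [sw_castSucc, sw_succ, if_pos h, if_neg h.not_gt]
    have h' : sw k η k.castSucc < sw k η k.succ := by rwa [sw_castSucc, sw_succ]
    have h₁ := T_E_sw_of_lt hq ht hqt h'
    have h₂ := T_E_sw_of_lt hq' ht' hqt' h'
    have h₃ := kerCoeff_sw ht hqt h'
    rw [sw_sw] at h₁ h₂ h₃
    refine ⟨h₁, ?_, ?_⟩
    · rw [hTinv, h₂, hρ _ h', smul_add, smul_smul, smul_smul, ← add_assoc, ← add_smul]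
      congr 2
      rw [mul_sub, hdiag _ h', mul_sub, mul_inv_cancel₀ ht]
      ring
    · rw [h₃]
      ring

theorem actX_T_kernel {q t : F} (hq : q ≠ 0) (ht : t ≠ 0)
    (hqt : ∀ a b : ℕ, 1 ≤ a → q ^ a * t ^ b ≠ 1) (k : Fin m) :
    actX (T t k) (kernel q t) = actY (Tinv t⁻¹ k) (kernel q t) := by
  obtain ⟨α, β, γ, h⟩ := exists_T_E_coeffs hq ht hqt k
  refine series_ext fun μ ν => ?_
  rw [coeff_actX_kernel, coeff_actY_kernel]
  have e₁ : ∀ η, kerCoeff q t η * ((T t k (E q t η)).coeff μ * (E q⁻¹ t⁻¹ η).coeff ν) =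
      kerCoeff q t η * α η * (E q t η).coeff μ * (E q⁻¹ t⁻¹ η).coeff ν +
      kerCoeff q t η * β η * (E q t (sw k η)).coeff μ * (E q⁻¹ t⁻¹ η).coeff ν := fun η => by
    rw [(h η).1, coeff_add, coeff_smul, coeff_smul, smul_eq_mul, smul_eq_mul]
    ring
  have e₂ : ∀ η, kerCoeff q t η * ((E q t η).coeff μ * (Tinv t⁻¹ k (E q⁻¹ t⁻¹ η)).coeff ν) =
      kerCoeff q t η * α η * (E q t η).coeff μ * (E q⁻¹ t⁻¹ η).coeff ν +
      kerCoeff q t η * γ η * (E q t η).coeff μ * (E q⁻¹ t⁻¹ (sw k η)).coeff ν := fun η => by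
    rw [(h η).2.1, coeff_add, coeff_smul, coeff_smul, smul_eq_mul, smul_eq_mul]
    ring
  have hx := finite_support_E (m := m) q t μ
  have hy := finite_support_E (m := m) q⁻¹ t⁻¹ ν
  have hα : (Function.support fun η => kerCoeff q t η * α η * (E q t η).coeff μ *
    (E q⁻¹ t⁻¹ η).coeff ν).Finite := hy.subset fun η hη => right_ne_zero_of_mul hη
  rw [finsum_congr e₁, finsum_congr e₂, finsum_add_distrib hα, finsum_add_distrib hα]
  · congr 1
    -- The off-diagonal terms correspond to each other under `η ↦ s_k η`.
    rw [← finsum_comp_equiv ⟨sw k, sw k, sw_sw k, sw_sw k⟩]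
    refine finsum_congr fun η => ?_
    simp only [Equiv.coe_fn_mk, sw_sw]
    have h₁ := (h (sw k η)).2.2
    rw [sw_sw] at h₁
    rw [h₁]
  · exact hx.subset fun η hη => right_ne_zero_of_mul (left_ne_zero_of_mul hη)
  · exact hy.subset fun η hη => right_ne_zero_of_mul hη

theorem actX_Tinv_kernel {q t : F} (hq : q ≠ 0) (ht : t ≠ 0)
    (hqt : ∀ a b : ℕ, 1 ≤ a → q ^ a * t ^ b ≠ 1) (k : Fin m) :
    actX (Tinv t k) (kernel q t) = actY (T t⁻¹ k) (kernel q t) := by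
  have rT := rowFinite_T t k
  have rTi := rowFinite_Tinv t k
  have h : kernel q t = actY (T t⁻¹ k) (actX (T t k) (kernel q t)) := by
    rw [actX_T_kernel hq ht hqt, actY_actY (rowFinite_T _ k) (rowFinite_Tinv _ k),
      T_mul_Tinv (inv_ne_zero ht)]
    refine series_ext fun μ ν => ?_
    rw [coeff_actY_kernel, coeff_kernel]
    rfl
  conv_lhs => rw [h]
  rw [← actX_actY rT (rowFinite_T _ k), actX_actX rTi rT, Tinv_mul_T ht, actX_one]

theorem actX_Φhat_kernel {q t : F} (hq : q ≠ 0) (ht : t ≠ 0)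
    (hqt : ∀ a b : ℕ, 1 ≤ a → q ^ a * t ^ b ≠ 1) :
    actX (Φhat q t) (kernel q t) = actY (Φ t⁻¹) (kernel (m := m) q t) := by
  refine series_ext fun μ ν => ?_
  -- On the left only the compositions `raise η` contribute: the other ones have last part `0`.
  rw [coeff_actX_kernel, coeff_actY_kernel, ← finsum_mem_univ, ← finsum_mem_inter_support_eq'
    (s := Set.range raise), finsum_mem_range raise_injective]
  · refine finsum_congr fun η => ?_
    rw [Φhat_E_raise hq ht hqt, Φ_E (inv_ne_zero hq) (inv_ne_zero ht) (inv_generic hqt), inv_inv,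
      coeff_smul, coeff_smul, smul_eq_mul, smul_eq_mul, ← kerCoeff_raise hqt η]
    ring
  · intro η hη
    refine ⟨fun _ => Set.mem_univ _, fun _ => ?_⟩
    have h : η (Fin.last m) ≠ 0 := fun h => hη (by
      simp only [Φhat_E_of_last_eq_zero hq ht hqt h, coeff_zero, zero_mul, mul_zero])
    obtain ⟨κ, hκ, -⟩ := exists_raise h
    exact ⟨κ, hκ⟩

theorem actX_prodUp_kernel {q t : F} (hq : q ≠ 0) (ht : t ≠ 0)
    (hqt : ∀ a b : ℕ, 1 ≤ a → q ^ a * t ^ b ≠ 1) {h : ℕ} (hm : h ≤ m) :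
    actX (prodUp (T t) 0 h) (kernel (m := m) q t) =
      actY (prodDown (Tinv t⁻¹) 0 h) (kernel q t) := by
  induction h with
  | zero =>
    rw [prodUp_of_le _ le_rfl, prodDown_of_le _ le_rfl]
    refine series_ext fun μ ν => ?_
    rw [coeff_actX_kernel, coeff_actY_kernel]
    rfl
  | succ p ih =>
    obtain ⟨k, rfl⟩ : ∃ k : Fin m, k.val = p := ⟨⟨p, hm⟩, rfl⟩
    have hU := rowFinite_prodUp (rowFinite_T t) (Nat.le_of_succ_le hm)
    have hV := rowFinite_prodDown (rowFinite_Tinv t⁻¹) (Nat.le_of_succ_le hm)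
    rw [prodUp_succ _ k (Nat.zero_le _), prodDown_succ _ k (Nat.zero_le _),
      ← actX_actX hU (rowFinite_T t k), actX_T_kernel hq ht hqt,
      actX_actY hU (rowFinite_Tinv t⁻¹ k), ih (Nat.le_of_succ_le hm),
      actY_actY (rowFinite_Tinv t⁻¹ k) hV]

/-- For `i = n` this is the identity for `Φ̂_q` with the factor `T_1 ⋯ T_{n-1}` cancelled. Downward
induction uses `D_i = t⁻¹ T_i D_{i+1} T_i` in `x` and the corresponding recursion for `y_i`. -/
theorem actX_D_kernel {q t : F} (hq : q ≠ 0) (ht : t ≠ 0)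
    (hqt : ∀ a b : ℕ, 1 ≤ a → q ^ a * t ^ b ≠ 1) (i : Fin (m + 1)) :
    actX (D q t i) (kernel q t) = actY (mulX i) (kernel q t) := by
  induction i using Fin.reverseInduction with
  | last =>
    have hU := rowFinite_prodUp (rowFinite_T t) (le_refl m)
    have hV := rowFinite_prodDown (rowFinite_Tinv t⁻¹) (le_refl m)
    have hW := rowFinite_prodDown (rowFinite_Tinv t) (le_refl m)
    have hD := rowFinite_D q ht (Fin.last m)
    have hX := rowFinite_mulX (F := F) (Fin.last m)
    have h : actX (prodUp (T t) 0 m) (actX (D q t (Fin.last m)) (kernel q t)) =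
        actX (prodUp (T t) 0 m) (actY (mulX (Fin.last m)) (kernel q t)) := by
      rw [actX_actX hU hD, ← Φhat, actX_Φhat_kernel hq ht hqt, Φ, ← actY_actY hX hV,
        ← actX_prodUp_kernel hq ht hqt le_rfl, actX_actY hU hX]
    have h' := congrArg (actX (prodDown (Tinv t) 0 m)) h
    rwa [actX_actX hW hU, actX_actX hW hU,
      prodDown_mul_prodUp (Tinv_mul_T ht) (Nat.zero_le m) le_rfl, actX_one, actX_one] at h'
  | cast k ih =>
    have rT := rowFinite_T t k
    have rV := rowFinite_Tinv t⁻¹ k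
    have rD := rowFinite_D q ht k.succ
    have rX := rowFinite_mulX (F := F) k.succ
    have hX : (mulX k.castSucc : Op m F) = t⁻¹ • (Tinv t⁻¹ k * mulX k.succ * Tinv t⁻¹ k) := by
      rw [Tinv_mul_mulX (inv_ne_zero ht), inv_inv, smul_mul_assoc, mul_assoc,
        T_mul_Tinv (inv_ne_zero ht), mul_one, smul_smul, inv_mul_cancel₀ ht, one_smul]
    rw [D_castSucc q ht, hX, actX_smul, actY_smul, ← actX_actX (rT.mul rD) rT,
      actX_T_kernel hq ht hqt, ← actX_actX rT rD, actX_actY rD rV, ih, actY_actY rV rX,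
      actX_actY rT (rV.mul rX), actX_T_kernel hq ht hqt, actY_actY (rV.mul rX) rV]

end QDunkl

end

theorem mainTheorem1 {F : Type*} [Field F] (m : ℕ) (q t : F) (hq : q ≠ 0) (ht : t ≠ 0)
    (hqt : ∀ a b : ℕ, 1 ≤ a → q ^ a * t ^ b ≠ 1) :
    -- the defining conditions of `E_η` determine a unique polynomial
    (∀ η : QDunkl.Comp m, ∃! P : QDunkl.Poly m F, QDunkl.IsMacdonald q t η P) ∧
    -- the division by `x_i` in the definition of `D_i` is exact
    (∀ (i : Fin (m + 1)) (f : QDunkl.Poly m F), MvPolynomial.X i ∣ QDunkl.xD q t i f) ∧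
    -- (a)
    (∀ k : Fin m,
      QDunkl.actX (QDunkl.T t k) (QDunkl.kernel q t) =
        QDunkl.actY (QDunkl.Tinv t⁻¹ k) (QDunkl.kernel q t) ∧
      QDunkl.actX (QDunkl.Tinv t k) (QDunkl.kernel q t) =
        QDunkl.actY (QDunkl.T t⁻¹ k) (QDunkl.kernel q t)) ∧
    -- (b)
    QDunkl.actX (QDunkl.Φhat q t) (QDunkl.kernel q t) =
      QDunkl.actY (QDunkl.Φ t⁻¹) (QDunkl.kernel (m := m) q t) ∧
    -- (c)
    (∀ i : Fin (m + 1),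
      QDunkl.actX (QDunkl.D q t i) (QDunkl.kernel q t) =
        MvPowerSeries.X (Sum.inr i) * QDunkl.kernel q t) := by
  refine ⟨fun η => ⟨QDunkl.E q t η, QDunkl.isMacdonald_E hq ht hqt η, fun P hP =>
    hP.unique hq ht hqt (QDunkl.isMacdonald_E hq ht hqt η)⟩,
    fun i => QDunkl.mulX_mul_D_iff.1 (QDunkl.mulX_mul_D q ht i),
    fun k => ⟨QDunkl.actX_T_kernel hq ht hqt k, QDunkl.actX_Tinv_kernel hq ht hqt k⟩,
    QDunkl.actX_Φhat_kernel hq ht hqt, fun i => ?_⟩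
  rw [QDunkl.actX_D_kernel hq ht hqt, QDunkl.actY_mulX]
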